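/- \textbf{Setting.} Let $\mathfrak g_0$ be a finite-dimensional nonabelian real Lie algebra, $\mathfrak g=\mathfrak g_0\otimes\mathbb C$, and $G_0$, $G$ connected Lie groups (real, resp. complex) with these Lie algebras, acting on $\mathfrak g^*$ by the coadjoint action. Fix a basis of $\mathfrak g_0$ with structure constants $c_{ij}^k$ and let $z=(z_1,\dots,z_n)$ be the corresponding complex coordinates on $\mathfrak g^*$; the bar is the conjugation defined by $\mathfrak g_0$. Let $c=c_{ij}^kz_k\,\partial_{z_i}\wedge\partial_{z_j}$ be the linear Poisson bivector on $\mathfrak g^*$, $R=\max_z\operatorname{rank}c(z)$, $r=n-R$, and $\operatorname{Sing}\mathfrak g^*=\{z:\operatorname{rank}c(z)<R\}$; assume $\operatorname{codim}_{\mathbb C}\operatorname{Sing}\mathfrak g^*\ge 3$. For $\lambda\in\mathbb C^2$ put $\phi_\lambda(z)=\lambda_1z+\lambda_2\bar z$, and let $\mathcal C=\{z:\phi_\lambda(z)\in\operatorname{Sing}\mathfrak g^*\text{ for some }\lambda\ne0\}$. For an open set $W$ let $Z^{hol}_c(W)$ be the set of holomorphic $g$ on $W$ with $\sum_i\frac{\partial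 g}{\partial z_i}\,c_{ij}^kz_k=0$ for all $j$. An open set $W\subset\mathfrak g^*\setminus\operatorname{Sing}\mathfrak g^*$ is \emph{admissible} if there are $g_1,\dots,g_r\in Z_c^{hol}(W)$ whose differentials are linearly independent at every point of $W$. A set $U\subset\mathfrak g^*\setminus\mathcal C$ is \emph{strongly admissible} if for every $\lambda\ne0$ the set $\phi_\lambda(U)$ has an admissible neighbourhood; choose such neighbourhoods $U_\lambda$. A smooth complex-valued function is \emph{functionally generated} by a family $S$ if at every point its differential is a complex linear combination of differentials of members of $S$. For $U$ open in $\mathfrak g^*$, $F_1(U)$ is the set of smooth functions $U\to\mathbb C$ functionally generated by the functions $g$ and $\tilde g=\sum_i\overline{(\partial g/\partial z_i)}\,z_i$ with $g\in Z_c^{hol}(U)$, and $g\circ\phi_\lambda|_U$ with $\lambda_1,\lambda_2\ne0$, $g\in Z_c^{hol}(U_\lambda)$. For $U$ open in a $G$-orbit, $F_1(U)$ is the set of smooth functions on the manifold $U$ functionally generated by the restrictions to $U$ of the same functions, with $Z_c^{hol}(U)$ replaced by $Z_c^{hol}(V)$ for a chosen admissible neighbourhood $V$ of $U$ in $\mathfrak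 g^*$. \textbf{Proposition.} (i) Let $U\subset\mathfrak g^*$ be open and strongly admissible. Then every function in $F_1(U)$ is $G_0$-invariant: it is constant on the connected components (in the orbit topology) of the intersections of $U$ with the $G_0$-orbits; so if $U$ is $G_0$-invariant, then $f(g\cdot z)=f(z)$ for all $f\in F_1(U)$, $g\in G_0$, $z\in U$. (ii) Let $U$ be an open subset of a $G$-orbit $M\subset\mathfrak g^*$ ($M$ with its structure of an immersed submanifold) such that $U'=U/G_0$ is a smooth manifold; that is, there is a surjective submersion $p:U\to U'$ whose fibres are the connected components of the intersections of $U$ with the $G_0$-orbits (these fibres are the $G_0$-orbits if $U$ is $G_0$-invariant). Assume that $U$ is strongly admissible. Then $c|_U$ and $\bar c|_U$ have push-forwards $c'$, $\bar c'$ under $p$. Let $J'=\{\lambda_1c'+\lambda_2\bar c':\lambda\in\mathbb C^2\}$, let $J'_0\subset J'$ be the set of bivectors of maximal rank (the rank of a bivector field being the maximum of its pointwise ranks), and let $F'_0(U')=\sum_{b\in J'_0}Z_b(U')$ be the space of first integrals, where $Z_b(U')$ is the space of smooth complex-valued Casimir functions of $b$ on $U'$. Then the functions on $U'$ functionally generated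 by $F_0'(U')$ are exactly the functions of $F_1(U)$ regarded as functions on $U'$: the map $f\mapsto f\circ p$ is a bijection from the former set onto $F_1(U)$. This holds for all choices of $V$ and of the $U_\lambda$. -/

import Mathlib

open scoped Manifold ContDiff Matrix ComplexConjugate

noncomputable section

/-! ### Complex functions, covectors and bivectors on a smooth manifold -/

section Manifold

variable {B : Type*} [NormedAddCommGroup B] [NormedSpace ℝ B]
  {H : Type*} [TopologicalSpace H] (I : ModelWithCorners ℝ B H)
  {M : Type*} [TopologicalSpace M] [ChartedSpace H M]
  {B' : Type*} [NormedAddCommGroup B'] [NormedSpace ℝ B']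
  {H' : Type*} [TopologicalSpace H'] (I' : ModelWithCorners ℝ B' H')
  {M' : Type*} [TopologicalSpace M'] [ChartedSpace H' M']

/-- The complexified cotangent space at `x`: real-linear maps from the tangent space to `ℂ`. -/
abbrev ComplexCotangent (x : M) : Type _ := TangentSpace I x →L[ℝ] ℂ

/-- The differential at `x` of a complex-valued function. -/
def cdiff (f : M → ℂ) (x : M) : ComplexCotangent I x := mfderiv I 𝓘(ℝ, ℂ) f x

/-- The smooth functions on `U` functionally generated by the family `S`: at every point of `U`
their differential is a complex linear combination of the differentials of members of `S`. -/
def functionallyGenerated (U : Set M) (S : Set (M → ℂ)) : Set (M → ℂ) :=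
  {f | ContMDiffOn I 𝓘(ℝ, ℂ) ∞ f U ∧
    ∀ x ∈ U, cdiff I f x ∈ Submodule.span ℂ ((fun s => cdiff I s x) '' S)}

variable (M) in
/-- Fields of complex bilinear forms on the complexified cotangent spaces; complex bivector fields
are regarded as such fields (the ones used below are skew-symmetric). -/
abbrev BivectorField : Type _ :=
  ∀ x : M, ComplexCotangent I x →ₗ[ℂ] ComplexCotangent I x →ₗ[ℂ] ℂ

variable {I I'} in
/-- `b'` is the push-forward of `b` under `h`, that is `b' (h x) = (∧² h_*) (b x)` for all `x`. -/
def IsPushforward (h : M → M') (b : BivectorField I M) (b' : BivectorField I' M') : Prop :=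
  ∀ (x : M) (α β : ComplexCotangent I' (h x)),
    b' (h x) α β =
      b x (ContinuousLinearMap.comp α (mfderiv I I' h x))
        (ContinuousLinearMap.comp β (mfderiv I I' h x))

variable {I}

/-- The rank of a bivector field: the maximum over all points of the rank of its sharp map. -/
def bivectorRank (b : BivectorField I M) : ℕ :=
  ⨆ x : M, Module.finrank ℂ (LinearMap.range (b x))

/-- The members of maximal rank of a linear family of bivector fields. -/
def maximalRankPart (J : Submodule ℂ (BivectorField I M)) : Set (BivectorField I M) :=
  {b | b ∈ J ∧ ∀ b' ∈ J, bivectorRank b' ≤ bivectorRank b}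

/-- The smooth complex-valued Casimir functions of a bivector field. -/
def casimirs (b : BivectorField I M) : Set (M → ℂ) :=
  {f | ContMDiff I 𝓘(ℝ, ℂ) ∞ f ∧ ∀ x, b x (cdiff I f x) = 0}

/-- The sum of the spaces of Casimir functions of the members of maximal rank of `J`. -/
def firstIntegrals (J : Submodule ℂ (BivectorField I M)) : Submodule ℂ (M → ℂ) :=
  Submodule.span ℂ (⋃ b ∈ maximalRankPart J, casimirs b)

end Manifold

/-! ### The dual of a complexified Lie algebra

`𝔤₀` is a real Lie algebra with basis `e`, `𝔤 = 𝔤₀ ⊗ ℂ`. Elements of `𝔤` and of `𝔤*` are written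
in the complex coordinates `ι → ℂ` given by `e` and its dual basis; the complex conjugations
defined by `𝔤₀` are then coordinatewise. -/

section Lie

variable {ι : Type*} [Fintype ι] [DecidableEq ι] {𝔤₀ : Type*} [LieRing 𝔤₀] [LieAlgebra ℝ 𝔤₀]
  (e : Module.Basis ι ℝ 𝔤₀)

/-- `[e i, e j] = ∑ k, (structureConstant e i j k) • e k`. -/
def structureConstant (i j k : ι) : ℝ := e.repr ⁅e i, e j⁆ k

/-- The coefficients `c_{ij}(z) = ∑ k, c_{ij}^k z_k` of the linear Poisson bivector on `𝔤*`. -/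
def poissonMatrix (z : ι → ℂ) : Matrix ι ι ℂ :=
  Matrix.of fun i j => ∑ k, (structureConstant e i j k : ℂ) * z k

/-- The maximal rank of the linear Poisson bivector. -/
def genericRank : ℕ := ⨆ z : ι → ℂ, (poissonMatrix e z).rank

/-- The rank of the Lie algebra `𝔤`: the corank of its linear Poisson bivector. -/
def lieRank : ℕ := Fintype.card ι - genericRank e

/-- The union of the symplectic leaves of nonmaximal dimension. -/
def singSet : Set (ι → ℂ) := {z | (poissonMatrix e z).rank < genericRank e}

/-- `φ_λ (z) = λ₁ z + λ₂ z̄`. -/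
def phi (l : ℂ × ℂ) (z : ι → ℂ) : ι → ℂ := fun i => l.1 * z i + l.2 * conj (z i)

/-- The incompleteness set. -/
def incompletenessSet : Set (ι → ℂ) := {z | ∃ l : ℂ × ℂ, l ≠ 0 ∧ phi l z ∈ singSet e}

/-- The partial derivative `∂g/∂z_i` of a holomorphic function. -/
def holPartial (g : (ι → ℂ) → ℂ) (i : ι) (z : ι → ℂ) : ℂ := fderiv ℂ g z (Pi.single i 1)

/-- The holomorphic Casimir functions over `W` of the linear Poisson bivector. -/
def holCasimirs (W : Set (ι → ℂ)) : Set ((ι → ℂ) → ℂ) :=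
  {g | DifferentiableOn ℂ g W ∧
    ∀ z ∈ W, ∀ j, ∑ i, holPartial g i z * poissonMatrix e z i j = 0}

/-- Admissible sets. -/
def IsAdmissible (W : Set (ι → ℂ)) : Prop :=
  IsOpen W ∧ Disjoint W (singSet e) ∧
    ∃ g : Fin (lieRank e) → (ι → ℂ) → ℂ, (∀ a, g a ∈ holCasimirs e W) ∧
      ∀ z ∈ W, LinearIndependent ℂ fun a => fderiv ℂ (g a) z

/-- Strong admissibility, for subsets of `𝔤*` that need not be open in `𝔤*`. -/
def IsStronglyAdmissible (U : Set (ι → ℂ)) : Prop :=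
  Disjoint U (incompletenessSet e) ∧
    ∀ l : ℂ × ℂ, l ≠ 0 → ∃ W, IsAdmissible e W ∧ phi l '' U ⊆ W

/-- `g̃ = ∑ i, conj (∂g/∂z_i) z_i`. -/
def tildeFun (g : (ι → ℂ) → ℂ) (z : ι → ℂ) : ℂ := ∑ i, conj (holPartial g i z) * z i

/-- The generators of `F_1`, pulled back along `j : M → 𝔤*` (an inclusion in the applications).
`V` is a neighbourhood of `U = j(M)` and `W l` a neighbourhood of `φ_l(U)`. -/
def F1Generators {M : Type*} (j : M → ι → ℂ) (V : Set (ι → ℂ)) (W : ℂ × ℂ → Set (ι → ℂ)) :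
    Set (M → ℂ) :=
  {f | ∃ g ∈ holCasimirs e V, f = g ∘ j} ∪ {f | ∃ g ∈ holCasimirs e V, f = tildeFun g ∘ j} ∪
    {f | ∃ l : ℂ × ℂ, l.1 ≠ 0 ∧ l.2 ≠ 0 ∧ ∃ g ∈ holCasimirs e (W l), f = g ∘ phi l ∘ j}

/-! ### Coadjoint actions -/

/-- The matrix of `ad* v : 𝔤* → 𝔤*`, `(ad* v z)(u) = z([v, u])`. -/
def coadMatrix (v : ι → ℂ) : Matrix ι ι ℂ :=
  Matrix.of fun j k => ∑ i, v i * (structureConstant e i j k : ℂ)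

/-- `exp (ad* v)` for `v ∈ 𝔤`. -/
def coadExp (v : ι → ℂ) : Matrix ι ι ℂ := NormedSpace.exp (coadMatrix e v)

/-- `exp (ad* (t x))` for `x ∈ 𝔤₀` and real `t`. -/
def realCoadExp (x : ι → ℝ) (t : ℝ) : Matrix ι ι ℂ := coadExp e fun i => ((t * x i : ℝ) : ℂ)

/-- The group of transformations of `𝔤*` by which a connected complex Lie group `G` with Lie
algebra `𝔤` acts: it is generated by the `exp (ad* v)`, a set closed under inversion. -/
def coadjointGroup : Submonoid (Matrix ι ι ℂ) := Submonoid.closure (Set.range (coadExp e))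

/-- The same for a connected Lie group `G₀` with Lie algebra `𝔤₀`, acting on `𝔤*`. -/
def realCoadjointGroup : Submonoid (Matrix ι ι ℂ) :=
  Submonoid.closure (Set.range fun x : ι → ℝ => realCoadExp e x 1)

/-- The `G`-orbit of `z`. -/
def complexOrbit (z : ι → ℂ) : Set (ι → ℂ) := {w | ∃ A ∈ coadjointGroup e, w = A *ᵥ z}

/-- The tangent space at `z` of the `G`-orbit of `z`. -/
def complexOrbitTangent (z : ι → ℂ) : Set (ι → ℂ) := Set.range fun v => coadMatrix e v *ᵥ z

/-- The tangent space at `z` of the `G₀`-orbit of `z`. -/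
def realOrbitTangent (z : ι → ℂ) : Set (ι → ℂ) :=
  Set.range fun x : ι → ℝ => coadMatrix e (fun i => (x i : ℂ)) *ᵥ z

/-- `w` is obtained from `z` by moving inside `U` along a one-parameter subgroup of `G₀`. -/
def RealStep (U : Set (ι → ℂ)) (z w : ι → ℂ) : Prop :=
  ∃ x : ι → ℝ, (∀ t ∈ Set.Icc (0 : ℝ) 1, realCoadExp e x t *ᵥ z ∈ U) ∧ w = realCoadExp e x 1 *ᵥ z

/-- `z` and `w` lie on one connected piece of a `G₀`-orbit in `U`. If `U` is `G₀`-invariant, this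
says that `w` belongs to the `G₀`-orbit of `z`. -/
def SameRealOrbitIn (U : Set (ι → ℂ)) : (ι → ℂ) → (ι → ℂ) → Prop :=
  Relation.ReflTransGen (RealStep e U)

/-- `f` is constant on the connected pieces of the `G₀`-orbits in `U`. -/
def IsRealInvariantOn (U : Set (ι → ℂ)) (f : (ι → ℂ) → ℂ) : Prop :=
  ∀ z ∈ U, ∀ w, SameRealOrbitIn e U z w → f w = f z

/-- The linear map `α ↦ α(v)` on covectors. -/
def evalCovector (v : ι → ℂ) : ((ι → ℂ) →L[ℝ] ℂ) →ₗ[ℂ] ℂ where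
  toFun α := α v
  map_add' _ _ := rfl
  map_smul' _ _ := rfl

/-- `α ↦ α(∂/∂z_i)`. -/
def dz (i : ι) : ((ι → ℂ) →L[ℝ] ℂ) →ₗ[ℂ] ℂ :=
  (1 / 2 : ℂ) • (evalCovector (Pi.single i 1) - Complex.I • evalCovector (Pi.single i Complex.I))

/-- `α ↦ α(∂/∂z̄_i)`. -/
def dzbar (i : ι) : ((ι → ℂ) →L[ℝ] ℂ) →ₗ[ℂ] ℂ :=
  (1 / 2 : ℂ) • (evalCovector (Pi.single i 1) + Complex.I • evalCovector (Pi.single i Complex.I))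

/-- The linear Poisson bivector `c = c_{ij}^k z_k ∂/∂z_i ∧ ∂/∂z_j` on `𝔤*`. -/
def lieBivector : BivectorField 𝓘(ℝ, ι → ℂ) (ι → ℂ) := fun z =>
  ∑ i, ∑ j, poissonMatrix e z i j • (dz i).smulRight (dz j)

/-- The complex conjugate of `c`. -/
def lieBivectorConj : BivectorField 𝓘(ℝ, ι → ℂ) (ι → ℂ) := fun z =>
  ∑ i, ∑ j, conj (poissonMatrix e z i j) • (dzbar i).smulRight (dzbar j)

section Reduction

variable {d m : ℕ} {X : Type*} [TopologicalSpace X] [ChartedSpace (EuclideanSpace ℝ (Fin d)) X]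
  {N : Type*} [TopologicalSpace N] [ChartedSpace (EuclideanSpace ℝ (Fin m)) N]

/-- The manifold `X`, with the inclusion `j`, is an open subset of the `G`-orbit of `z₀`, the orbit
having its structure of an immersed submanifold: `j` is an injective immersion into the orbit,
onto whose tangent spaces it maps those of `X`. -/
structure IsOpenInOrbit (z₀ : ι → ℂ) (j : X → ι → ℂ) : Prop where
  smooth : ContMDiff (𝓡 d) 𝓘(ℝ, ι → ℂ) ∞ j
  injective : Function.Injective j
  mem_orbit : ∀ x, j x ∈ complexOrbit e z₀
  immersion : ∀ x, Function.Injective (mfderiv (𝓡 d) 𝓘(ℝ, ι → ℂ) j x)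
  tangent : ∀ x, Set.range (mfderiv (𝓡 d) 𝓘(ℝ, ι → ℂ) j x) = complexOrbitTangent e (j x)

/-- The manifold `N` is the quotient `U/G₀` of `U = j(X)`, with canonical projection `p`: a
surjective submersion whose fibres are, as sets and as submanifolds, the (connected pieces in `U`
of the) `G₀`-orbits. -/
structure IsRealOrbitQuotient (j : X → ι → ℂ) (p : X → N) : Prop where
  smooth : ContMDiff (𝓡 d) (𝓡 m) ∞ p
  surjective : Function.Surjective p
  submersion : ∀ x, Function.Surjective (mfderiv (𝓡 d) (𝓡 m) p x)
  fibre : ∀ x y, p x = p y ↔ SameRealOrbitIn e (Set.range j) (j x) (j y)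
  fibre_tangent : ∀ (x : X) (v : TangentSpace (𝓡 d) x),
    mfderiv (𝓡 d) (𝓡 m) p x v = 0 ↔
      mfderiv (𝓡 d) 𝓘(ℝ, ι → ℂ) j x v ∈ realOrbitTangent e (j x)

/-- `c₁`, `c₂` are the reductions to `N` of the restrictions to `X` of `c` and of its conjugate:
there are bivector fields on `X` whose images under `j` are `c` and its conjugate (they are unique
if `j` is an immersion) and whose push-forwards under `p` are `c₁`, `c₂`. -/
def IsReduction (j : X → ι → ℂ) (p : X → N) (c₁ c₂ : BivectorField (𝓡 m) N) : Prop :=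
  ∃ b₁ b₂ : BivectorField (𝓡 d) X,
    IsPushforward j b₁ (lieBivector e) ∧ IsPushforward j b₂ (lieBivectorConj e) ∧
      IsPushforward p b₁ c₁ ∧ IsPushforward p b₂ c₂

end Reduction

end Lie

end

set_option linter.unusedSectionVars false

/-! ### The linear Poisson bivector in coordinates -/

section Algebra

variable {ι : Type*} [Fintype ι] [DecidableEq ι] {𝔤₀ : Type*} [LieRing 𝔤₀] [LieAlgebra ℝ 𝔤₀]
  (e : Module.Basis ι ℝ 𝔤₀)

/-! A complex covector at z is a pair (a, b) of holomorphic and antiholomorphic coefficients. Put C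
= `poissonMatrix e z` and D = `poissonMatrix e (star z)`. The covector annihilates the real orbit
iff C a + D b = 0, and the complex orbit iff C a = 0 and D b = 0, so the complexified cotangent
space of the quotient is the first space of pairs modulo the second (`IsPencilReduction`). There the
member of the reduced pencil with parameters (l₁, l₂) reads l₁ a·C a' + l₂ b·D b'. By skew-symmetry
its kernel, for l₁ ≠ 0, consists of the classes with C a = C t for some t in the kernel of l₂ C + l₁
D (`form_eq_zero_iff`); the case l₁ = 0 is symmetric.

Now l₂ C + l₁ D is the Poisson matrix at φ_(l₂, l₁)(z), and by admissibility its kernel is spanned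
by gradients of local Casimir functions g. For l₁, l₂ ≠ 0 this yields the differentials of g ∘
φ_(l₂, l₁). For l₂ = 0 it yields those of g̃. For l₁ = 0 it yields those of the conjugate of g̃,
which is not a generator; along the orbit its differential is the derivative at ε = 0 of the
differentials of g ∘ φ_(1, ε), hence lies in the same finite-dimensional span
(`restrictedCovector_mem_of_hol`). Conversely each generator has its differential in one of these
kernels (`form_eq_zero`); g itself is stationary on complex orbits.

Off the incompleteness set all these Poisson matrices have kernels of one dimension. A dimension
count (`finrank_ker_left`) then shows that at each point all nonzero parameters give the same rank,
so every nonzero parameter gives a member of maximal rank and the two families of differentials span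
the same spaces.

Invariance and descent rest on one principle: a function that locally extends to one with zero
derivative along real orbits is constant on their connected pieces (`eq_of_sameRealOrbitIn`). For
the generators the derivative vanishes by the Casimir equation and its first derivative; for the
reduced brackets it vanishes by the Jacobi identity (`fderiv_poisson_pairing_eq_zero`). -/

theorem structureConstant_skew (i j k : ι) :
    structureConstant e j i k = -structureConstant e i j k := by
  unfold structureConstant
  rw [← lie_skew, map_neg, Finsupp.neg_apply]

theorem sum_structureConstant_smul (i j : ι) :
    ∑ k, structureConstant e i j k • e k = ⁅e i, e j⁆ := e.sum_repr _

/-- The Jacobi identity in terms of structure constants. -/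
theorem structureConstant_jacobi (a i j l : ι) :
    ∑ k, structureConstant e i j k * structureConstant e a k l =
      ∑ k, structureConstant e a i k * structureConstant e k j l +
        ∑ k, structureConstant e a j k * structureConstant e i k l := by
  have h := leibniz_lie (e a) (e i) (e j)
  rw [← sum_structureConstant_smul e i j, ← sum_structureConstant_smul e a i,
    ← sum_structureConstant_smul e a j] at h
  simp only [lie_sum, sum_lie, lie_smul, smul_lie] at h
  have h' := congrArg (fun v => e.repr v l) h
  simpa [structureConstant] using h'

theorem poissonMatrix_transpose (z : ι → ℂ) : (poissonMatrix e z)ᵀ = -poissonMatrix e z := by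
  ext i j
  simp only [poissonMatrix, Matrix.transpose_apply, Matrix.of_apply, Matrix.neg_apply,
    ← Finset.sum_neg_distrib]
  refine Finset.sum_congr rfl fun k _ => ?_
  rw [structureConstant_skew]
  push_cast
  ring

theorem poissonMatrix_apply_skew (z : ι → ℂ) (i j : ι) :
    poissonMatrix e z j i = -poissonMatrix e z i j :=
  congrFun (congrFun (poissonMatrix_transpose e z) i) j

theorem vecMul_poissonMatrix (z v : ι → ℂ) : v ᵥ* poissonMatrix e z = -(poissonMatrix e z *ᵥ v) := by
  rw [← Matrix.mulVec_transpose, poissonMatrix_transpose, Matrix.neg_mulVec]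

theorem dotProduct_poissonMatrix_comm (z v w : ι → ℂ) :
    v ⬝ᵥ poissonMatrix e z *ᵥ w = -(poissonMatrix e z *ᵥ v ⬝ᵥ w) := by
  rw [Matrix.dotProduct_mulVec, vecMul_poissonMatrix, neg_dotProduct]

theorem poissonMatrix_star (z : ι → ℂ) (i j : ι) :
    poissonMatrix e (star z) i j = conj (poissonMatrix e z i j) := by
  simp [poissonMatrix, map_sum]

theorem poissonMatrix_star_mulVec (z v : ι → ℂ) :
    poissonMatrix e (star z) *ᵥ star v = star (poissonMatrix e z *ᵥ v) := by
  ext i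
  simp [Matrix.mulVec, dotProduct, poissonMatrix_star]

theorem poissonMatrix_add (z w : ι → ℂ) :
    poissonMatrix e (z + w) = poissonMatrix e z + poissonMatrix e w := by
  ext i j
  simp [poissonMatrix, mul_add, Finset.sum_add_distrib]

theorem poissonMatrix_smul (a : ℂ) (z : ι → ℂ) :
    poissonMatrix e (a • z) = a • poissonMatrix e z := by
  ext i j
  simp only [poissonMatrix, Matrix.of_apply, Pi.smul_apply, smul_eq_mul, Matrix.smul_apply,
    Finset.mul_sum]
  exact Finset.sum_congr rfl fun k _ => by ring

theorem phi_eq (l : ℂ × ℂ) (z : ι → ℂ) : phi l z = l.1 • z + l.2 • star z := by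
  ext i; simp [phi]

/-- Linearity of the Poisson structure: the pencil of the two matrices at z consists of values of
the single matrix function at the points φ_l(z). This is what links the pencil to Casimir functions
near φ_l(z). -/
theorem poissonMatrix_phi (l : ℂ × ℂ) (z : ι → ℂ) :
    poissonMatrix e (phi l z) = l.1 • poissonMatrix e z + l.2 • poissonMatrix e (star z) := by
  rw [phi_eq, poissonMatrix_add, poissonMatrix_smul, poissonMatrix_smul]

theorem coadMatrix_mulVec (v z : ι → ℂ) :
    coadMatrix e v *ᵥ z = v ᵥ* poissonMatrix e z := by
  ext j
  simp only [coadMatrix, Matrix.mulVec, dotProduct, Matrix.vecMul, poissonMatrix, Matrix.of_apply,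
    Finset.sum_mul, Finset.mul_sum]
  rw [Finset.sum_comm]
  exact Finset.sum_congr rfl fun k _ => Finset.sum_congr rfl fun l _ => by ring

theorem coadMatrix_mulVec_eq_neg (v z : ι → ℂ) :
    coadMatrix e v *ᵥ z = -(poissonMatrix e z *ᵥ v) := by
  rw [coadMatrix_mulVec, vecMul_poissonMatrix]

/-- Invariance of the linear Poisson bivector. -/
theorem poissonMatrix_coadMatrix_mulVec (v z : ι → ℂ) :
    poissonMatrix e (coadMatrix e v *ᵥ z) =
      coadMatrix e v * poissonMatrix e z + poissonMatrix e z * (coadMatrix e v)ᵀ := by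
  ext i j
  -- The Jacobi identity; below, all three matrix entries are expanded over the monomials v a * z l
  -- so that it compares their coefficients.
  have key (a l : ι) : (∑ k, (structureConstant e i j k : ℂ) * structureConstant e a k l) =
      ∑ k, (structureConstant e a i k : ℂ) * structureConstant e k j l +
        ∑ k, (structureConstant e a j k : ℂ) * structureConstant e i k l := by
    exact_mod_cast structureConstant_jacobi e a i j l
  have h1 : poissonMatrix e (coadMatrix e v *ᵥ z) i j =
      ∑ a, ∑ l, v a * z l * ∑ k, (structureConstant e i j k : ℂ) * structureConstant e a k l := by
    simp only [poissonMatrix, coadMatrix, Matrix.mulVec, dotProduct, Matrix.of_apply,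
      Finset.mul_sum, Finset.sum_mul]
    calc _ = ∑ k, ∑ a, ∑ l, _ := Finset.sum_congr rfl fun k _ => Finset.sum_comm
      _ = ∑ a, ∑ k, ∑ l, _ := Finset.sum_comm
      _ = _ := Finset.sum_congr rfl fun a _ => by
        rw [Finset.sum_comm]
        exact Finset.sum_congr rfl fun l _ => Finset.sum_congr rfl fun k _ => by ring
  have h2 : (coadMatrix e v * poissonMatrix e z) i j =
      ∑ a, ∑ l, v a * z l * ∑ k, (structureConstant e a i k : ℂ) * structureConstant e k j l := by
    simp only [poissonMatrix, coadMatrix, Matrix.mul_apply, Matrix.of_apply,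
      Finset.mul_sum, Finset.sum_mul]
    calc _ = ∑ k, ∑ a, ∑ l, _ := Finset.sum_congr rfl fun k _ => Finset.sum_comm
      _ = ∑ a, ∑ k, ∑ l, _ := Finset.sum_comm
      _ = _ := Finset.sum_congr rfl fun a _ => by
        rw [Finset.sum_comm]
        exact Finset.sum_congr rfl fun l _ => Finset.sum_congr rfl fun k _ => by ring
  have h3 : (poissonMatrix e z * (coadMatrix e v)ᵀ) i j =
      ∑ a, ∑ l, v a * z l * ∑ k, (structureConstant e a j k : ℂ) * structureConstant e i k l := by
    simp only [poissonMatrix, coadMatrix, Matrix.mul_apply, Matrix.of_apply,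
      Matrix.transpose_apply, Finset.mul_sum, Finset.sum_mul]
    calc _ = ∑ a, ∑ k, ∑ l, _ := Finset.sum_comm
      _ = _ := Finset.sum_congr rfl fun a _ => by
        rw [Finset.sum_comm]
        exact Finset.sum_congr rfl fun l _ => Finset.sum_congr rfl fun k _ => by ring
  rw [Matrix.add_apply, h1, h2, h3, ← Finset.sum_add_distrib]
  refine Finset.sum_congr rfl fun a _ => ?_
  rw [← Finset.sum_add_distrib]
  exact Finset.sum_congr rfl fun l _ => by rw [key, mul_add]

/-! ### Covectors in coordinates -/

/-- The coefficients of a covector with respect to the `dz_i`. -/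
noncomputable def holCoeff : ((ι → ℂ) →L[ℝ] ℂ) →ₗ[ℂ] (ι → ℂ) := LinearMap.pi dz

/-- The coefficients of a covector with respect to the `dz̄_i`. -/
noncomputable def antiholCoeff : ((ι → ℂ) →L[ℝ] ℂ) →ₗ[ℂ] (ι → ℂ) := LinearMap.pi dzbar

theorem holCoeff_apply (α : (ι → ℂ) →L[ℝ] ℂ) (i : ι) : holCoeff α i =
    1 / 2 * (α (Pi.single i 1) - Complex.I * α (Pi.single i Complex.I)) := rfl

theorem antiholCoeff_apply (α : (ι → ℂ) →L[ℝ] ℂ) (i : ι) : antiholCoeff α i =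
    1 / 2 * (α (Pi.single i 1) + Complex.I * α (Pi.single i Complex.I)) := rfl

theorem covector_apply (α : (ι → ℂ) →L[ℝ] ℂ) (w : ι → ℂ) :
    α w = holCoeff α ⬝ᵥ w + antiholCoeff α ⬝ᵥ star w := by
  have hw : w = ∑ i, ((w i).re • (Pi.single i 1 : ι → ℂ) +
      (w i).im • (Pi.single i Complex.I : ι → ℂ)) := by
    ext j
    simp only [Finset.sum_apply, Pi.add_apply, Pi.smul_apply, Pi.single_apply]
    simp [Complex.re_add_im, Finset.sum_add_distrib]
  conv_lhs => rw [hw]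
  simp only [map_sum, map_add, map_smul, dotProduct, ← Finset.sum_add_distrib, Pi.star_apply]
  refine Finset.sum_congr rfl fun i _ => ?_
  rw [holCoeff_apply, antiholCoeff_apply]
  have h1 : w i = (w i).re + (w i).im * Complex.I := (Complex.re_add_im _).symm
  have h2 : star (w i) = (w i).re - (w i).im * Complex.I := by
    apply Complex.ext <;> simp
  rw [h2]
  nth_rw 3 [h1]
  simp only [Complex.real_smul]
  linear_combination ((w i).im * α (Pi.single i Complex.I)) * Complex.I_mul_I

theorem star_single_one (i : ι) : star (Pi.single i 1 : ι → ℂ) = Pi.single i 1 := by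
  rw [← Pi.single_star, star_one]

theorem star_single_I (i : ι) :
    star (Pi.single i Complex.I : ι → ℂ) = Pi.single i (-Complex.I) := by
  rw [← Pi.single_star]
  simp

/-- The covector with given coefficients. -/
noncomputable def ofCoeff (a b : ι → ℂ) : (ι → ℂ) →L[ℝ] ℂ :=
  LinearMap.toContinuousLinearMap
    { toFun := fun w => a ⬝ᵥ w + b ⬝ᵥ star w
      map_add' := fun v w => by simp only [star_add, dotProduct_add]; ring
      map_smul' := fun c w => by
        have : star (c • w) = c • star w := by ext i; simp
        simp only [this, dotProduct_smul, RingHom.id_apply, smul_add] }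

theorem ofCoeff_apply (a b w : ι → ℂ) : ofCoeff a b w = a ⬝ᵥ w + b ⬝ᵥ star w := rfl

theorem holCoeff_ofCoeff (a b : ι → ℂ) : holCoeff (ofCoeff a b) = a := by
  ext i
  rw [holCoeff_apply, ofCoeff_apply, ofCoeff_apply, star_single_one, star_single_I]
  simp only [dotProduct_single]
  linear_combination (-1 / 2 * a i + 1 / 2 * b i) * Complex.I_mul_I

theorem antiholCoeff_ofCoeff (a b : ι → ℂ) : antiholCoeff (ofCoeff a b) = b := by
  ext i
  rw [antiholCoeff_apply, ofCoeff_apply, ofCoeff_apply, star_single_one, star_single_I]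
  simp only [dotProduct_single]
  linear_combination (1 / 2 * a i - 1 / 2 * b i) * Complex.I_mul_I

theorem sum_smulRight_apply {E : Type*} [AddCommGroup E] [Module ℂ E] (A : Matrix ι ι ℂ)
    (f : ι → E →ₗ[ℂ] ℂ) (α β : E) :
    (∑ i, ∑ j, A i j • (f i).smulRight (f j)) α β =
      (fun i => f i α) ⬝ᵥ A *ᵥ (fun i => f i β) := by
  simp only [LinearMap.sum_apply, LinearMap.smul_apply, LinearMap.smulRight_apply, dotProduct,
    Matrix.mulVec, Finset.mul_sum, smul_eq_mul]
  exact Finset.sum_congr rfl fun i _ => Finset.sum_congr rfl fun j _ => by ring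

theorem lieBivector_apply (z : ι → ℂ) (α β : (ι → ℂ) →L[ℝ] ℂ) :
    lieBivector e z α β = holCoeff α ⬝ᵥ poissonMatrix e z *ᵥ holCoeff β :=
  sum_smulRight_apply (poissonMatrix e z) dz α β

theorem lieBivectorConj_apply (z : ι → ℂ) (α β : (ι → ℂ) →L[ℝ] ℂ) :
    lieBivectorConj e z α β =
      antiholCoeff α ⬝ᵥ poissonMatrix e (star z) *ᵥ antiholCoeff β := by
  have h : poissonMatrix e (star z) = (poissonMatrix e z).map conj := by
    ext i j
    rw [poissonMatrix_star, Matrix.map_apply]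
  rw [h]
  exact sum_smulRight_apply ((poissonMatrix e z).map conj) dzbar α β

/-! ### Covectors along orbits -/

/-- The value of a covector on a vector tangent to a real orbit. -/
theorem covector_real_coad (α : (ι → ℂ) →L[ℝ] ℂ) (z : ι → ℂ) (x : ι → ℝ) :
    α (coadMatrix e (fun i => (x i : ℂ)) *ᵥ z) =
      (poissonMatrix e z *ᵥ holCoeff α + poissonMatrix e (star z) *ᵥ antiholCoeff α) ⬝ᵥ
        (fun i => (x i : ℂ)) := by
  have hx : star (fun i => (x i : ℂ)) = fun i => (x i : ℂ) := by ext i; simp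
  rw [covector_apply, coadMatrix_mulVec_eq_neg, star_neg, ← poissonMatrix_star_mulVec, hx,
    dotProduct_neg, dotProduct_neg, dotProduct_poissonMatrix_comm, dotProduct_poissonMatrix_comm,
    add_dotProduct]
  ring

/-- On real x the holomorphic and antiholomorphic parts are both linear in the same vector, so only
the sum of the two gradients is tested, and the real basis vectors suffice. -/
theorem covector_vanishes_real_iff (α : (ι → ℂ) →L[ℝ] ℂ) (z : ι → ℂ) :
    (∀ v ∈ realOrbitTangent e z, α v = 0) ↔
      poissonMatrix e z *ᵥ holCoeff α + poissonMatrix e (star z) *ᵥ antiholCoeff α = 0 := by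
  constructor
  · intro h
    ext i
    have := h _ ⟨Pi.single i 1, rfl⟩
    rw [covector_real_coad] at this
    have hs : (fun k => ((Pi.single i (1 : ℝ) : ι → ℝ) k : ℂ)) = (Pi.single i 1 : ι → ℂ) := by
      ext k; by_cases h : k = i <;> simp [h]
    rw [hs, dotProduct_single] at this
    simpa using this
  · rintro h _ ⟨x, rfl⟩
    dsimp only
    rw [covector_real_coad, h]
    simp

theorem covector_vanishes_iff (α : (ι → ℂ) →L[ℝ] ℂ) (z : ι → ℂ) :
    (∀ v ∈ complexOrbitTangent e z, α v = 0) ↔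
      poissonMatrix e z *ᵥ holCoeff α = 0 ∧ poissonMatrix e (star z) *ᵥ antiholCoeff α = 0 := by
  have key (v : ι → ℂ) : α (coadMatrix e v *ᵥ z) = poissonMatrix e z *ᵥ holCoeff α ⬝ᵥ v +
      poissonMatrix e (star z) *ᵥ antiholCoeff α ⬝ᵥ star v := by
    rw [covector_apply, coadMatrix_mulVec_eq_neg, star_neg, ← poissonMatrix_star_mulVec,
      dotProduct_neg, dotProduct_neg, dotProduct_poissonMatrix_comm, dotProduct_poissonMatrix_comm]
    ring
  constructor
  · intro h
    -- Multiplying the direction by I changes the relative sign of the two parts, so these two tests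
    -- separate them.
    have h1 (i : ι) := h _ ⟨Pi.single i (1 : ℂ), rfl⟩
    have h2 (i : ι) := h _ ⟨Pi.single i Complex.I, rfl⟩
    simp only [key, star_single_one, star_single_I, dotProduct_single] at h1 h2
    constructor <;> ext i <;> simp only [Pi.zero_apply]
    · linear_combination 1 / 2 * h1 i - Complex.I / 2 * h2 i +
        1 / 2 * ((poissonMatrix e z *ᵥ holCoeff α) i -
          (poissonMatrix e (star z) *ᵥ antiholCoeff α) i) * Complex.I_mul_I
    · linear_combination 1 / 2 * h1 i + Complex.I / 2 * h2 i -
        1 / 2 * ((poissonMatrix e z *ᵥ holCoeff α) i -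
          (poissonMatrix e (star z) *ᵥ antiholCoeff α) i) * Complex.I_mul_I
  · rintro ⟨ha, hb⟩ _ ⟨v, rfl⟩
    dsimp only
    rw [key, ha, hb]
    simp

end Algebra

/-! ### Linear pencils of skew-symmetric matrices -/

section Pencil

variable {ι : Type*} [Fintype ι] [DecidableEq ι] {C D : Matrix ι ι ℂ}

theorem dotProduct_mulVec_of_skew (hC : Cᵀ = -C) (v w : ι → ℂ) :
    v ⬝ᵥ C *ᵥ w = -(C *ᵥ v ⬝ᵥ w) := by
  rw [Matrix.dotProduct_mulVec, ← Matrix.mulVec_transpose, hC, Matrix.neg_mulVec, neg_dotProduct]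

/-- A vector annihilating the common image of two skew-symmetric matrices is a sum of vectors of
their kernels. -/
theorem exists_add_eq_of_annihilates_range_inf (hC : Cᵀ = -C) (hD : Dᵀ = -D) (q : ι → ℂ)
    (hq : ∀ a b, C *ᵥ a + D *ᵥ b = 0 → q ⬝ᵥ C *ᵥ a = 0) :
    ∃ u v, C *ᵥ u = 0 ∧ D *ᵥ v = 0 ∧ q = u + v := by
  let E := dotProductEquiv ℂ ι
  have hmem : E q ∈ (LinearMap.range C.mulVecLin ⊓ LinearMap.range D.mulVecLin).dualAnnihilator := by
    rw [Submodule.mem_dualAnnihilator]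
    rintro _ ⟨⟨a, rfl⟩, ⟨b, hb⟩⟩
    refine hq a (-b) ?_
    simp only [Matrix.mulVecLin_apply] at hb
    rw [Matrix.mulVec_neg, hb, add_neg_cancel]
  -- The annihilator of an intersection is the sum of the annihilators, and the annihilator of the
  -- image of a skew matrix is its kernel.
  rw [Subspace.dualAnnihilator_inf_eq, Submodule.mem_sup] at hmem
  obtain ⟨φ, hφ, ψ, hψ, hsum⟩ := hmem
  have key {A : Matrix ι ι ℂ} (hA : Aᵀ = -A) (χ : Module.Dual ℂ (ι → ℂ))
      (hχ : χ ∈ (LinearMap.range A.mulVecLin).dualAnnihilator) : A *ᵥ E.symm χ = 0 := by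
    rw [Submodule.mem_dualAnnihilator] at hχ
    refine dotProduct_eq_zero _ fun w => ?_
    have h := hχ (A *ᵥ w) ⟨w, rfl⟩
    have h2 : χ (A *ᵥ w) = E.symm χ ⬝ᵥ A *ᵥ w := by
      conv_lhs => rw [← E.apply_symm_apply χ]
      rfl
    rw [h2, dotProduct_mulVec_of_skew hA] at h
    simpa using h
  refine ⟨E.symm φ, E.symm ψ, key hC φ hφ, key hD ψ hψ, ?_⟩
  rw [← map_add, hsum, E.symm_apply_apply]

variable {V : Type*} [AddCommGroup V] [Module ℂ V] {A B : V →ₗ[ℂ] ι → ℂ}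

/-- `V` is identified by `A` and `B` with the space of the pairs `(a, b)` such that
`C a + D b = 0`, modulo the pairs such that `C a = 0` and `D b = 0`. -/
structure IsPencilReduction (C D : Matrix ι ι ℂ) (A B : V →ₗ[ℂ] ι → ℂ) : Prop where
  skew_left : Cᵀ = -C
  skew_right : Dᵀ = -D
  rel : ∀ α, C *ᵥ A α + D *ᵥ B α = 0
  inj : ∀ α, C *ᵥ A α = 0 → α = 0
  surj : ∀ a b, C *ᵥ a + D *ᵥ b = 0 → ∃ α, C *ᵥ A α = C *ᵥ a

namespace IsPencilReduction

theorem right_eq (h : IsPencilReduction C D A B) (α : V) : D *ᵥ B α = -(C *ᵥ A α) :=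
  eq_neg_of_add_eq_zero_right (h.rel α)

theorem symm (h : IsPencilReduction C D A B) : IsPencilReduction D C B A where
  skew_left := h.skew_right
  skew_right := h.skew_left
  rel α := by rw [add_comm, h.rel]
  inj α hα := h.inj α (by have := h.right_eq α; rw [hα] at this; simpa using this)
  surj b a hab := by
    obtain ⟨α, hα⟩ := h.surj a b (by rw [add_comm, hab])
    exact ⟨α, by rw [h.right_eq, hα, eq_neg_of_add_eq_zero_right hab, neg_neg]⟩

theorem finite (h : IsPencilReduction C D A B) : Module.Finite ℂ V := by
  refine Module.Finite.of_injective (C.mulVecLin ∘ₗ A) ?_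
  rw [← LinearMap.ker_eq_bot, LinearMap.ker_eq_bot']
  exact h.inj

/-- Since D b' = -C a' on admissible pairs, the form is the pairing of q = l₁ a - l₂ b with C a',
and C a' runs over the common image of C and D. Hence the form vanishes iff q is a sum of vectors of
the two kernels, and such a decomposition amounts to a choice of t. -/
theorem form_eq_zero_iff (h : IsPencilReduction C D A B) {l₁ l₂ : ℂ} (hl : l₁ ≠ 0) (α : V) :
    (∀ β, l₁ * (A α ⬝ᵥ C *ᵥ A β) + l₂ * (B α ⬝ᵥ D *ᵥ B β) = 0) ↔
      ∃ t, l₂ • C *ᵥ t + l₁ • D *ᵥ t = 0 ∧ C *ᵥ A α = C *ᵥ t := by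
  have hC := dotProduct_mulVec_of_skew h.skew_left
  have hD := dotProduct_mulVec_of_skew h.skew_right
  have hform (β : V) : l₁ * (A α ⬝ᵥ C *ᵥ A β) + l₂ * (B α ⬝ᵥ D *ᵥ B β) =
      (l₁ • A α - l₂ • B α) ⬝ᵥ C *ᵥ A β := by
    rw [h.right_eq β]
    simp only [sub_dotProduct, smul_dotProduct, dotProduct_neg, smul_eq_mul]
    ring
  simp only [hform]
  constructor
  · intro hα
    obtain ⟨u, v, hu, hv, huv⟩ := exists_add_eq_of_annihilates_range_inf h.skew_left h.skew_right
      (l₁ • A α - l₂ • B α) (fun a b hab => by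
        obtain ⟨β, hβ⟩ := h.surj a b hab
        rw [← hβ, hα])
    -- The witness t is a with the kernel part u of q removed: C does not see u, and l₁ t = l₂ b +
    -- v, where D does not see v.
    have h1 : C *ᵥ (A α - l₁⁻¹ • u) = C *ᵥ A α := by
      rw [Matrix.mulVec_sub, Matrix.mulVec_smul, hu, smul_zero, sub_zero]
    refine ⟨A α - l₁⁻¹ • u, ?_, h1.symm⟩
    have h2 : l₁ • (A α - l₁⁻¹ • u) = l₂ • B α + v := by
      rw [smul_sub, smul_inv_smul₀ hl, sub_eq_iff_eq_add, add_assoc, add_comm v u, ← huv]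
      abel
    rw [h1, ← Matrix.mulVec_smul D, h2, Matrix.mulVec_add, hv, Matrix.mulVec_smul, h.right_eq]
    simp
  · rintro ⟨t, ht, hCt⟩ β
    have e1 : A α ⬝ᵥ C *ᵥ A β = t ⬝ᵥ C *ᵥ A β := by rw [hC, hCt, hC]
    have e2 : B α ⬝ᵥ C *ᵥ A β = t ⬝ᵥ C *ᵥ B β := by
      have : C *ᵥ A β = -(D *ᵥ B β) := by rw [h.right_eq, neg_neg]
      rw [this, dotProduct_neg, hD, h.right_eq, hCt, hC]
      simp
    have e3 : l₁ • D *ᵥ t = -(l₂ • C *ᵥ t) := eq_neg_of_add_eq_zero_right ht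
    have e4 : l₂ * (t ⬝ᵥ C *ᵥ B β) = -(l₁ * (t ⬝ᵥ D *ᵥ B β)) := by
      have := congrArg (fun w => w ⬝ᵥ B β) e3
      simp only [smul_dotProduct, neg_dotProduct, smul_eq_mul] at this
      rw [hC, hD]
      linear_combination -this
    have e5 : t ⬝ᵥ D *ᵥ B β = -(t ⬝ᵥ C *ᵥ A β) := by rw [h.right_eq, dotProduct_neg]
    rw [sub_dotProduct, smul_dotProduct, smul_dotProduct, e1, e2]
    simp only [smul_eq_mul]
    linear_combination l₁ * e5 - e4

/-- The injective map C ∘ A carries the kernel of the form onto the image under C of K = ker (l₂ C +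
l₁ D). Rank-nullity for C on K gives the formula, because ker C ∩ K = ker C ∩ ker D when l₁ ≠ 0. -/
theorem finrank_ker_left (h : IsPencilReduction C D A B) {l₁ l₂ : ℂ} (hl : l₁ ≠ 0)
    (b : V →ₗ[ℂ] V →ₗ[ℂ] ℂ)
    (hb : ∀ α β, b α β = l₁ * (A α ⬝ᵥ C *ᵥ A β) + l₂ * (B α ⬝ᵥ D *ᵥ B β))
    (hker : ∀ v, D *ᵥ v = 0 → ∃ w, C *ᵥ v + D *ᵥ w = 0) :
    Module.finrank ℂ (LinearMap.ker b) +
        Module.finrank ℂ (LinearMap.ker C.mulVecLin ⊓ LinearMap.ker D.mulVecLin : Submodule ℂ _) =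
      Module.finrank ℂ (LinearMap.ker (l₂ • C + l₁ • D).mulVecLin) := by
  have hinj : Function.Injective (C.mulVecLin ∘ₗ A) := by
    rw [← LinearMap.ker_eq_bot, LinearMap.ker_eq_bot']
    exact h.inj
  set K := LinearMap.ker (l₂ • C + l₁ • D).mulVecLin with hK
  have memK (t : ι → ℂ) : t ∈ K ↔ l₂ • C *ᵥ t + l₁ • D *ᵥ t = 0 := by
    rw [hK, LinearMap.mem_ker, Matrix.mulVecLin_apply, Matrix.add_mulVec, Matrix.smul_mulVec,
      Matrix.smul_mulVec]
  have hmap : (LinearMap.ker b).map (C.mulVecLin ∘ₗ A) = K.map C.mulVecLin := by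
    have hmem (α : V) : α ∈ LinearMap.ker b ↔
        ∃ t, l₂ • C *ᵥ t + l₁ • D *ᵥ t = 0 ∧ C *ᵥ A α = C *ᵥ t := by
      rw [← h.form_eq_zero_iff hl, LinearMap.mem_ker]
      simp only [← hb]
      exact ⟨fun h β => by rw [h]; rfl, fun h => LinearMap.ext h⟩
    ext w
    constructor
    · rintro ⟨α, hα, rfl⟩
      obtain ⟨t, ht, hCt⟩ := (hmem α).1 hα
      exact ⟨t, (memK t).2 ht, hCt.symm⟩
    · rintro ⟨t, ht, rfl⟩
      have ht' := (memK t).1 ht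
      obtain ⟨s, hs⟩ : ∃ s, C *ᵥ t + D *ᵥ s = 0 := by
        -- A vector t of K has to be completed to a pair. If l₂ ≠ 0 a multiple of t itself does it;
        -- if l₂ = 0 then t only lies in ker D, and `hker` supplies the completion.
        by_cases h2 : l₂ = 0
        · rw [h2, zero_smul, zero_add] at ht'
          exact hker t ((smul_eq_zero.1 ht').resolve_left hl)
        · refine ⟨(l₂⁻¹ * l₁) • t, ?_⟩
          rw [Matrix.mulVec_smul, mul_smul, eq_neg_of_add_eq_zero_right ht', smul_neg,
            inv_smul_smul₀ h2, add_neg_cancel]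
      obtain ⟨α, hα⟩ := h.surj t s hs
      exact ⟨α, (hmem α).2 ⟨t, ht', hα⟩, hα⟩
  have hinf : LinearMap.ker C.mulVecLin ⊓ LinearMap.ker D.mulVecLin =
      LinearMap.ker C.mulVecLin ⊓ K := by
    ext t
    simp only [Submodule.mem_inf, memK, LinearMap.mem_ker, Matrix.mulVecLin_apply]
    refine and_congr_right fun hC => ?_
    rw [hC, smul_zero, zero_add, smul_eq_zero, or_iff_right hl]
  have h1 := LinearMap.finrank_range_add_finrank_ker (C.mulVecLin.domRestrict K)
  rw [LinearMap.range_domRestrict, LinearMap.ker_domRestrict, ← Submodule.finrank_map_subtype_eq K,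
    Submodule.map_comap_subtype, inf_comm] at h1
  rw [(Submodule.equivMapOfInjective _ hinj (LinearMap.ker b)).finrank_eq, hmap, hinf, h1]

end IsPencilReduction

end Pencil

/-! ### Constancy of the rank along a reduced pencil -/

section Pencil

variable {ι : Type*} [Fintype ι] [DecidableEq ι] {C D : Matrix ι ι ℂ}
  {V : Type*} [AddCommGroup V] [Module ℂ V] {A B : V →ₗ[ℂ] ι → ℂ}

/-- The reduced forms of a pencil with kernels of constant dimension have the same rank. -/
theorem IsPencilReduction.finrank_range_eq (h : IsPencilReduction C D A B)
    (c₁ c₂ : V →ₗ[ℂ] V →ₗ[ℂ] ℂ) (h₁ : ∀ α β, c₁ α β = A α ⬝ᵥ C *ᵥ A β)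
    (h₂ : ∀ α β, c₂ α β = B α ⬝ᵥ D *ᵥ B β)
    (hD : ∀ v, D *ᵥ v = 0 → ∃ w, C *ᵥ v + D *ᵥ w = 0)
    (hC : ∀ w, C *ᵥ w = 0 → ∃ v, C *ᵥ v + D *ᵥ w = 0) {r : ℕ}
    (hr : ∀ l : ℂ × ℂ, l ≠ 0 → Module.finrank ℂ (LinearMap.ker (l.1 • C + l.2 • D).mulVecLin) = r)
    {l l' : ℂ × ℂ} (hl : l ≠ 0) (hl' : l' ≠ 0) :
    Module.finrank ℂ (LinearMap.range (l.1 • c₁ + l.2 • c₂)) =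
      Module.finrank ℂ (LinearMap.range (l'.1 • c₁ + l'.2 • c₂)) := by
  have := h.finite
  have key (l : ℂ × ℂ) (hl : l ≠ 0) : Module.finrank ℂ (LinearMap.ker (l.1 • c₁ + l.2 • c₂)) +
      Module.finrank ℂ (LinearMap.ker C.mulVecLin ⊓ LinearMap.ker D.mulVecLin : Submodule ℂ _)
        = r := by
    -- The kernel of the form with parameters l is governed by the matrix with the parameters
    -- interchanged.
    have hsw : (l.2, l.1) ≠ 0 := fun h0 => hl (by
      simp only [Prod.mk_eq_zero] at h0; exact Prod.ext h0.2 h0.1)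
    have hform (α β : V) : (l.1 • c₁ + l.2 • c₂) α β =
        l.1 * (A α ⬝ᵥ C *ᵥ A β) + l.2 * (B α ⬝ᵥ D *ᵥ B β) := by
      rw [← h₁, ← h₂]; rfl
    rw [← hr _ hsw]
    by_cases h1 : l.1 = 0
    · have h2 : l.2 ≠ 0 := fun h2 => hl (Prod.ext h1 h2)
      have := h.symm.finrank_ker_left (l₁ := l.2) (l₂ := l.1) h2 _
        (fun α β => by rw [hform, add_comm]) (fun w hw => by
          obtain ⟨v, hv⟩ := hC w hw
          exact ⟨v, by rw [add_comm, hv]⟩)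
      rw [inf_comm, this, add_comm (l.1 • D)]
    · exact h.finrank_ker_left h1 _ hform hD
  have e1 := LinearMap.finrank_range_add_finrank_ker (l.1 • c₁ + l.2 • c₂)
  have e2 := LinearMap.finrank_range_add_finrank_ker (l'.1 • c₁ + l'.2 • c₂)
  have e3 := key l hl
  have e4 := key l' hl'
  omega

end Pencil

/-! ### Reduction at a point -/

section Pointwise

variable {ι : Type*} [Fintype ι] [DecidableEq ι] {𝔤₀ : Type*} [LieRing 𝔤₀] [LieAlgebra ℝ 𝔤₀]
  (e : Module.Basis ι ℝ 𝔤₀)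
  {T : Type*} [NormedAddCommGroup T] [NormedSpace ℝ T] [FiniteDimensional ℝ T]
  {Q : Type*} [NormedAddCommGroup Q] [NormedSpace ℝ Q] [FiniteDimensional ℝ Q]

/-- A left inverse of an injective continuous linear map from a finite-dimensional space. -/
theorem exists_continuousLeftInverse {E F : Type*} [NormedAddCommGroup E] [NormedSpace ℝ E]
    [NormedAddCommGroup F] [NormedSpace ℝ F] [FiniteDimensional ℝ F] (J : E →L[ℝ] F)
    (hJ : Function.Injective J) : ∃ L : F →L[ℝ] E, ∀ v, L (J v) = v := by
  obtain ⟨L, hL⟩ := LinearMap.exists_leftInverse_of_injective J.toLinearMap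
    (LinearMap.ker_eq_bot.2 hJ)
  have : FiniteDimensional ℝ E := FiniteDimensional.of_injective J.toLinearMap hJ
  exact ⟨LinearMap.toContinuousLinearMap L, fun v => LinearMap.congr_fun hL v⟩

theorem exists_continuousRightInverse {E F : Type*} [NormedAddCommGroup E] [NormedSpace ℝ E]
    [NormedAddCommGroup F] [NormedSpace ℝ F] [FiniteDimensional ℝ F] (P : E →L[ℝ] F)
    (hP : Function.Surjective P) : ∃ S : F →L[ℝ] E, ∀ v, P (S v) = v := by
  obtain ⟨S, hS⟩ := LinearMap.exists_rightInverse_of_surjective P.toLinearMap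
    (LinearMap.range_eq_top.2 hP)
  exact ⟨LinearMap.toContinuousLinearMap S, fun v => LinearMap.congr_fun hS v⟩

open Classical in
/-- A chosen left inverse (`0` if there is none). -/
noncomputable def leftInv (J : T →L[ℝ] (ι → ℂ)) : (ι → ℂ) →L[ℝ] T :=
  if h : ∃ L : (ι → ℂ) →L[ℝ] T, ∀ v, L (J v) = v then h.choose else 0

theorem leftInv_apply {J : T →L[ℝ] (ι → ℂ)} (hJ : Function.Injective J) (v : T) :
    leftInv J (J v) = v := by
  have h := exists_continuousLeftInverse J hJ
  rw [leftInv, dif_pos h]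
  exact h.choose_spec v

/-- Extension of covectors along an injective linear map. -/
noncomputable def extendCovector (J : T →L[ℝ] (ι → ℂ)) : (T →L[ℝ] ℂ) →ₗ[ℂ] ((ι → ℂ) →L[ℝ] ℂ) where
  toFun α := α.comp (leftInv J)
  map_add' _ _ := rfl
  map_smul' _ _ := rfl

theorem extendCovector_comp {J : T →L[ℝ] (ι → ℂ)} (hJ : Function.Injective J) (α : T →L[ℝ] ℂ) :
    (extendCovector J α).comp J = α := by
  ext v
  exact congrArg α (leftInv_apply hJ v)

/-- Composition of covectors with a linear map. -/
noncomputable def pullCovector (P : T →L[ℝ] Q) : (Q →L[ℝ] ℂ) →ₗ[ℂ] (T →L[ℝ] ℂ) where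
  toFun α := α.comp P
  map_add' _ _ := rfl
  map_smul' _ _ := rfl

theorem pullCovector_apply (P : T →L[ℝ] Q) (α : Q →L[ℝ] ℂ) : pullCovector P α = α.comp P := rfl

/-- `J` is an isomorphism onto the tangent space of the complex orbit at `z`, and `P` is a
projection along the tangent space of the real orbit. -/
structure IsReductionAt (z : ι → ℂ) (J : T →L[ℝ] (ι → ℂ)) (P : T →L[ℝ] Q) : Prop where
  inj : Function.Injective J
  range : Set.range J = complexOrbitTangent e z
  surj : Function.Surjective P
  ker : ∀ v, P v = 0 ↔ J v ∈ realOrbitTangent e z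

variable {e}

theorem realOrbitTangent_subset (z : ι → ℂ) : realOrbitTangent e z ⊆ complexOrbitTangent e z := by
  rintro _ ⟨x, rfl⟩
  exact ⟨_, rfl⟩

/-- Restriction to the complex orbit forgets exactly the kernels of the two matrices. Covectors on T
can therefore be handled through arbitrary extensions to the ambient space. -/
theorem comp_eq_iff_of_range {z : ι → ℂ} {J : T →L[ℝ] (ι → ℂ)}
    (hJ : Set.range J = complexOrbitTangent e z) (α β : (ι → ℂ) →L[ℝ] ℂ) :
    α.comp J = β.comp J ↔ poissonMatrix e z *ᵥ holCoeff α = poissonMatrix e z *ᵥ holCoeff β ∧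
      poissonMatrix e (star z) *ᵥ antiholCoeff α = poissonMatrix e (star z) *ᵥ antiholCoeff β := by
  have h := covector_vanishes_iff e (α - β) z
  rw [map_sub, map_sub, Matrix.mulVec_sub, Matrix.mulVec_sub, sub_eq_zero, sub_eq_zero, ← hJ] at h
  rw [← h, Set.forall_mem_range]
  constructor
  · intro hc v
    exact sub_eq_zero.2 (congrArg (fun f => f v) hc)
  · intro hc
    ext v
    exact sub_eq_zero.1 (hc v)

/-- The linear Poisson bivector is tangent to the orbits. -/
theorem lieBivector_congr {z : ι → ℂ} {J : T →L[ℝ] (ι → ℂ)}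
    (hJ : Set.range J = complexOrbitTangent e z) {α α' β β' : (ι → ℂ) →L[ℝ] ℂ}
    (hα : α.comp J = α'.comp J) (hβ : β.comp J = β'.comp J) :
    lieBivector e z α β = lieBivector e z α' β' := by
  rw [lieBivector_apply, lieBivector_apply, ((comp_eq_iff_of_range hJ β β').1 hβ).1,
    dotProduct_poissonMatrix_comm, ((comp_eq_iff_of_range hJ α α').1 hα).1,
    ← dotProduct_poissonMatrix_comm]

theorem lieBivectorConj_congr {z : ι → ℂ} {J : T →L[ℝ] (ι → ℂ)}
    (hJ : Set.range J = complexOrbitTangent e z) {α α' β β' : (ι → ℂ) →L[ℝ] ℂ}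
    (hα : α.comp J = α'.comp J) (hβ : β.comp J = β'.comp J) :
    lieBivectorConj e z α β = lieBivectorConj e z α' β' := by
  rw [lieBivectorConj_apply, lieBivectorConj_apply, ((comp_eq_iff_of_range hJ β β').1 hβ).2,
    dotProduct_poissonMatrix_comm, ((comp_eq_iff_of_range hJ α α').1 hα).2,
    ← dotProduct_poissonMatrix_comm]

namespace IsReductionAt

variable {z : ι → ℂ} {J : T →L[ℝ] (ι → ℂ)} {P : T →L[ℝ] Q}

/-- A covector that vanishes on the real orbit descends. -/
theorem exists_pullCovector_eq (h : IsReductionAt e z J P) (α : T →L[ℝ] ℂ)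
    (hα : ∀ v, P v = 0 → α v = 0) : ∃ β, pullCovector P β = α := by
  obtain ⟨S, hS⟩ := exists_continuousRightInverse P h.surj
  refine ⟨α.comp S, ?_⟩
  ext v
  have : α (S (P v) - v) = 0 := hα _ (by rw [map_sub, hS, sub_self])
  rw [map_sub, sub_eq_zero] at this
  exact this

theorem pullCovector_injective (h : IsReductionAt e z J P) :
    Function.Injective (pullCovector P) := by
  intro α β hαβ
  ext w
  obtain ⟨v, rfl⟩ := h.surj w
  exact congrArg (fun f => f v) hαβ

/-- Covectors on Q are the covectors on T that vanish on the real orbit directions. Extending them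
to the ambient space gives `rel`; restriction to the complex orbit gives `inj`; and a pair
satisfying the relation defines an ambient covector that vanishes on the real orbit, hence descends,
which is `surj`. -/
theorem isPencilReduction (h : IsReductionAt e z J P) :
    IsPencilReduction (poissonMatrix e z) (poissonMatrix e (star z))
      (holCoeff ∘ₗ extendCovector J ∘ₗ pullCovector P)
      (antiholCoeff ∘ₗ extendCovector J ∘ₗ pullCovector P) where
  skew_left := poissonMatrix_transpose e z
  skew_right := poissonMatrix_transpose e (star z)
  rel α := by
    refine (covector_vanishes_real_iff e _ z).1 fun w hw => ?_
    obtain ⟨v, rfl⟩ : w ∈ Set.range J := h.range ▸ realOrbitTangent_subset z hw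
    have : extendCovector J (pullCovector P α) (J v) = α (P v) :=
      congrArg (fun f => f v) (extendCovector_comp h.inj (pullCovector P α))
    rw [LinearMap.comp_apply, this, (h.ker v).2 hw, map_zero]
  inj α hα := by
    have hα' : poissonMatrix e z *ᵥ holCoeff (extendCovector J (pullCovector P α)) = 0 := hα
    have hrel : poissonMatrix e z *ᵥ holCoeff (extendCovector J (pullCovector P α)) +
        poissonMatrix e (star z) *ᵥ antiholCoeff (extendCovector J (pullCovector P α)) = 0 := by
      refine (covector_vanishes_real_iff e _ z).1 fun w hw => ?_
      obtain ⟨v, rfl⟩ : w ∈ Set.range J := h.range ▸ realOrbitTangent_subset z hw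
      have : extendCovector J (pullCovector P α) (J v) = α (P v) :=
        congrArg (fun f => f v) (extendCovector_comp h.inj (pullCovector P α))
      rw [this, (h.ker v).2 hw, map_zero]
    rw [hα', zero_add] at hrel
    have h0 := (comp_eq_iff_of_range h.range (extendCovector J (pullCovector P α)) 0).2
      ⟨by rw [hα', map_zero, Matrix.mulVec_zero], by rw [hrel, map_zero, Matrix.mulVec_zero]⟩
    rw [extendCovector_comp h.inj, ContinuousLinearMap.zero_comp] at h0
    exact h.pullCovector_injective (h0.trans (map_zero _).symm)
  surj a b hab := by
    have hv := (covector_vanishes_real_iff e (ofCoeff a b) z).2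
      (by rw [holCoeff_ofCoeff, antiholCoeff_ofCoeff, hab])
    obtain ⟨α, hα⟩ := h.exists_pullCovector_eq ((ofCoeff a b).comp J)
      (fun v hv' => hv _ ((h.ker v).1 hv'))
    refine ⟨α, ?_⟩
    have := ((comp_eq_iff_of_range h.range (extendCovector J (pullCovector P α))
      (ofCoeff a b)).1 (by rw [extendCovector_comp h.inj, hα])).1
    rw [holCoeff_ofCoeff] at this
    exact this

end IsReductionAt

end Pointwise

/-! ### Smoothness of holomorphic functions of several variables -/

section Holomorphic

open Metric Set MeasureTheory

variable {E : Type*} [NormedAddCommGroup E] [NormedSpace ℂ E] [FiniteDimensional ℂ E]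

/-- Cauchy's formula on a circle in the complex line through x in direction w writes the directional
derivative at x as an integral of values of f at translates of x. It can be differentiated under the
integral sign, the dominating bound being Cauchy's estimate. -/
theorem DifferentiableOn.differentiableOn_fderiv_apply {f : E → ℂ} {U : Set E} (hU : IsOpen U)
    (hf : DifferentiableOn ℂ f U) (w : E) :
    DifferentiableOn ℂ (fun x => fderiv ℂ f x w) U := by
  intro z₀ hz₀
  refine DifferentiableAt.differentiableWithinAt ?_
  obtain ⟨r₁, hr₁, hball₁⟩ := Metric.isOpen_iff.1 hU z₀ hz₀
  obtain ⟨r₂, hr₂, hball₂⟩ := Metric.continuousAt_iff.1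
    (hf.differentiableAt (hU.mem_nhds hz₀)).continuousAt 1 one_pos
  -- Three nested radii: x varies in the ball of radius R, the circles around x stay in the ball of
  -- radius 2R, and balls of radius R about points of those circles stay in the ball of radius 3R.
  obtain ⟨R, hR, hR₁, hR₂⟩ : ∃ R > 0, 3 * R ≤ r₁ ∧ 3 * R ≤ r₂ :=
    ⟨min r₁ r₂ / 3, by positivity, by linarith [min_le_left r₁ r₂],
      by linarith [min_le_right r₁ r₂]⟩
  have hsub : ball z₀ (3 * R) ⊆ U := (ball_subset_ball hR₁).trans hball₁
  have hdiff {y : E} (hy : y ∈ ball z₀ (3 * R)) : DifferentiableAt ℂ f y :=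
    hf.differentiableAt (hU.mem_nhds (hsub hy))
  -- On the ball of radius 3R the values of f are within 1 of f z₀, hence within 2 of each other;
  -- this explains the constant 2 / R.
  have hbd {y : E} (hy : y ∈ ball z₀ (2 * R)) : ‖fderiv ℂ f y‖ ≤ 2 / R := by
    have hyR : ball y R ⊆ ball z₀ (3 * R) := by
      refine ball_subset_ball' ?_
      have := mem_ball.1 hy
      linarith
    refine Complex.norm_fderiv_le_div_of_mapsTo_ball (hf.mono (hyR.trans hsub)) ?_ hR
    intro x hx
    have h1 := hball₂ (x := x) ((mem_ball.1 (hyR hx)).trans_le hR₂)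
    have h2 := hball₂ (x := y) ((mem_ball.1 (hyR (mem_ball_self hR))).trans_le hR₂)
    rw [mem_closedBall]
    have := dist_triangle_right (f x) (f y) (f z₀)
    linarith
  obtain ⟨δ, hδ, hδw⟩ : ∃ δ > 0, δ * ‖w‖ < R := by
    refine ⟨R / (‖w‖ + 1), by positivity, ?_⟩
    rw [div_mul_eq_mul_div, div_lt_iff₀ (by positivity)]
    nlinarith [norm_nonneg w]
  have hmem {x : E} (hx : x ∈ ball z₀ R) {t : ℂ} (ht : ‖t‖ ≤ δ) : x + t • w ∈ ball z₀ (2 * R) := by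
    rw [mem_ball, dist_eq_norm] at hx ⊢
    have h1 : ‖t • w‖ ≤ δ * ‖w‖ := by
      rw [norm_smul]; exact mul_le_mul_of_nonneg_right ht (norm_nonneg w)
    have h2 : x + t • w - z₀ = (x - z₀) + t • w := by abel
    rw [h2]
    linarith [norm_add_le (x - z₀) (t • w)]
  have hball : ball z₀ (2 * R) ⊆ ball z₀ (3 * R) := ball_subset_ball (by linarith)
  have hcirc (θ : ℝ) : ‖circleMap 0 δ θ‖ ≤ δ := by simp [abs_of_pos hδ]
  -- The kernel of Cauchy's formula for the first derivative at the centre, in the angular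
  -- parameter.
  let k : ℝ → ℂ := fun θ => _root_.deriv (circleMap 0 δ) θ * (1 / (circleMap 0 δ θ) ^ 2)
  have hk : Continuous k := by
    have h0 (θ : ℝ) : circleMap 0 δ θ ^ 2 ≠ 0 := pow_ne_zero _ (circleMap_ne_center hδ.ne')
    simp only [k, deriv_circleMap]
    exact ((continuous_circleMap 0 δ).mul continuous_const).mul
      (continuous_const.div ((continuous_circleMap 0 δ).pow 2) h0)
  have hint {x : E} (hx : x ∈ ball z₀ R) :
      fderiv ℂ f x w = (2 * Real.pi * Complex.I)⁻¹ *
        ∫ θ in (0 : ℝ)..2 * Real.pi, k θ * f (x + circleMap 0 δ θ • w) := by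
    have hd : HasDerivAt (fun t : ℂ => f (x + t • w)) (fderiv ℂ f x w) 0 := by
      have h1 : HasDerivAt (fun t : ℂ => x + t • w) w 0 := by
        simpa using ((hasDerivAt_id (0 : ℂ)).smul_const w).const_add x
      have h2 : HasFDerivAt f (fderiv ℂ f x) (x + (0 : ℂ) • w) := by
        have := hmem hx (t := 0) (by simpa using hδ.le)
        have h3 := (hdiff (hball this)).hasFDerivAt
        rwa [zero_smul, add_zero] at h3 ⊢
      exact h2.comp_hasDerivAt 0 h1
    have hon : DifferentiableOn ℂ (fun t : ℂ => f (x + t • w)) (closedBall 0 δ) := by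
      intro t ht
      have h1 := hdiff (hball (hmem hx (mem_closedBall_zero_iff.1 ht)))
      have h2 : DifferentiableAt ℂ (fun t : ℂ => x + t • w) t := by fun_prop
      exact (h1.comp t h2).differentiableWithinAt
    have hc := hon.deriv_eq_smul_circleIntegral hδ
    rw [hd.deriv, circleIntegral] at hc
    have h2 : (2 * Real.pi * Complex.I) ≠ 0 := Complex.two_pi_I_ne_zero
    rw [eq_inv_mul_iff_mul_eq₀ h2, ← smul_eq_mul, ← hc]
    refine intervalIntegral.integral_congr fun θ _ => ?_
    simp only [k, smul_eq_mul, sub_zero]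
    ring
  borelize E
  borelize (E →L[ℂ] ℂ)
  have : ProperSpace (E →L[ℂ] ℂ) := FiniteDimensional.proper ℂ _
  have hder : HasFDerivAt
      (fun x => ∫ θ in (0 : ℝ)..2 * Real.pi, k θ * f (x + circleMap 0 δ θ • w))
      (∫ θ in (0 : ℝ)..2 * Real.pi, k θ • fderiv ℂ f (z₀ + circleMap 0 δ θ • w)) z₀ := by
    have hcont {x : E} (hx : x ∈ ball z₀ R) :
        Continuous fun θ : ℝ => k θ * f (x + circleMap 0 δ θ • w) := by
      refine hk.mul (continuous_iff_continuousAt.2 fun θ => ?_)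
      refine ContinuousAt.comp (hdiff (hball (hmem hx (hcirc θ)))).continuousAt ?_
      exact (continuous_const.add ((continuous_circleMap 0 δ).smul continuous_const)).continuousAt
    refine intervalIntegral.hasFDerivAt_integral_of_dominated_of_fderiv_le
      (F := fun x θ => k θ * f (x + circleMap 0 δ θ • w))
      (F' := fun x θ => k θ • fderiv ℂ f (x + circleMap 0 δ θ • w))
      (bound := fun θ => ‖k θ‖ * (2 / R)) (s := ball z₀ R)
      (ball_mem_nhds _ hR) ?_ ?_ ?_ ?_ ?_ ?_
    · filter_upwards [ball_mem_nhds z₀ hR] with x hx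
      exact (hcont hx).aestronglyMeasurable
    · exact (hcont (mem_ball_self hR)).intervalIntegrable _ _
    -- Continuity of the derivative is not yet known here; its measurability holds for any function.
    · refine AEStronglyMeasurable.smul hk.aestronglyMeasurable ?_
      refine Measurable.aestronglyMeasurable ?_
      exact (measurable_fderiv ℂ f).comp
        (continuous_const.add ((continuous_circleMap 0 δ).smul continuous_const)).measurable
    · refine Filter.Eventually.of_forall fun θ _ x hx => ?_
      rw [norm_smul]
      exact mul_le_mul_of_nonneg_left (hbd (hmem hx (hcirc θ))) (norm_nonneg _)
    · exact (hk.norm.mul continuous_const).intervalIntegrable _ _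
    · refine Filter.Eventually.of_forall fun θ _ x hx => ?_
      have h1 := (hdiff (hball (hmem hx (hcirc θ)))).hasFDerivAt
      have h2 : HasFDerivAt (fun x : E => x + circleMap 0 δ θ • w)
        (ContinuousLinearMap.id ℂ E) x := (hasFDerivAt_id x).add_const _
      exact (h1.comp x h2).const_mul (k θ)
  refine ((hder.differentiableAt).const_mul ((2 * Real.pi * Complex.I)⁻¹)).congr_of_eventuallyEq ?_
  filter_upwards [ball_mem_nhds z₀ hR] with x hx
  exact hint hx

/-- Directional derivatives of a holomorphic function are again holomorphic, so the order of
differentiability can be raised by induction. -/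
theorem DifferentiableOn.contDiffOn_of_isOpen {f : E → ℂ} {U : Set E} (hU : IsOpen U)
    (hf : DifferentiableOn ℂ f U) : ContDiffOn ℂ ∞ f U := by
  rw [contDiffOn_infty]
  intro n
  induction n generalizing f with
  | zero => exact contDiffOn_zero.2 hf.continuousOn
  | succ n ih =>
    push_cast
    refine contDiffOn_succ_of_fderiv_apply hf (by simp) fun y => ?_
    refine (ih (hf.differentiableOn_fderiv_apply hU y)).congr fun x hx => ?_
    rw [fderivWithin_of_isOpen hU hx]

end Holomorphic

/-! ### Differentials of Casimir functions -/

section Casimir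

variable {ι : Type*} [Fintype ι] [DecidableEq ι] {𝔤₀ : Type*} [LieRing 𝔤₀] [LieAlgebra ℝ 𝔤₀]
  {e : Module.Basis ι ℝ 𝔤₀} {W : Set (ι → ℂ)} {g : (ι → ℂ) → ℂ}

/-- The holomorphic gradient. -/
noncomputable def holGrad (g : (ι → ℂ) → ℂ) (z : ι → ℂ) : ι → ℂ := fun i => holPartial g i z

/-- The holomorphic Hessian. -/
noncomputable def holHess (g : (ι → ℂ) → ℂ) (z : ι → ℂ) : Matrix ι ι ℂ :=
  Matrix.of fun i k => holPartial (holPartial g i) k z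

theorem clm_apply_eq_dotProduct (A : (ι → ℂ) →L[ℂ] ℂ) (w : ι → ℂ) :
    A w = (fun i => A (Pi.single i 1)) ⬝ᵥ w := by
  have hw : w = ∑ i, w i • (Pi.single i 1 : ι → ℂ) := by
    ext j
    simp [Finset.sum_apply, Pi.single_apply]
  conv_lhs => rw [hw]
  simp only [map_sum, map_smul, smul_eq_mul, dotProduct, mul_comm]

theorem fderiv_apply_eq_dotProduct (g : (ι → ℂ) → ℂ) (z w : ι → ℂ) :
    fderiv ℂ g z w = holGrad g z ⬝ᵥ w := clm_apply_eq_dotProduct _ _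

theorem poissonMatrix_mulVec_holGrad (hg : g ∈ holCasimirs e W) {z : ι → ℂ} (hz : z ∈ W) :
    poissonMatrix e z *ᵥ holGrad g z = 0 := by
  have h : holGrad g z ᵥ* poissonMatrix e z = 0 := funext fun j => hg.2 z hz j
  rw [vecMul_poissonMatrix, neg_eq_zero] at h
  exact h

theorem differentiableOn_holPartial (hW : IsOpen W) (hg : DifferentiableOn ℂ g W) (i : ι) :
    DifferentiableOn ℂ (holPartial g i) W := hg.differentiableOn_fderiv_apply hW _

theorem holHess_symm (hW : IsOpen W) (hg : DifferentiableOn ℂ g W) {z : ι → ℂ} (hz : z ∈ W)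
    (i k : ι) : holHess g z i k = holHess g z k i := by
  have hc : ContDiffAt ℂ 2 g z :=
    ((hg.contDiffOn_of_isOpen hW).contDiffAt (hW.mem_nhds hz)).of_le (by norm_cast)
  have hd : DifferentiableAt ℂ (fderiv ℂ g) z :=
    (hc.fderiv_right (m := 1) (by norm_num)).differentiableAt (by norm_num)
  have key (i k : ι) : holHess g z i k =
      fderiv ℂ (fderiv ℂ g) z (Pi.single k 1) (Pi.single i 1) := by
    have h := hd.hasFDerivAt.clm_apply (hasFDerivAt_const (Pi.single i (1 : ℂ) : ι → ℂ) z)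
    change fderiv ℂ (fun x => fderiv ℂ g x (Pi.single i 1)) z (Pi.single k 1) = _
    rw [h.fderiv]
    simp
  rw [key, key]
  exact (hc.isSymmSndFDerivAt (by simp)).eq _ _

/-- The derivative of the equation of the Casimir functions. -/
theorem sum_holHess_mul_poissonMatrix (hW : IsOpen W) (hg : g ∈ holCasimirs e W) {z : ι → ℂ}
    (hz : z ∈ W) (j k : ι) :
    ∑ i, holHess g z i k * poissonMatrix e z i j +
      ∑ i, holPartial g i z * (structureConstant e i j k : ℂ) = 0 := by
  have hP (i : ι) : HasFDerivAt (fun w => poissonMatrix e w i j)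
      (∑ l, (structureConstant e i j l : ℂ) • ContinuousLinearMap.proj (R := ℂ)
        (φ := fun _ : ι => ℂ) l) z := by
    refine HasFDerivAt.fun_sum fun l _ => ?_
    exact (hasFDerivAt_apply l z).const_mul _
  have hd (i : ι) := ((differentiableOn_holPartial hW hg.1 i).differentiableAt
    (hW.mem_nhds hz)).hasFDerivAt
  have h1 := HasFDerivAt.fun_sum fun i (_ : i ∈ Finset.univ) => (hd i).mul (hP i)
  have h2 : HasFDerivAt (fun w => ∑ i, holPartial g i w * poissonMatrix e w i j)
      (0 : (ι → ℂ) →L[ℂ] ℂ) z := by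
    refine (hasFDerivAt_const (0 : ℂ) z).congr_of_eventuallyEq ?_
    filter_upwards [hW.mem_nhds hz] with w hw
    exact hg.2 w hw j
  have h3 := congrArg (fun A : (ι → ℂ) →L[ℂ] ℂ => A (Pi.single k 1)) (h1.unique h2)
  simp only [_root_.sum_apply, _root_.add_apply,
    _root_.smul_apply, ContinuousLinearMap.proj_apply, smul_eq_mul,
    _root_.zero_apply, Finset.sum_add_distrib, Pi.single_apply, mul_ite, mul_one,
    mul_zero, Finset.sum_ite_eq', Finset.mem_univ, if_true] at h3
  rw [← h3, add_comm]
  congr 1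
  simp only [holHess, Matrix.of_apply]
  exact Finset.sum_congr rfl fun i _ => by rw [mul_comm]; rfl

/-- `φ_l` as a linear map. -/
noncomputable def phiL (l : ℂ × ℂ) : (ι → ℂ) →L[ℝ] (ι → ℂ) :=
  LinearMap.toContinuousLinearMap
    { toFun := phi l
      map_add' := fun v w => by simp only [phi_eq, star_add, smul_add]; abel
      map_smul' := fun c w => by
        have : star (c • w) = c • star w := by ext i; simp
        simp only [phi_eq, this, RingHom.id_apply, smul_add, smul_comm c] }

theorem phiL_apply (l : ℂ × ℂ) (z : ι → ℂ) : phiL l z = phi l z := rfl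

theorem contDiff_phi (l : ℂ × ℂ) : ContDiff ℝ ∞ (phi l : (ι → ℂ) → ι → ℂ) :=
  (phiL l : (ι → ℂ) →L[ℝ] (ι → ℂ)).contDiff

theorem contDiffAt_holomorphic (hW : IsOpen W) (hg : DifferentiableOn ℂ g W) {z : ι → ℂ}
    (hz : z ∈ W) : ContDiffAt ℝ ∞ g z :=
  ((hg.contDiffOn_of_isOpen hW).contDiffAt (hW.mem_nhds hz)).restrict_scalars ℝ

theorem contDiffAt_comp_phi (hW : IsOpen W) (hg : DifferentiableOn ℂ g W) (l : ℂ × ℂ)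
    {z : ι → ℂ} (hz : phi l z ∈ W) : ContDiffAt ℝ ∞ (g ∘ phi l) z :=
  (contDiffAt_holomorphic hW hg hz).comp z (contDiff_phi l).contDiffAt

/-- Both coefficient vectors are multiples of the one gradient at φ_l(z). This form matches the
vectors t in the description of the kernels of the reduced pencil. -/
theorem hasFDerivAt_comp_phi (hW : IsOpen W) (hg : DifferentiableOn ℂ g W) (l : ℂ × ℂ)
    {z : ι → ℂ} (hz : phi l z ∈ W) :
    HasFDerivAt (g ∘ phi l)
      (ofCoeff (l.1 • holGrad g (phi l z)) (l.2 • holGrad g (phi l z))) z := by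
  have h1 := ((hg.differentiableAt (hW.mem_nhds hz)).hasFDerivAt).restrictScalars ℝ
  have h2 : HasFDerivAt (phi l) (phiL l) z := (phiL l).hasFDerivAt
  refine (h1.comp z h2).congr_fderiv ?_
  ext w
  change fderiv ℂ g (phi l z) (phi l w) = _
  rw [fderiv_apply_eq_dotProduct, ofCoeff_apply, phi_eq l w]
  simp only [dotProduct_add, dotProduct_smul, smul_dotProduct]

/-- The `dz̄_k`-coefficients of the differential of `g̃`. -/
noncomputable def tildeCoeff (g : (ι → ℂ) → ℂ) (z : ι → ℂ) : ι → ℂ :=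
  fun k => ∑ i, conj (holHess g z i k) * z i

theorem contDiffAt_tildeFun (hW : IsOpen W) (hg : DifferentiableOn ℂ g W) {z : ι → ℂ}
    (hz : z ∈ W) : ContDiffAt ℝ ∞ (tildeFun g) z := by
  refine ContDiffAt.sum fun i _ => ContDiffAt.mul ?_ (contDiff_apply ℝ ℂ i).contDiffAt
  exact Complex.conjCLE.contDiff.contDiffAt.comp z
    (contDiffAt_holomorphic hW (differentiableOn_holPartial hW hg i) hz)

/-- The conjugated partial derivatives are antiholomorphic, so they contribute only to the dz̄-part,
while the explicit factors z_i give the dz-part. -/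
theorem hasFDerivAt_tildeFun (hW : IsOpen W) (hg : DifferentiableOn ℂ g W) {z : ι → ℂ}
    (hz : z ∈ W) : HasFDerivAt (tildeFun g) (ofCoeff (star (holGrad g z)) (tildeCoeff g z)) z := by
  have h1 (i : ι) : HasFDerivAt (fun w => conj (holPartial g i w))
      ((Complex.conjCLE : ℂ →L[ℝ] ℂ).comp ((fderiv ℂ (holPartial g i) z).restrictScalars ℝ)) z :=
    (Complex.conjCLE : ℂ →L[ℝ] ℂ).hasFDerivAt.comp z
      ((((differentiableOn_holPartial hW hg i).differentiableAt
        (hW.mem_nhds hz)).hasFDerivAt).restrictScalars ℝ)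
  have h2 (i : ι) : HasFDerivAt (fun w : ι → ℂ => w i)
    (ContinuousLinearMap.proj (R := ℝ) (φ := fun _ : ι => ℂ) i) z := hasFDerivAt_apply i z
  refine (HasFDerivAt.fun_sum fun i (_ : i ∈ Finset.univ) => (h1 i).mul (h2 i)).congr_fderiv ?_
  ext w
  rw [ofCoeff_apply]
  simp only [_root_.sum_apply, _root_.add_apply,
    _root_.smul_apply, ContinuousLinearMap.proj_apply, smul_eq_mul,
    Finset.sum_add_distrib]
  congr 1
  have h3 (i : ι) : fderiv ℂ (holPartial g i) z w = ∑ k, holHess g z i k * w k :=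
    clm_apply_eq_dotProduct _ _
  calc _ = ∑ i, z i * conj (fderiv ℂ (holPartial g i) z w) := rfl
    _ = ∑ i, ∑ k, z i * (conj (holHess g z i k) * conj (w k)) := by
      simp only [h3, map_sum, map_mul, Finset.mul_sum]
    _ = _ := by
      rw [Finset.sum_comm]
      simp only [dotProduct, tildeCoeff, Finset.sum_mul]
      exact Finset.sum_congr rfl fun k _ => Finset.sum_congr rfl fun i _ => by
        rw [Pi.star_apply, Complex.star_def]; ring

/-- Differentiate the Casimir equation in z_i, conjugate, and contract with z_i: the structure
constants reassemble into the Poisson matrix at z. The result says that the differential of g̃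
annihilates the real orbit. -/
theorem poissonMatrix_mulVec_tildeCoeff (hW : IsOpen W) (hg : g ∈ holCasimirs e W) {z : ι → ℂ}
    (hz : z ∈ W) : poissonMatrix e z *ᵥ star (holGrad g z) +
      poissonMatrix e (star z) *ᵥ tildeCoeff g z = 0 := by
  ext j
  have h (i : ι) : ∑ k, conj (poissonMatrix e z j k) * conj (holHess g z i k) =
      ∑ k, conj (holPartial g k z) * (structureConstant e k j i : ℂ) := by
    have h0 := congrArg conj (sum_holHess_mul_poissonMatrix hW hg hz j i)
    simp only [map_add, map_sum, map_mul, Complex.conj_ofReal, map_zero] at h0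
    rw [← sub_eq_zero, ← neg_eq_zero, ← h0, neg_sub, sub_eq_add_neg, add_comm,
      ← Finset.sum_neg_distrib]
    congr 1
    refine Finset.sum_congr rfl fun k _ => ?_
    rw [holHess_symm hW hg.1 hz i k, poissonMatrix_apply_skew e z k j, map_neg]
    ring
  have h1 : (poissonMatrix e (star z) *ᵥ tildeCoeff g z) j =
      ∑ k, conj (holPartial g k z) * poissonMatrix e z k j := by
    calc _ = ∑ i, (∑ k, conj (poissonMatrix e z j k) * conj (holHess g z i k)) * z i := by
          simp only [Matrix.mulVec, dotProduct, tildeCoeff, poissonMatrix_star, Finset.mul_sum,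
            Finset.sum_mul]
          rw [Finset.sum_comm]
          exact Finset.sum_congr rfl fun k _ => Finset.sum_congr rfl fun i _ => by ring
      _ = _ := by
          simp only [h]
          simp only [poissonMatrix, Matrix.of_apply, Finset.mul_sum, Finset.sum_mul]
          rw [Finset.sum_comm]
          exact Finset.sum_congr rfl fun k _ => Finset.sum_congr rfl fun i _ => by ring
  rw [Pi.add_apply, h1, Pi.zero_apply]
  simp only [Matrix.mulVec, dotProduct, ← Finset.sum_add_distrib]
  refine Finset.sum_eq_zero fun k _ => ?_
  rw [poissonMatrix_apply_skew e z j k, Pi.star_apply, Complex.star_def]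
  simp only [holGrad]
  ring

/-- The differential of the complex conjugate of `g̃` is the derivative at `ε = 0` of the
differentials of the functions `g ∘ φ_(1, ε)`. -/
theorem hasDerivAt_holGrad_phi (hW : IsOpen W) (hg : DifferentiableOn ℂ g W) {z : ι → ℂ}
    (hz : z ∈ W) :
    HasDerivAt (fun ε : ℝ => (holGrad g (phi (1, ε) z), (ε : ℂ) • holGrad g (phi (1, ε) z)))
      (star (tildeCoeff g z), holGrad g z) 0 := by
  have hphi : HasDerivAt (fun ε : ℝ => phi (1, ε) z) (star z) 0 := by
    simp only [phi_eq, one_smul]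
    have h0 : HasDerivAt (fun ε : ℝ => (ε : ℂ)) 1 0 := Complex.ofRealCLM.hasDerivAt
    simpa using (h0.smul_const (star z)).const_add z
  have h00 : phi (1, ((0 : ℝ) : ℂ)) z = z := by simp [phi_eq]
  have hgrad : HasDerivAt (fun ε : ℝ => holGrad g (phi (1, ε) z)) (star (tildeCoeff g z)) 0 := by
    -- The derivative is the Hessian applied to `star z`; by symmetry of the Hessian it is the
    -- conjugate of `tildeCoeff`.
    refine hasDerivAt_pi.2 fun i => ?_
    have h1 : HasFDerivAt (holPartial g i) ((fderiv ℂ (holPartial g i) z).restrictScalars ℝ)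
        (phi (1, ((0 : ℝ) : ℂ)) z) := by
      rw [h00]
      exact (((differentiableOn_holPartial hW hg i).differentiableAt
        (hW.mem_nhds hz)).hasFDerivAt).restrictScalars ℝ
    refine (h1.comp_hasDerivAt (0 : ℝ) hphi).congr_deriv ?_
    change fderiv ℂ (holPartial g i) z (star z) = _
    rw [clm_apply_eq_dotProduct]
    simp only [dotProduct, Pi.star_apply, tildeCoeff, star_sum, star_mul', Complex.star_def,
      Complex.conj_conj]
    refine Finset.sum_congr rfl fun k _ => ?_
    rw [holHess_symm hW hg hz k i]
    rfl
  refine hgrad.prodMk ?_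
  have h0 : HasDerivAt (fun ε : ℝ => (ε : ℂ)) 1 0 := Complex.ofRealCLM.hasDerivAt
  refine (h0.smul hgrad).congr_deriv ?_
  rw [h00]
  simp

/-- The difference quotients lie in S, and a subspace of a finite-dimensional space is closed. -/
theorem mem_of_hasDerivAt {F : Type*} [NormedAddCommGroup F] [NormedSpace ℂ F]
    [FiniteDimensional ℂ F] (S : Submodule ℂ F) {γ : ℝ → F} {γ' : F} (h : HasDerivAt γ γ' 0)
    (hγ : ∀ᶠ ε in nhds 0, γ ε ∈ S) : γ' ∈ S := by
  refine S.closed_of_finiteDimensional.mem_of_tendsto (hasDerivAt_iff_tendsto_slope.1 h) ?_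
  filter_upwards [nhdsWithin_le_nhds hγ] with ε hε
  exact (S.restrictScalars ℝ).smul_mem _ (Submodule.sub_mem S hε hγ.self_of_nhds)

/-! ### Casimir functions on admissible sets -/

theorem rank_poissonMatrix_le (z : ι → ℂ) : (poissonMatrix e z).rank ≤ genericRank e :=
  le_ciSup (f := fun z => (poissonMatrix e z).rank)
    ⟨Fintype.card ι, by rintro _ ⟨z, rfl⟩; exact Matrix.rank_le_card_width _⟩ z

theorem finrank_ker_poissonMatrix {z : ι → ℂ} (hz : z ∉ singSet e) :
    Module.finrank ℂ (LinearMap.ker (poissonMatrix e z).mulVecLin) = lieRank e := by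
  have h1 : (poissonMatrix e z).rank = genericRank e :=
    le_antisymm (rank_poissonMatrix_le z) (not_lt.1 hz)
  have h2 := LinearMap.finrank_range_add_finrank_ker (poissonMatrix e z).mulVecLin
  rw [Module.finrank_fintype_fun_eq_card] at h2
  rw [lieRank, ← h1, Matrix.rank]
  omega

/-- Outside the singular set the kernel has dimension `lieRank e`, and admissibility provides that
many independent gradients inside it. -/
theorem IsAdmissible.mem_span_holGrad (hW : IsAdmissible e W) {z : ι → ℂ} (hz : z ∈ W)
    {u : ι → ℂ} (hu : poissonMatrix e z *ᵥ u = 0) :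
    u ∈ Submodule.span ℂ ((fun g => holGrad g z) '' holCasimirs e W) := by
  obtain ⟨-, hdisj, g, hg, hind⟩ := hW
  let K := LinearMap.ker (poissonMatrix e z).mulVecLin
  have hK : Module.finrank ℂ K = lieRank e :=
    finrank_ker_poissonMatrix (Set.disjoint_left.1 hdisj hz)
  have hind' : LinearIndependent ℂ fun a => holGrad (g a) z := by
    rw [Fintype.linearIndependent_iff]
    intro k hk
    refine Fintype.linearIndependent_iff.1 (hind z hz) k ?_
    ext w
    have := congrArg (fun v => v ⬝ᵥ w) hk
    simpa [sum_dotProduct, fderiv_apply_eq_dotProduct] using this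
  have hle : Submodule.span ℂ (Set.range fun a => holGrad (g a) z) ≤ K := by
    rw [Submodule.span_le]
    rintro _ ⟨a, rfl⟩
    exact poissonMatrix_mulVec_holGrad (hg a) hz
  have heq := Submodule.eq_of_le_of_finrank_eq hle
    (by rw [finrank_span_eq_card hind', hK, Fintype.card_fin])
  have hmem : u ∈ K := hu
  rw [← heq] at hmem
  refine Submodule.span_mono ?_ hmem
  rintro _ ⟨a, rfl⟩
  exact ⟨g a, hg a, rfl⟩

end Casimir

/-! ### One-parameter groups of coadjoint transformations -/

section Flow

variable {ι : Type*} [Fintype ι] [DecidableEq ι] {𝔤₀ : Type*} [LieRing 𝔤₀] [LieAlgebra ℝ 𝔤₀]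
  (e : Module.Basis ι ℝ 𝔤₀)

theorem realCoadExp_eq (x : ι → ℝ) (t : ℝ) :
    realCoadExp e x t = NormedSpace.exp (t • coadMatrix e fun i => (x i : ℂ)) := by
  rw [realCoadExp, coadExp]
  congr 1
  ext j k
  simp only [coadMatrix, Matrix.of_apply, Matrix.smul_apply, Complex.real_smul, Finset.mul_sum]
  exact Finset.sum_congr rfl fun i _ => by push_cast; ring

open scoped Matrix.Norms.Operator in
theorem hasDerivAt_exp_smul_mulVec (B : Matrix ι ι ℂ) (z : ι → ℂ) (t : ℝ) :
    HasDerivAt (fun s : ℝ => NormedSpace.exp (s • B) *ᵥ z)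
      (B *ᵥ (NormedSpace.exp (t • B) *ᵥ z)) t := by
  let L : Matrix ι ι ℂ →ₗ[ℝ] (ι → ℂ) :=
    { toFun := fun A => A *ᵥ z
      map_add' := fun A A' => Matrix.add_mulVec A A' z
      map_smul' := fun c A => Matrix.smul_mulVec c A z }
  have h := (LinearMap.toContinuousLinearMap L).hasFDerivAt.comp_hasDerivAt t
    (hasDerivAt_exp_smul_const' (𝕂 := ℝ) B t)
  refine h.congr_deriv ?_
  change (B * NormedSpace.exp (t • B)) *ᵥ z = _
  rw [Matrix.mulVec_mulVec]

theorem hasDerivAt_realCoadExp_mulVec (x : ι → ℝ) (z : ι → ℂ) (t : ℝ) :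
    HasDerivAt (fun s => realCoadExp e x s *ᵥ z)
      (coadMatrix e (fun i => (x i : ℂ)) *ᵥ (realCoadExp e x t *ᵥ z)) t := by
  simp only [realCoadExp_eq]
  exact hasDerivAt_exp_smul_mulVec _ z t

theorem realCoadExp_zero_mulVec (x : ι → ℝ) (z : ι → ℂ) : realCoadExp e x 0 *ᵥ z = z := by
  rw [realCoadExp_eq, zero_smul, NormedSpace.exp_zero, Matrix.one_mulVec]

theorem realCoadExp_mem (x : ι → ℝ) (t : ℝ) : realCoadExp e x t ∈ realCoadjointGroup e := by
  refine Submonoid.subset_closure ⟨fun i => t * x i, ?_⟩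
  simp [realCoadExp]

/-- Uniqueness of the integral curves of a coadjoint vector field. -/
theorem eq_realCoadExp_mulVec (x : ι → ℝ) (z : ι → ℂ) {γ : ℝ → ι → ℂ} {a b t₀ : ℝ}
    (ht₀ : t₀ ∈ Set.Ioo a b)
    (hγ : ∀ t ∈ Set.Ioo a b, HasDerivAt γ (coadMatrix e (fun i => (x i : ℂ)) *ᵥ γ t) t)
    (h₀ : γ t₀ = realCoadExp e x t₀ *ᵥ z) :
    ∀ t ∈ Set.Ioo a b, γ t = realCoadExp e x t *ᵥ z := by
  let L : (ι → ℂ) →L[ℂ] (ι → ℂ) :=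
    LinearMap.toContinuousLinearMap (coadMatrix e fun i => (x i : ℂ)).mulVecLin
  exact ODE_solution_unique_of_mem_Ioo (v := fun _ y => L y) (s := fun _ => Set.univ)
    (K := ‖L‖₊) (fun t _ => L.lipschitz.lipschitzOnWith) ht₀
    (fun t ht => ⟨hγ t ht, trivial⟩)
    (fun t _ => ⟨hasDerivAt_realCoadExp_mulVec e x z t, trivial⟩) h₀

/-! ### Invariance of the functions generated by `F1Generators` -/

variable {e}

/-- The generators on a subset of an orbit are restrictions of ambient functions, so their
differentials can be computed in the coordinates of 𝔤*. -/
theorem F1Generators_eq_image {M : Type*} (j : M → ι → ℂ) (V : Set (ι → ℂ))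
    (W : ℂ × ℂ → Set (ι → ℂ)) :
    F1Generators e j V W = (fun F => F ∘ j) '' F1Generators e id V W := by
  ext f
  simp only [F1Generators, Set.mem_union, Set.mem_ofPred_eq, Set.mem_image]
  constructor
  · rintro ((⟨g, hg, rfl⟩ | ⟨g, hg, rfl⟩) | ⟨l, h1, h2, g, hg, rfl⟩)
    · exact ⟨_, Or.inl (Or.inl ⟨g, hg, rfl⟩), rfl⟩
    · exact ⟨_, Or.inl (Or.inr ⟨g, hg, rfl⟩), rfl⟩
    · exact ⟨_, Or.inr ⟨l, h1, h2, g, hg, rfl⟩, rfl⟩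
  · rintro ⟨_, ((⟨g, hg, rfl⟩ | ⟨g, hg, rfl⟩) | ⟨l, h1, h2, g, hg, rfl⟩), rfl⟩
    · exact Or.inl (Or.inl ⟨g, hg, rfl⟩)
    · exact Or.inl (Or.inr ⟨g, hg, rfl⟩)
    · exact Or.inr ⟨l, h1, h2, g, hg, rfl⟩

theorem F1Generators_contDiffAt {V : Set (ι → ℂ)} {W : ℂ × ℂ → Set (ι → ℂ)} (hV : IsOpen V)
    (hW : ∀ l ≠ 0, IsOpen (W l)) {z : ι → ℂ} (hz : z ∈ V) (hzW : ∀ l ≠ 0, phi l z ∈ W l)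
    {F : (ι → ℂ) → ℂ} (hF : F ∈ F1Generators e id V W) : ContDiffAt ℝ ∞ F z := by
  obtain ((⟨g, hg, rfl⟩ | ⟨g, hg, rfl⟩) | ⟨l, h1, h2, g, hg, rfl⟩) := hF
  · exact contDiffAt_holomorphic hV hg.1 hz
  · exact contDiffAt_tildeFun hV hg.1 hz
  · have hl : l ≠ 0 := fun h => h1 (by rw [h]; rfl)
    exact contDiffAt_comp_phi (hW l hl) hg.1 l (hzW l hl)

/-- The generators are infinitesimally invariant under the real Lie algebra. -/
theorem F1Generators_fderiv_eq_zero {V : Set (ι → ℂ)} {W : ℂ × ℂ → Set (ι → ℂ)} (hV : IsOpen V)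
    (hW : ∀ l ≠ 0, IsOpen (W l)) {z : ι → ℂ} (hz : z ∈ V) (hzW : ∀ l ≠ 0, phi l z ∈ W l)
    {F : (ι → ℂ) → ℂ} (hF : F ∈ F1Generators e id V W) :
    ∀ v ∈ realOrbitTangent e z, fderiv ℝ F z v = 0 := by
  rw [covector_vanishes_real_iff]
  obtain ((⟨g, hg, rfl⟩ | ⟨g, hg, rfl⟩) | ⟨l, h1, h2, g, hg, rfl⟩) := hF
  -- The function g itself is treated as g ∘ φ_(1, 0), so the formula for its differential is a
  -- special case.
  · have h10 : phi (1, 0) z = z := by simp [phi_eq]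
    have h := hasFDerivAt_comp_phi hV hg.1 (1, 0) (z := z) (by rwa [h10])
    have hid : g ∘ phi (1, 0) = g ∘ id := by
      funext w; simp [phi_eq]
    rw [hid, h10] at h
    rw [h.fderiv, holCoeff_ofCoeff, antiholCoeff_ofCoeff]
    simp [poissonMatrix_mulVec_holGrad hg hz]
  · rw [Function.comp_id, (hasFDerivAt_tildeFun hV hg.1 hz).fderiv, holCoeff_ofCoeff,
      antiholCoeff_ofCoeff, poissonMatrix_mulVec_tildeCoeff hV hg hz]
  · have hl : l ≠ 0 := fun h => h1 (by rw [h]; rfl)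
    rw [Function.comp_id, (hasFDerivAt_comp_phi (hW l hl) hg.1 l (hzW l hl)).fderiv,
      holCoeff_ofCoeff, antiholCoeff_ofCoeff, Matrix.mulVec_smul, Matrix.mulVec_smul,
      ← Matrix.smul_mulVec, ← Matrix.smul_mulVec, ← Matrix.add_mulVec, ← poissonMatrix_phi,
      poissonMatrix_mulVec_holGrad hg (hzW l hl)]

/-- A function whose derivative vanishes along a one-parameter group is constant along it. -/
theorem eq_of_locally_invariant (x : ι → ℝ) (z : ι → ℂ) (h : ℝ → ℂ)
    (hh : ∀ t ∈ Set.Icc (0 : ℝ) 1, ∃ F : (ι → ℂ) → ℂ,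
      DifferentiableAt ℝ F (realCoadExp e x t *ᵥ z) ∧
      fderiv ℝ F (realCoadExp e x t *ᵥ z)
        (coadMatrix e (fun i => (x i : ℂ)) *ᵥ (realCoadExp e x t *ᵥ z)) = 0 ∧
      ∀ᶠ s in nhdsWithin t (Set.Icc 0 1), h s = F (realCoadExp e x s *ᵥ z)) :
    h 1 = h 0 := by
  have hder : ∀ t ∈ Set.Icc (0 : ℝ) 1, HasDerivWithinAt h 0 (Set.Icc 0 1) t := by
    intro t ht
    obtain ⟨F, hF, hF0, heq⟩ := hh t ht
    -- The function F may change with t; each one only has to give h the derivative 0 at that t,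
    -- within the interval.
    have h1 := hF.hasFDerivAt.comp_hasDerivAt t (hasDerivAt_realCoadExp_mulVec e x z t)
    rw [hF0] at h1
    exact h1.hasDerivWithinAt.congr_of_eventuallyEq heq (heq.self_of_nhdsWithin ht)
  refine constant_of_has_deriv_right_zero (fun t ht => (hder t ht).continuousWithinAt)
    (fun t ht => ?_) 1 (Set.right_mem_Icc.2 zero_le_one)
  refine (hder t (Set.Ico_subset_Icc_self ht)).mono_of_mem_nhdsWithin ?_
  exact Icc_mem_nhdsGE_of_mem ht

/-- Functions functionally generated by `F_1`-generators are infinitesimally invariant. -/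
theorem invariant_of_mem_functionallyGenerated {U : Set (ι → ℂ)} {W : ℂ × ℂ → Set (ι → ℂ)}
    (hU : IsOpen U) (hW : ∀ l ≠ 0, IsOpen (W l) ∧ phi l '' U ⊆ W l) {f : (ι → ℂ) → ℂ}
    (hf : f ∈ functionallyGenerated 𝓘(ℝ, ι → ℂ) U (F1Generators e id U W)) :
    IsRealInvariantOn e U f := by
  have hinf : ∀ z ∈ U, ∀ v ∈ realOrbitTangent e z, fderiv ℝ f z v = 0 := by
    intro z hz v hv
    have hspan : fderiv ℝ f z ∈
        Submodule.span ℂ ((fun s => fderiv ℝ s z) '' F1Generators e id U W) := by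
      have h := hf.2 z hz
      have hd : ∀ s : (ι → ℂ) → ℂ, cdiff 𝓘(ℝ, ι → ℂ) s z = fderiv ℝ s z :=
        fun s => mfderiv_eq_fderiv
      simp only [hd] at h
      exact h
    -- Vanishing on a fixed vector v is a linear condition on covectors, so it passes from the
    -- generators to their span.
    have hle : Submodule.span ℂ ((fun s => fderiv ℝ s z) '' F1Generators e id U W) ≤
        LinearMap.ker (evalCovector v) := by
      rw [Submodule.span_le]
      rintro _ ⟨F, hF, rfl⟩
      exact F1Generators_fderiv_eq_zero hU (fun l hl => (hW l hl).1) hz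
        (fun l hl => (hW l hl).2 ⟨z, hz, rfl⟩) hF v hv
    exact hle hspan
  have hstep : ∀ z w, RealStep e U z w → f w = f z := by
    rintro z w ⟨x, hx, rfl⟩
    have h := eq_of_locally_invariant (e := e) x z (fun t => f (realCoadExp e x t *ᵥ z))
      (fun t ht => ⟨f, ?_, hinf _ (hx t ht) _ ⟨x, rfl⟩, Filter.Eventually.of_forall fun _ => rfl⟩)
    · simpa only [realCoadExp_zero_mulVec] using h
    · exact ((contMDiffOn_iff_contDiffOn.1 hf.1).contDiffAt (hU.mem_nhds (hx t ht))).differentiableAt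
        (by simp)
  intro z _ w hzw
  induction hzw with
  | refl => rfl
  | tail _ h ih => rw [hstep _ _ h, ih]

/-- If U is invariant, whole one-parameter arcs stay in U, so each exponential is a single step;
products follow by induction over the generated group. -/
theorem IsRealInvariantOn.apply_mulVec {U : Set (ι → ℂ)} {f : (ι → ℂ) → ℂ}
    (hf : IsRealInvariantOn e U f) (hU : ∀ A ∈ realCoadjointGroup e, ∀ z ∈ U, A *ᵥ z ∈ U)
    {A : Matrix ι ι ℂ} (hA : A ∈ realCoadjointGroup e) {z : ι → ℂ} (hz : z ∈ U) :
    f (A *ᵥ z) = f z := by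
  have h : ∀ z ∈ U, f (A *ᵥ z) = f z := by
    induction hA using Submonoid.closure_induction with
    | mem A hA =>
      obtain ⟨x, rfl⟩ := hA
      intro z hz
      exact hf z hz _ (Relation.ReflTransGen.single
        ⟨x, fun t _ => hU _ (realCoadExp_mem e x t) z hz, rfl⟩)
    | one => intro z _; rw [Matrix.one_mulVec]
    | mul A B hA hB ihA ihB =>
      intro z hz
      rw [← Matrix.mulVec_mulVec, ihA _ (hU B hB z hz), ihB z hz]
  exact h z hz

end Flow

/-! ### Local retractions and sections -/

section Local

open Filter Topology

/-- The inverse function theorem, normalised to identity derivative: in the applications a linear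
left or right inverse of the derivative has already been composed in. -/
theorem exists_local_inverse {T : Type*} [NormedAddCommGroup T] [NormedSpace ℝ T] [CompleteSpace T]
    {k : T → T} {a : T} (hk : ContDiffAt ℝ ∞ k a)
    (hk' : HasFDerivAt k (ContinuousLinearMap.id ℝ T) a) :
    ∃ κ : T → T, ContDiffAt ℝ ∞ κ (k a) ∧ κ (k a) = a ∧ (∀ᶠ u in 𝓝 a, κ (k u) = u) ∧
      ∀ᶠ v in 𝓝 (k a), k (κ v) = v := by
  have h1 : HasFDerivAt k ((ContinuousLinearEquiv.refl ℝ T : T ≃L[ℝ] T) : T →L[ℝ] T) a := hk'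
  have hs := hk.hasStrictFDerivAt' h1 (by simp)
  exact ⟨hk.localInverse h1 (by simp), hk.to_localInverse h1 (by simp),
    hs.localInverse_apply_image, hs.eventually_left_inverse, hs.eventually_right_inverse⟩

variable {d m : ℕ} {X : Type*} [TopologicalSpace X] [ChartedSpace (EuclideanSpace ℝ (Fin d)) X]
  [IsManifold (𝓡 d) ∞ X]
  {N : Type*} [TopologicalSpace N] [ChartedSpace (EuclideanSpace ℝ (Fin m)) N]
  [IsManifold (𝓡 m) ∞ N]
  {F : Type*} [NormedAddCommGroup F] [NormedSpace ℝ F] [FiniteDimensional ℝ F]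

theorem contDiffAt_comp_extChartAt_symm {j : X → F} (hj : ContMDiff (𝓡 d) 𝓘(ℝ, F) ∞ j) (x₀ : X)
    {u : EuclideanSpace ℝ (Fin d)} (hu : u ∈ (extChartAt (𝓡 d) x₀).target) :
    ContDiffAt ℝ ∞ (j ∘ (extChartAt (𝓡 d) x₀).symm) u := by
  rw [← contMDiffAt_iff_contDiffAt]
  exact (hj _).comp u ((contMDiffOn_extChartAt_symm x₀).contMDiffAt
    (extChartAt_target_mem_nhds' hu))

theorem hasFDerivAt_comp_extChartAt_symm {j : X → F} (hj : ContMDiff (𝓡 d) 𝓘(ℝ, F) ∞ j) (x₀ : X) :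
    HasFDerivAt (j ∘ (extChartAt (𝓡 d) x₀).symm) (mfderiv (𝓡 d) 𝓘(ℝ, F) j x₀)
      (extChartAt (𝓡 d) x₀ x₀) := by
  have h := ((hj x₀).mdifferentiableAt (by simp)).hasMFDerivAt.2
  rw [ModelWithCorners.range_eq_univ] at h
  let J : EuclideanSpace ℝ (Fin d) →L[ℝ] F := mfderiv (𝓡 d) 𝓘(ℝ, F) j x₀
  have h2 : HasFDerivWithinAt (j ∘ (extChartAt (𝓡 d) x₀).symm) J Set.univ
    (extChartAt (𝓡 d) x₀ x₀) := h
  exact hasFDerivWithinAt_univ.1 h2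

/-- An immersion has a smooth local retraction. -/
theorem exists_local_retraction {j : X → F} (hj : ContMDiff (𝓡 d) 𝓘(ℝ, F) ∞ j) (x₀ : X)
    (hinj : Function.Injective (mfderiv (𝓡 d) 𝓘(ℝ, F) j x₀)) :
    ∃ π : F → X, ContMDiffAt 𝓘(ℝ, F) (𝓡 d) ∞ π (j x₀) ∧ ∀ᶠ x in 𝓝 x₀, π (j x) = x := by
  set φ := extChartAt (𝓡 d) x₀ with hφ
  let J : EuclideanSpace ℝ (Fin d) →L[ℝ] F := mfderiv (𝓡 d) 𝓘(ℝ, F) j x₀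
  obtain ⟨L, hL⟩ := exists_continuousLeftInverse J hinj
  have hjt := contDiffAt_comp_extChartAt_symm hj x₀ (mem_extChartAt_target x₀)
  have hjt' : HasFDerivAt (j ∘ φ.symm) J (φ x₀) := hasFDerivAt_comp_extChartAt_symm hj x₀
  -- Composed with a linear left inverse of its derivative, the chart expression of j becomes
  -- locally invertible; undoing it after L gives the retraction.
  have hk : ContDiffAt ℝ ∞ (L ∘ (j ∘ φ.symm)) (φ x₀) := L.contDiff.contDiffAt.comp _ hjt
  have hk' : HasFDerivAt (L ∘ (j ∘ φ.symm)) (ContinuousLinearMap.id ℝ _) (φ x₀) := by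
    refine (L.hasFDerivAt.comp (φ x₀) hjt').congr_fderiv ?_
    ext1 v
    exact hL v
  obtain ⟨κ, hκ, hκa, hleft, -⟩ := exists_local_inverse hk hk'
  have hx₀ : φ.symm (φ x₀) = x₀ := extChartAt_to_inv x₀
  have hLj : (L ∘ (j ∘ φ.symm)) (φ x₀) = L (j x₀) := by simp [hx₀]
  rw [hLj] at hκ hκa
  refine ⟨φ.symm ∘ κ ∘ L, ?_, ?_⟩
  · have h1 : ContMDiffAt 𝓘(ℝ, EuclideanSpace ℝ (Fin d)) (𝓡 d) ∞ φ.symm ((κ ∘ L) (j x₀)) := by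
      refine (contMDiffOn_extChartAt_symm x₀).contMDiffAt ?_
      rw [Function.comp_apply, hκa]
      exact extChartAt_target_mem_nhds x₀
    have h2 : ContDiffAt ℝ ∞ (κ ∘ L) (j x₀) := hκ.comp _ L.contDiff.contDiffAt
    exact h1.comp _ h2.contMDiffAt
  · have h1 := (continuousAt_extChartAt (I := 𝓡 d) x₀).eventually hleft
    filter_upwards [h1, extChartAt_source_mem_nhds (I := 𝓡 d) x₀] with x hx hxs
    have h2 : φ.symm (φ x) = x := φ.left_inv hxs
    simp only [Function.comp_apply] at hx ⊢
    rw [← hφ, h2] at hx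
    rw [hx, h2]

/-- A submersion has smooth local sections. -/
theorem exists_local_section {p : X → N} (hp : ContMDiff (𝓡 d) (𝓡 m) ∞ p) (x₀ : X)
    (hsurj : Function.Surjective (mfderiv (𝓡 d) (𝓡 m) p x₀)) :
    ∃ σ : N → X, ContMDiffAt (𝓡 m) (𝓡 d) ∞ σ (p x₀) ∧ ∀ᶠ y in 𝓝 (p x₀), p (σ y) = y := by
  set φ := extChartAt (𝓡 d) x₀ with hφ
  set ψ := extChartAt (𝓡 m) (p x₀) with hψ
  let P : EuclideanSpace ℝ (Fin d) →L[ℝ] EuclideanSpace ℝ (Fin m) := mfderiv (𝓡 d) (𝓡 m) p x₀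
  obtain ⟨S, hS⟩ := exists_continuousRightInverse P hsurj
  have hx₀ : φ.symm (φ x₀) = x₀ := extChartAt_to_inv x₀
  -- A slice through x₀ in the direction of a linear right inverse of the derivative of p. Along it
  -- p has identity derivative in charts, and inverting p on it gives the section.
  let θ : EuclideanSpace ℝ (Fin m) → X := fun v => φ.symm (φ x₀ + S v)
  have hθ0 : θ 0 = x₀ := by simp only [θ, map_zero, add_zero, hx₀]
  have hθ : ContMDiffAt (𝓡 m) (𝓡 d) ∞ θ 0 := by
    have h1 : ContMDiffAt 𝓘(ℝ, EuclideanSpace ℝ (Fin d)) (𝓡 d) ∞ φ.symm (φ x₀ + S 0) := by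
      refine (contMDiffOn_extChartAt_symm x₀).contMDiffAt ?_
      rw [map_zero, add_zero]
      exact extChartAt_target_mem_nhds x₀
    have h2 : ContDiff ℝ ∞ fun v => φ x₀ + S v := contDiff_const.add S.contDiff
    exact ContMDiffAt.comp (g := φ.symm) (f := fun v => φ x₀ + S v) 0 h1 h2.contMDiff.contMDiffAt
  have hpt : HasFDerivAt (ψ ∘ p ∘ φ.symm) P (φ x₀) := by
    have h := ((hp x₀).mdifferentiableAt (by simp)).hasMFDerivAt.2
    rw [ModelWithCorners.range_eq_univ] at h
    have h2 : HasFDerivWithinAt (ψ ∘ p ∘ φ.symm) P Set.univ (φ x₀) := h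
    exact hasFDerivWithinAt_univ.1 h2
  let k : EuclideanSpace ℝ (Fin m) → EuclideanSpace ℝ (Fin m) := ψ ∘ p ∘ θ
  have hk0 : k 0 = ψ (p x₀) := by simp only [k, Function.comp_apply, hθ0]
  have hpθ : ContMDiffAt (𝓡 m) (𝓡 m) ∞ (p ∘ θ) 0 := (hp _).comp _ hθ
  have hk : ContDiffAt ℝ ∞ k 0 := by
    rw [← contMDiffAt_iff_contDiffAt]
    have h1 : ContMDiffAt (𝓡 m) 𝓘(ℝ, EuclideanSpace ℝ (Fin m)) ∞ ψ ((p ∘ θ) 0) := by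
      rw [Function.comp_apply, hθ0]
      exact contMDiffAt_extChartAt
    exact h1.comp _ hpθ
  have hk' : HasFDerivAt k (ContinuousLinearMap.id ℝ _) 0 := by
    have h1 : HasFDerivAt (fun v => φ x₀ + S v) S 0 := S.hasFDerivAt.const_add _
    have h2 : HasFDerivAt (ψ ∘ p ∘ φ.symm) P (φ x₀ + S 0) := by
      rwa [map_zero, add_zero]
    refine (h2.comp 0 h1).congr_fderiv ?_
    ext1 v
    exact hS v
  obtain ⟨κ, hκ, hκa, -, hright⟩ := exists_local_inverse hk hk'
  rw [hk0] at hκ hκa hright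
  have hσ : ContMDiffAt (𝓡 m) (𝓡 d) ∞ (θ ∘ κ ∘ ψ) (p x₀) := by
    have h1 : ContMDiffAt (𝓡 m) (𝓡 m) ∞ (κ ∘ ψ) (p x₀) :=
      hκ.contMDiffAt.comp _ contMDiffAt_extChartAt
    refine ContMDiffAt.comp _ ?_ h1
    rwa [Function.comp_apply, hκa]
  refine ⟨θ ∘ κ ∘ ψ, hσ, ?_⟩
  have hcont : ContinuousAt (p ∘ θ ∘ κ ∘ ψ) (p x₀) :=
    ((hp _).continuousAt).comp hσ.continuousAt
  have hval : (p ∘ θ ∘ κ ∘ ψ) (p x₀) = p x₀ := by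
    simp only [Function.comp_apply, hκa, hθ0]
  have h1 := (continuousAt_extChartAt (I := 𝓡 m) (p x₀)).eventually hright
  -- The right inverse identity holds only after applying the chart ψ; staying in its source allows
  -- ψ to be cancelled.
  have h2 : ∀ᶠ y in 𝓝 (p x₀), (p ∘ θ ∘ κ ∘ ψ) y ∈ ψ.source := by
    refine hcont.eventually ?_
    rw [hval]
    exact extChartAt_source_mem_nhds (I := 𝓡 m) (p x₀)
  filter_upwards [h1, h2, extChartAt_source_mem_nhds (I := 𝓡 m) (p x₀)] with y hy1 hy2 hy3
  exact ψ.injOn hy2 hy3 hy1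

end Local

/-! ### Real orbits inside open subsets of complex orbits -/

section Fibres

open Filter Topology

variable {ι : Type*} [Fintype ι] [DecidableEq ι] {𝔤₀ : Type*} [LieRing 𝔤₀] [LieAlgebra ℝ 𝔤₀]
  {e : Module.Basis ι ℝ 𝔤₀}
  {d m : ℕ} {X : Type*} [TopologicalSpace X] [ChartedSpace (EuclideanSpace ℝ (Fin d)) X]
  [IsManifold (𝓡 d) ∞ X]
  {N : Type*} [TopologicalSpace N] [ChartedSpace (EuclideanSpace ℝ (Fin m)) N]
  [IsManifold (𝓡 m) ∞ N]
  {F : Type*} [NormedAddCommGroup F] [NormedSpace ℝ F]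
  {F' : Type*} [NormedAddCommGroup F'] [NormedSpace ℝ F']

variable (d) in
/-- The derivative of a vector-valued function on a manifold. -/
noncomputable def vecDeriv (f : X → F) (x : X) : EuclideanSpace ℝ (Fin d) →L[ℝ] F :=
  mfderiv (𝓡 d) 𝓘(ℝ, F) f x

theorem vecDeriv_comp {f : X → F} {x : X} (hf : MDifferentiableAt (𝓡 d) 𝓘(ℝ, F) f x) {g : F → F'}
    (hg : DifferentiableAt ℝ g (f x)) :
    vecDeriv d (g ∘ f) x = (fderiv ℝ g (f x)).comp (vecDeriv d f x) := by
  unfold vecDeriv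
  rw [mfderiv_comp x hg.mdifferentiableAt hf, mfderiv_eq_fderiv]
  rfl

theorem vecDeriv_congr {f g : X → F} {x : X} (h : f =ᶠ[𝓝 x] g) : vecDeriv d f x = vecDeriv d g x :=
  h.mfderiv_eq

theorem vecDeriv_const {f : X → F} {x : X} {c : F} (h : ∀ᶠ x' in 𝓝 x, f x' = c) :
    vecDeriv d f x = 0 := by
  rw [vecDeriv_congr (g := fun _ => c) h]
  exact mfderiv_const

variable (d m) in
/-- The derivative of a map between manifolds. -/
noncomputable def mapDeriv (p : X → N) (x : X) :
    EuclideanSpace ℝ (Fin d) →L[ℝ] EuclideanSpace ℝ (Fin m) := mfderiv (𝓡 d) (𝓡 m) p x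

theorem vecDeriv_comp_map {p : X → N} {x : X} (hp : MDifferentiableAt (𝓡 d) (𝓡 m) p x) {f : N → F}
    (hf : MDifferentiableAt (𝓡 m) 𝓘(ℝ, F) f (p x)) :
    vecDeriv d (f ∘ p) x = (vecDeriv m f (p x)).comp (mapDeriv d m p x) :=
  mfderiv_comp x hf hp

theorem IsOpenInOrbit.mdifferentiableAt {z₀ : ι → ℂ} {j : X → ι → ℂ}
    (hj : IsOpenInOrbit (d := d) e z₀ j) (x : X) : MDifferentiableAt (𝓡 d) 𝓘(ℝ, ι → ℂ) j x :=
  (hj.smooth x).mdifferentiableAt (by simp)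

theorem IsOpenInOrbit.vecDeriv_injective {z₀ : ι → ℂ} {j : X → ι → ℂ}
    (hj : IsOpenInOrbit (d := d) e z₀ j) (x : X) : Function.Injective (vecDeriv d j x) :=
  hj.immersion x

theorem IsOpenInOrbit.range_vecDeriv {z₀ : ι → ℂ} {j : X → ι → ℂ}
    (hj : IsOpenInOrbit (d := d) e z₀ j) (x : X) :
    Set.range (vecDeriv d j x) = complexOrbitTangent e (j x) := hj.tangent x

/-- The coadjoint vector fields are tangent to the complex orbits, so they lift pointwise to a chart
of X. -/
theorem coadMatrix_mulVec_eq_of_chart {z₀ : ι → ℂ} {j : X → ι → ℂ}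
    (hj : IsOpenInOrbit (d := d) e z₀ j) (x₀ : X) {u : EuclideanSpace ℝ (Fin d)}
    (hu : u ∈ (extChartAt (𝓡 d) x₀).target) (v : ι → ℂ) :
    ∃ w, fderiv ℝ (j ∘ (extChartAt (𝓡 d) x₀).symm) u w =
      coadMatrix e v *ᵥ (j ((extChartAt (𝓡 d) x₀).symm u)) := by
  set φ := extChartAt (𝓡 d) x₀ with hφ
  obtain ⟨w, hw⟩ : coadMatrix e v *ᵥ (j (φ.symm u)) ∈ Set.range (vecDeriv d j (φ.symm u)) := by
    rw [hj.range_vecDeriv]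
    exact ⟨v, rfl⟩
  have hsrc : φ.symm u ∈ φ.source := φ.map_target hu
  have hφu : φ (φ.symm u) = u := φ.right_inv hu
  have heq : j =ᶠ[𝓝 (φ.symm u)] (j ∘ φ.symm) ∘ φ := by
    filter_upwards [extChartAt_source_mem_nhds' hsrc] with x hx
    rw [Function.comp_apply, Function.comp_apply, φ.left_inv hx]
  have hdφ : MDifferentiableAt (𝓡 d) 𝓘(ℝ, EuclideanSpace ℝ (Fin d)) φ (φ.symm u) :=
    mdifferentiableAt_extChartAt (by rwa [hφ, extChartAt_source] at hsrc)
  have hd : DifferentiableAt ℝ (j ∘ φ.symm) (φ (φ.symm u)) := by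
    rw [hφu]
    exact (contDiffAt_comp_extChartAt_symm hj.smooth x₀ hu).differentiableAt (by simp)
  rw [vecDeriv_congr heq, vecDeriv_comp hdφ hd, hφu] at hw
  exact ⟨_, hw⟩

/-- A curve whose image is an integral curve of a coadjoint vector field is continuous. -/
theorem continuousWithinAt_of_flow {z₀ : ι → ℂ} {j : X → ι → ℂ}
    (hj : IsOpenInOrbit (d := d) e z₀ j) (x : ι → ℝ) (z : ι → ℂ) {γ : ℝ → X} {s : Set ℝ}
    (hγ : ∀ t ∈ s, j (γ t) = realCoadExp e x t *ᵥ z) {t₀ : ℝ} (ht₀ : t₀ ∈ s) :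
    ContinuousWithinAt γ s t₀ := by
  set x₀ := γ t₀ with hx₀
  set φ := extChartAt (𝓡 d) x₀ with hφ
  set B := coadMatrix e (fun i => (x i : ℂ)) with hB
  let BL : (ι → ℂ) →L[ℝ] (ι → ℂ) :=
    (LinearMap.toContinuousLinearMap B.mulVecLin : (ι → ℂ) →L[ℂ] (ι → ℂ)).restrictScalars ℝ
  have hBL (w : ι → ℂ) : BL w = B *ᵥ w := rfl
  obtain ⟨π, hπ, hπj⟩ := exists_local_retraction hj.smooth x₀ (hj.immersion x₀)
  have hφx₀ : φ.symm (φ x₀) = x₀ := extChartAt_to_inv x₀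
  set jt := j ∘ φ.symm with hjt
  have hjtx₀ : jt (φ x₀) = j x₀ := by rw [hjt, Function.comp_apply, hφx₀]
  have hjts {u : EuclideanSpace ℝ (Fin d)} (hu : u ∈ φ.target) : ContDiffAt ℝ ∞ jt u :=
    contDiffAt_comp_extChartAt_symm hj.smooth x₀ hu
  -- A smooth local left inverse of `jt`, with values in the coordinates of X.
  let χ : (ι → ℂ) → EuclideanSpace ℝ (Fin d) := φ ∘ π
  have hχ : ContDiffAt ℝ ∞ χ (jt (φ x₀)) := by
    rw [hjtx₀, ← contMDiffAt_iff_contDiffAt]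
    have h1 : ContMDiffAt (𝓡 d) 𝓘(ℝ, EuclideanSpace ℝ (Fin d)) ∞ φ (π (j x₀)) := by
      rw [hπj.self_of_nhds]
      exact contMDiffAt_extChartAt
    exact h1.comp _ hπ
  have htarget : φ.target ∈ 𝓝 (φ x₀) := extChartAt_target_mem_nhds x₀
  have hcont0 : ContinuousAt φ.symm (φ x₀) := continuousAt_extChartAt_symm x₀
  have hleft : ∀ᶠ u in 𝓝 (φ x₀), χ (jt u) = u := by
    have h1 : ∀ᶠ u in 𝓝 (φ x₀), π (j (φ.symm u)) = φ.symm u := by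
      refine hcont0.eventually (p := fun x => π (j x) = x) ?_
      rwa [hφx₀]
    filter_upwards [h1, htarget] with u hu1 hu2
    simp only [χ, hjt, Function.comp_apply, hu1]
    exact φ.right_inv hu2
  have hχd : ∀ᶠ u in 𝓝 (φ x₀), DifferentiableAt ℝ χ (jt u) := by
    have h1 : ContDiffAt ℝ 1 χ (jt (φ x₀)) := hχ.of_le (by norm_cast)
    have h2 := (h1.eventually (by simp)).mono fun w hw => hw.differentiableAt one_ne_zero
    exact (hjts (mem_of_mem_nhds htarget)).continuousAt.eventually h2
  -- The lift of the coadjoint vector field to the chart. Defining it through χ makes it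
  -- continuously differentiable, as needed to solve its differential equation.
  let ξ : EuclideanSpace ℝ (Fin d) → EuclideanSpace ℝ (Fin d) := fun u =>
    fderiv ℝ χ (jt u) (BL (jt u))
  have hξ : ContDiffAt ℝ 1 ξ (φ x₀) := by
    have hj1 : ContDiffAt ℝ 1 jt (φ x₀) :=
      (hjts (mem_of_mem_nhds htarget)).of_le (by norm_cast)
    have h1 : ContDiffAt ℝ 1 (fderiv ℝ χ) (jt (φ x₀)) :=
      hχ.fderiv_right (by norm_cast)
    exact (h1.comp (φ x₀) hj1).clm_apply (BL.contDiff.contDiffAt.comp (φ x₀) hj1)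
  have hgood : ∀ᶠ u in 𝓝 (φ x₀), u ∈ φ.target ∧ fderiv ℝ jt u (ξ u) = B *ᵥ jt u := by
    filter_upwards [htarget, hleft.eventually_nhds, hχd] with u hu1 hu2 hu3
    refine ⟨hu1, ?_⟩
    obtain ⟨w, hw⟩ := coadMatrix_mulVec_eq_of_chart hj x₀ hu1 (fun i => (x i : ℂ))
    have h1 : HasFDerivAt (χ ∘ jt) ((fderiv ℝ χ (jt u)).comp (fderiv ℝ jt u)) u :=
      hu3.hasFDerivAt.comp u ((hjts hu1).differentiableAt (by simp)).hasFDerivAt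
    have h2 : HasFDerivAt (χ ∘ jt) (ContinuousLinearMap.id ℝ _) u :=
      (hasFDerivAt_id u).congr_of_eventuallyEq hu2
    have h3 : ξ u = w := by
      change fderiv ℝ χ (jt u) (B *ᵥ jt u) = w
      have h4 : fderiv ℝ χ (jt u) (fderiv ℝ jt u w) = w :=
        congrArg (fun A : EuclideanSpace ℝ (Fin d) →L[ℝ] EuclideanSpace ℝ (Fin d) => A w)
          (h1.unique h2)
      rw [← h4]
      exact congrArg _ hw.symm
    rw [h3]
    exact hw
  obtain ⟨α, hα0, ε, hε, hα⟩ := hξ.exists_forall_mem_closedBall_exists_eq_forall_mem_Ioo_hasDerivAt₀ t₀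
  have hαc : ContinuousAt α t₀ := (hα t₀ (by simp [hε])).continuousAt
  have hgood' : ∀ᶠ t in 𝓝 t₀, α t ∈ φ.target ∧ fderiv ℝ jt (α t) (ξ (α t)) = B *ᵥ jt (α t) := by
    refine hαc.eventually (p := fun u => u ∈ φ.target ∧ fderiv ℝ jt u (ξ u) = B *ᵥ jt u) ?_
    rwa [hα0]
  obtain ⟨δ, hδ, hδg⟩ := Metric.eventually_nhds_iff.1 hgood'
  have hmin : 0 < min δ ε := lt_min hδ hε
  have ht₀m : t₀ ∈ Set.Ioo (t₀ - min δ ε) (t₀ + min δ ε) := by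
    constructor <;> linarith
  -- The image of the solution α in the chart and the one-parameter orbit solve the same linear
  -- equation and agree at t₀. By injectivity of j, γ is then the continuous curve given by α; this
  -- is needed because the topology of X may be finer than that of its image.
  have hflow := eq_realCoadExp_mulVec e x z (γ := jt ∘ α) ht₀m
    (fun t ht => by
      have h1 : t ∈ Set.Ioo (t₀ - ε) (t₀ + ε) :=
        ⟨by linarith [ht.1, min_le_right δ ε], by linarith [ht.2, min_le_right δ ε]⟩
      obtain ⟨h2, h3⟩ := hδg (y := t) (by
        rw [Real.dist_eq, abs_sub_lt_iff]
        constructor <;> linarith [ht.1, ht.2, min_le_left δ ε])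
      have h4 := ((hjts h2).differentiableAt (by simp)).hasFDerivAt.comp_hasDerivAt t (hα t h1)
      rw [h3] at h4
      exact h4)
    (by rw [Function.comp_apply, hα0, hjtx₀, hx₀, hγ t₀ ht₀])
  have hγα : γ =ᶠ[𝓝[s] t₀] φ.symm ∘ α := by
    filter_upwards [self_mem_nhdsWithin, nhdsWithin_le_nhds (Ioo_mem_nhds ht₀m.1 ht₀m.2)]
      with t hts ht
    refine hj.injective ?_
    rw [hγ t hts, ← hflow t ht]
    rfl
  refine ContinuousWithinAt.congr_of_eventuallyEq ?_ hγα (hγα.self_of_nhdsWithin ht₀)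
  refine (ContinuousAt.comp ?_ hαc).continuousWithinAt
  rw [hα0]
  exact hcont0

theorem RealStep.scale {U : Set (ι → ℂ)} {z : ι → ℂ} {x : ι → ℝ}
    (hx : ∀ t ∈ Set.Icc (0 : ℝ) 1, realCoadExp e x t *ᵥ z ∈ U) {t : ℝ}
    (ht : t ∈ Set.Icc (0 : ℝ) 1) : RealStep e U z (realCoadExp e x t *ᵥ z) := by
  have h (s : ℝ) : realCoadExp e (fun i => t * x i) s = realCoadExp e x (s * t) := by
    simp only [realCoadExp]
    congr 1
    ext i
    push_cast
    ring
  refine ⟨fun i => t * x i, fun s hs => ?_, by rw [h, one_mul]⟩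
  rw [h]
  exact hx _ ⟨mul_nonneg hs.1 ht.1, mul_le_one₀ hs.2 ht.1 ht.2⟩

/-- A function on an open subset of a complex orbit that locally extends to infinitesimally
invariant functions is constant on the connected pieces of the real orbits. -/
theorem eq_of_sameRealOrbitIn {z₀ : ι → ℂ} {j : X → ι → ℂ}
    (hj : IsOpenInOrbit (d := d) e z₀ j) {x₀ : X} (h : X → ℂ)
    (hloc : ∀ x, SameRealOrbitIn e (Set.range j) (j x₀) (j x) → ∃ F : (ι → ℂ) → ℂ,
      DifferentiableAt ℝ F (j x) ∧ (∀ v ∈ realOrbitTangent e (j x), fderiv ℝ F (j x) v = 0) ∧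
        ∀ᶠ x' in 𝓝 x, h x' = F (j x'))
    {x₁ : X} (hx₁ : SameRealOrbitIn e (Set.range j) (j x₀) (j x₁)) : h x₁ = h x₀ := by
  -- The endpoint is generalised so that the induction can run over the intermediate points of the
  -- chain of steps.
  have key : ∀ w, SameRealOrbitIn e (Set.range j) (j x₀) w → ∀ x, j x = w → h x = h x₀ := by
    intro w hw
    induction hw with
    | refl => intro x hx; rw [hj.injective hx]
    | @tail y w hzy hyw ih =>
      obtain ⟨x, hx, rfl⟩ := hyw
      have hrange := hx
      have : Nonempty X := ⟨x₀⟩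
      -- The arc is lifted to X point by point; continuity of the lift comes from
      -- `continuousWithinAt_of_flow`.
      choose! γ hγ using hx
      have hmem (t : ℝ) (ht : t ∈ Set.Icc (0 : ℝ) 1) :
          SameRealOrbitIn e (Set.range j) (j x₀) (j (γ t)) := by
        rw [hγ t ht]
        have hstep : RealStep e (Set.range j) y (realCoadExp e x t *ᵥ y) :=
          RealStep.scale hrange ht
        exact Relation.ReflTransGen.tail hzy hstep
      have h10 : h (γ 1) = h (γ 0) := by
        refine eq_of_locally_invariant (e := e) x y (fun t => h (γ t)) fun t ht => ?_
        obtain ⟨F, hF, hF0, heq⟩ := hloc (γ t) (hmem t ht)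
        rw [hγ t ht] at hF hF0
        refine ⟨F, hF, hF0 _ ⟨x, rfl⟩, ?_⟩
        filter_upwards [(continuousWithinAt_of_flow hj x y hγ ht).eventually heq,
          self_mem_nhdsWithin] with s hs hs'
        rw [hs, hγ s hs']
      intro x' hx'
      have h1 : x' = γ 1 := hj.injective (by rw [hx', hγ 1 (by simp)])
      have h0 := ih (γ 0) (by rw [hγ 0 (by simp), realCoadExp_zero_mulVec])
      rw [h1, h10, h0]
  exact key _ hx₁ _ rfl

end Fibres

/-! ### Reduction of the Poisson bivectors -/

section Invariance

open Filter Topology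

variable {ι : Type*} [Fintype ι] [DecidableEq ι] {𝔤₀ : Type*} [LieRing 𝔤₀] [LieAlgebra ℝ 𝔤₀]
  (e : Module.Basis ι ℝ 𝔤₀)

theorem star_coadMatrix_mulVec (x : ι → ℝ) (z : ι → ℂ) :
    star (coadMatrix e (fun i => (x i : ℂ)) *ᵥ z) = coadMatrix e (fun i => (x i : ℂ)) *ᵥ star z := by
  ext j
  simp [coadMatrix, Matrix.mulVec, dotProduct]

/-- The transposed action of a real coadjoint vector field on covectors. -/
theorem coeff_comp_coad (η : (ι → ℂ) →L[ℝ] ℂ) (x : ι → ℝ) (L : (ι → ℂ) →L[ℝ] (ι → ℂ))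
    (hL : ∀ w, L w = coadMatrix e (fun i => (x i : ℂ)) *ᵥ w) :
    holCoeff (η.comp L) = (coadMatrix e fun i => (x i : ℂ))ᵀ *ᵥ holCoeff η ∧
      antiholCoeff (η.comp L) = (coadMatrix e fun i => (x i : ℂ))ᵀ *ᵥ antiholCoeff η := by
  have h : η.comp L = ofCoeff ((coadMatrix e fun i => (x i : ℂ))ᵀ *ᵥ holCoeff η)
      ((coadMatrix e fun i => (x i : ℂ))ᵀ *ᵥ antiholCoeff η) := by
    ext w
    rw [ContinuousLinearMap.comp_apply, hL, covector_apply, ofCoeff_apply, star_coadMatrix_mulVec,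
      Matrix.dotProduct_mulVec, Matrix.dotProduct_mulVec, Matrix.mulVec_transpose,
      Matrix.mulVec_transpose]
  rw [h, holCoeff_ofCoeff, antiholCoeff_ofCoeff]
  exact ⟨rfl, rfl⟩

/-- Infinitesimal invariance of the Poisson bracket. -/
theorem fderiv_poisson_pairing_eq_zero {a a' : (ι → ℂ) → ι → ℂ} {A A' s : (ι → ℂ) →L[ℝ] (ι → ℂ)}
    {z : ι → ℂ} (ha : HasFDerivAt a A z) (ha' : HasFDerivAt a' A' z) :
    DifferentiableAt ℝ (fun w => a w ⬝ᵥ poissonMatrix e (s w) *ᵥ a' w) z ∧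
    ∀ v : ι → ℂ, s (coadMatrix e v *ᵥ z) = coadMatrix e v *ᵥ s z →
      poissonMatrix e (s z) *ᵥ (A (coadMatrix e v *ᵥ z) + (coadMatrix e v)ᵀ *ᵥ a z) = 0 →
      poissonMatrix e (s z) *ᵥ (A' (coadMatrix e v *ᵥ z) + (coadMatrix e v)ᵀ *ᵥ a' z) = 0 →
      fderiv ℝ (fun w => a w ⬝ᵥ poissonMatrix e (s w) *ᵥ a' w) z (coadMatrix e v *ᵥ z) = 0 := by
  -- In the applications s is the identity or the conjugation, which treats c and its conjugate by
  -- one computation.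
  let PL (i k : ι) : (ι → ℂ) →L[ℝ] ℂ := LinearMap.toContinuousLinearMap
    { toFun := fun w => poissonMatrix e (s w) i k
      map_add' := fun v w => by rw [map_add, poissonMatrix_add, Matrix.add_apply]
      map_smul' := fun c w => by
        have : s (c • w) = (c : ℂ) • s w := by rw [map_smul]; rfl
        rw [this, poissonMatrix_smul]; rfl }
  have hP (i k : ι) : HasFDerivAt (fun w => poissonMatrix e (s w) i k) (PL i k) z :=
    (PL i k).hasFDerivAt
  have hder := HasFDerivAt.fun_sum fun i (_ : i ∈ Finset.univ) =>
    (hasFDerivAt_pi'.1 ha i).mul (HasFDerivAt.fun_sum fun k (_ : k ∈ Finset.univ) =>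
      (hP i k).mul (hasFDerivAt_pi'.1 ha' k))
  refine ⟨hder.differentiableAt, fun v hs h h' => ?_⟩
  set B := coadMatrix e v with hB
  have hval : fderiv ℝ (fun w => a w ⬝ᵥ poissonMatrix e (s w) *ᵥ a' w) z (B *ᵥ z) =
      a z ⬝ᵥ poissonMatrix e (s z) *ᵥ A' (B *ᵥ z) +
        a z ⬝ᵥ poissonMatrix e (s (B *ᵥ z)) *ᵥ a' z +
        A (B *ᵥ z) ⬝ᵥ poissonMatrix e (s z) *ᵥ a' z := by
    refine (congrArg (fun f : (ι → ℂ) →L[ℝ] ℂ => f (B *ᵥ z)) hder.fderiv).trans ?_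
    simp only [_root_.sum_apply, _root_.add_apply, _root_.smul_apply, smul_eq_mul,
      ContinuousLinearMap.comp_apply, ContinuousLinearMap.proj_apply, dotProduct, Matrix.mulVec,
      Finset.sum_add_distrib, mul_add, Finset.mul_sum]
    congr 1
    · congr 1
      exact Finset.sum_congr rfl fun i _ => Finset.sum_congr rfl fun k _ => by
        change _ * (_ * poissonMatrix e (s (B *ᵥ z)) i k) = _
        ring
    · refine Finset.sum_congr rfl fun i _ => ?_
      rw [Finset.sum_mul]
      exact Finset.sum_congr rfl fun k _ => by rw [Pi.mul_apply]; ring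
  rw [Matrix.mulVec_add] at h h'
  have h1 := eq_neg_of_add_eq_zero_left h
  have h2 := eq_neg_of_add_eq_zero_left h'
  -- Invariance of the Poisson matrix splits the middle term in two; each half cancels one of the
  -- terms coming from the derivatives of a and a'. The invariance of a and a' is needed only modulo
  -- the kernel of the matrix.
  rw [hval, h2, hs, poissonMatrix_coadMatrix_mulVec, dotProduct_poissonMatrix_comm e _ (A _), h1,
    Matrix.add_mulVec, dotProduct_add, ← Matrix.mulVec_mulVec, ← Matrix.mulVec_mulVec,
    dotProduct_neg, neg_dotProduct, neg_neg, ← neg_eq_iff_eq_neg.2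
      (dotProduct_poissonMatrix_comm e (s z) (Bᵀ *ᵥ a z) (a' z)), Matrix.dotProduct_mulVec _ B,
    Matrix.mulVec_transpose B (a z)]
  ring

end Invariance

/-! ### Descent of the bivectors to the quotient -/

section Reduction

open Filter Topology

variable {ι : Type*} [Fintype ι] [DecidableEq ι] {𝔤₀ : Type*} [LieRing 𝔤₀] [LieAlgebra ℝ 𝔤₀]
  {e : Module.Basis ι ℝ 𝔤₀}
  {d m : ℕ} {X : Type*} [TopologicalSpace X] [ChartedSpace (EuclideanSpace ℝ (Fin d)) X]
  [IsManifold (𝓡 d) ∞ X]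
  {N : Type*} [TopologicalSpace N] [ChartedSpace (EuclideanSpace ℝ (Fin m)) N]
  [IsManifold (𝓡 m) ∞ N]
  {z₀ : ι → ℂ} {j : X → ι → ℂ} {p : X → N}

theorem IsRealOrbitQuotient.isReductionAt (hj : IsOpenInOrbit (d := d) e z₀ j)
    (hp : IsRealOrbitQuotient (d := d) (m := m) e j p) (x : X) :
    IsReductionAt e (j x) (vecDeriv d j x) (mapDeriv d m p x) where
  inj := hj.vecDeriv_injective x
  range := hj.range_vecDeriv x
  surj := hp.submersion x
  ker := hp.fibre_tangent x

theorem IsRealOrbitQuotient.mdifferentiableAt (hp : IsRealOrbitQuotient (d := d) (m := m) e j p)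
    (x : X) : MDifferentiableAt (𝓡 d) (𝓡 m) p x :=
  (hp.smooth x).mdifferentiableAt (by simp)

/-- In a chart, the projection extends locally to `𝔤*`. -/
theorem exists_local_extension (hj : IsOpenInOrbit (d := d) e z₀ j)
    (hp : IsRealOrbitQuotient (d := d) (m := m) e j p) (x : X) :
    ∃ Φ : (ι → ℂ) → EuclideanSpace ℝ (Fin m), ContDiffAt ℝ ∞ Φ (j x) ∧
      ∀ᶠ x' in 𝓝 x, vecDeriv d (extChartAt (𝓡 m) (p x) ∘ p) x' =
        (fderiv ℝ Φ (j x')).comp (vecDeriv d j x') ∧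
        ∀ v ∈ realOrbitTangent e (j x'), fderiv ℝ Φ (j x') v = 0 := by
  set ψ := extChartAt (𝓡 m) (p x) with hψ
  obtain ⟨π, hπ, hπj⟩ := exists_local_retraction hj.smooth x (hj.immersion x)
  have hΦ : ContDiffAt ℝ ∞ (ψ ∘ p ∘ π) (j x) := by
    rw [← contMDiffAt_iff_contDiffAt]
    have h0 : ContMDiffAt 𝓘(ℝ, ι → ℂ) (𝓡 m) ∞ (p ∘ π) (j x) := (hp.smooth _).comp _ hπ
    have h1 : ContMDiffAt (𝓡 m) 𝓘(ℝ, EuclideanSpace ℝ (Fin m)) ∞ ψ ((p ∘ π) (j x)) := by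
      rw [Function.comp_apply, hπj.self_of_nhds]
      exact contMDiffAt_extChartAt
    exact h1.comp _ h0
  refine ⟨ψ ∘ p ∘ π, hΦ, ?_⟩
  have hd : ∀ᶠ x' in 𝓝 x, DifferentiableAt ℝ (ψ ∘ p ∘ π) (j x') := by
    have h1 : ContDiffAt ℝ 1 (ψ ∘ p ∘ π) (j x) := hΦ.of_le (by norm_cast)
    exact (hj.smooth x).continuousAt.eventually
      ((h1.eventually (by simp)).mono fun w hw => hw.differentiableAt one_ne_zero)
  have hsrc : ∀ᶠ x' in 𝓝 x, p x' ∈ ψ.source :=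
    (hp.smooth x).continuousAt.eventually (extChartAt_source_mem_nhds (I := 𝓡 m) (p x))
  filter_upwards [hπj.eventually_nhds, hd, hsrc] with x' h1 h2 h3
  have heq : vecDeriv d (ψ ∘ p) x' = (fderiv ℝ (ψ ∘ p ∘ π) (j x')).comp (vecDeriv d j x') := by
    rw [← vecDeriv_comp (hj.mdifferentiableAt x') h2]
    refine vecDeriv_congr ?_
    filter_upwards [h1] with x'' h
    simp only [Function.comp_apply, h]
  refine ⟨heq, fun v hv => ?_⟩
  obtain ⟨w, rfl⟩ : v ∈ Set.range (vecDeriv d j x') :=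
    (hj.range_vecDeriv x').symm ▸ realOrbitTangent_subset _ hv
  -- Real orbit directions are the kernel of the derivative of p, so the extension is stationary
  -- along them.
  have h4 : vecDeriv d (ψ ∘ p) x' w = 0 := by
    have hψd : MDifferentiableAt (𝓡 m) 𝓘(ℝ, EuclideanSpace ℝ (Fin m)) ψ (p x') :=
      mdifferentiableAt_extChartAt (by rwa [hψ, extChartAt_source] at h3)
    rw [vecDeriv_comp_map (hp.mdifferentiableAt x') hψd, ContinuousLinearMap.comp_apply,
      ((hp.isReductionAt hj x').ker w).2 hv, map_zero]
  rw [heq] at h4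
  exact h4

/-- The chart at y has identity derivative at y. Hence p can be replaced, along a whole fibre, by
its expression in one fixed chart, and fixed covectors α, β can be pulled back to varying points. -/
theorem vecDeriv_extChartAt_comp (hp : IsRealOrbitQuotient (d := d) (m := m) e j p) {x : X} {y : N}
    (hx : p x = y) : vecDeriv d (extChartAt (𝓡 m) y ∘ p) x = mapDeriv d m p x := by
  subst hx
  have hψd : MDifferentiableAt (𝓡 m) 𝓘(ℝ, EuclideanSpace ℝ (Fin m))
      (extChartAt (𝓡 m) (p x)) (p x) := mdifferentiableAt_extChartAt (mem_chart_source _ _)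
  rw [vecDeriv_comp_map (hp.mdifferentiableAt x) hψd]
  have : vecDeriv m (extChartAt (𝓡 m) (p x)) (p x) = ContinuousLinearMap.id ℝ _ :=
    mfderiv_extChartAt_self
  rw [this]
  rfl

/-- The derivative of the differential of a local extension along a real coadjoint vector field,
up to covectors that vanish on the complex orbit. -/
theorem second_derivative_local_extension (hj : IsOpenInOrbit (d := d) e z₀ j) {x : X}
    {Φ : (ι → ℂ) → EuclideanSpace ℝ (Fin m)} (hΦ : ContDiffAt ℝ ∞ Φ (j x))
    (hΦ0 : ∀ᶠ x' in 𝓝 x, ∀ v ∈ realOrbitTangent e (j x'), fderiv ℝ Φ (j x') v = 0)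
    (ξ : ι → ℝ) (w : ι → ℂ) (hw : w ∈ complexOrbitTangent e (j x)) :
    fderiv ℝ (fderiv ℝ Φ) (j x) (coadMatrix e (fun i => (ξ i : ℂ)) *ᵥ j x) w +
      fderiv ℝ Φ (j x) (coadMatrix e (fun i => (ξ i : ℂ)) *ᵥ w) = 0 := by
  let L : (ι → ℂ) →L[ℝ] (ι → ℂ) := (LinearMap.toContinuousLinearMap
    (coadMatrix e (fun i => (ξ i : ℂ))).mulVecLin : (ι → ℂ) →L[ℂ] (ι → ℂ)).restrictScalars ℝ
  have hL (w : ι → ℂ) : L w = coadMatrix e (fun i => (ξ i : ℂ)) *ᵥ w := rfl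
  have h2 : ContDiffAt ℝ 2 Φ (j x) := hΦ.of_le (by norm_cast)
  have hd : HasFDerivAt (fderiv ℝ Φ) (fderiv ℝ (fderiv ℝ Φ) (j x)) (j x) :=
    ((hΦ.fderiv_right (m := 1) (by norm_cast)).differentiableAt one_ne_zero).hasFDerivAt
  have hq := hd.clm_apply (L.hasFDerivAt (x := j x))
  -- The derivative of Φ along the coadjoint field vanishes only on the image of j, so it may be
  -- differentiated only in directions tangent to the complex orbit; symmetry of the second
  -- derivative then exchanges the two directions.
  have h0 : vecDeriv d ((fun z => fderiv ℝ Φ z (L z)) ∘ j) x = 0 :=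
    vecDeriv_const (hΦ0.mono fun x' h => h _ ⟨ξ, rfl⟩)
  rw [vecDeriv_comp (hj.mdifferentiableAt x) hq.differentiableAt, hq.fderiv] at h0
  rw [← hj.range_vecDeriv] at hw
  obtain ⟨u, rfl⟩ := hw
  have h3 := congrArg (fun A : EuclideanSpace ℝ (Fin d) →L[ℝ] EuclideanSpace ℝ (Fin m) => A u) h0
  have h4 : fderiv ℝ Φ (j x) (L (vecDeriv d j x u)) +
      fderiv ℝ (fderiv ℝ Φ) (j x) (vecDeriv d j x u) (L (j x)) = 0 := h3
  rw [(h2.isSymmSndFDerivAt (by simp)).eq, add_comm]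
  exact h4

/-- The reductions of the linear Poisson bivector and of its conjugate do not depend on the choice
of a point of the fibre. -/
theorem lieBivector_pull_eq (hj : IsOpenInOrbit (d := d) e z₀ j)
    (hp : IsRealOrbitQuotient (d := d) (m := m) e j p) {x₀ x₁ : X} (hx : p x₀ = p x₁)
    (α β : EuclideanSpace ℝ (Fin m) →L[ℝ] ℂ) :
    lieBivector e (j x₁) (extendCovector (vecDeriv d j x₁) (α.comp (mapDeriv d m p x₁)))
        (extendCovector (vecDeriv d j x₁) (β.comp (mapDeriv d m p x₁))) =
      lieBivector e (j x₀) (extendCovector (vecDeriv d j x₀) (α.comp (mapDeriv d m p x₀)))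
        (extendCovector (vecDeriv d j x₀) (β.comp (mapDeriv d m p x₀))) ∧
    lieBivectorConj e (j x₁) (extendCovector (vecDeriv d j x₁) (α.comp (mapDeriv d m p x₁)))
        (extendCovector (vecDeriv d j x₁) (β.comp (mapDeriv d m p x₁))) =
      lieBivectorConj e (j x₀) (extendCovector (vecDeriv d j x₀) (α.comp (mapDeriv d m p x₀)))
        (extendCovector (vecDeriv d j x₀) (β.comp (mapDeriv d m p x₀))) := by
  set ψ := extChartAt (𝓡 m) (p x₀) with hψ
  rw [← vecDeriv_extChartAt_comp hp hx.symm, ← vecDeriv_extChartAt_comp hp rfl, ← hψ]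
  have hfib := (hp.fibre x₀ x₁).1 hx
  have local_data : ∀ x, SameRealOrbitIn e (Set.range j) (j x₀) (j x) →
      ∃ Φ : (ι → ℂ) → EuclideanSpace ℝ (Fin m), ContDiffAt ℝ ∞ Φ (j x) ∧
      ∀ᶠ x' in 𝓝 x, vecDeriv d (ψ ∘ p) x' = (fderiv ℝ Φ (j x')).comp (vecDeriv d j x') ∧
        ∀ v ∈ realOrbitTangent e (j x'), fderiv ℝ Φ (j x') v = 0 := by
    intro x hx'
    have := exists_local_extension hj hp x
    rwa [← (hp.fibre x₀ x).2 hx'] at this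
  have coeff_deriv (x : X) {Φ : (ι → ℂ) → EuclideanSpace ℝ (Fin m)}
      (hΦ : ContDiffAt ℝ ∞ Φ (j x)) (κ : ((ι → ℂ) →L[ℝ] ℂ) →ₗ[ℂ] (ι → ℂ))
      (α : EuclideanSpace ℝ (Fin m) →L[ℝ] ℂ) :
      ∃ A : (ι → ℂ) →L[ℝ] (ι → ℂ), HasFDerivAt (fun z => κ (α.comp (fderiv ℝ Φ z))) A (j x) ∧
        ∀ w, A w = κ (α.comp (fderiv ℝ (fderiv ℝ Φ) (j x) w)) := by
    let K : ((ι → ℂ) →L[ℝ] EuclideanSpace ℝ (Fin m)) →L[ℝ] (ι → ℂ) :=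
      LinearMap.toContinuousLinearMap
        ((κ.restrictScalars ℝ) ∘ₗ (ContinuousLinearMap.compL ℝ (ι → ℂ)
          (EuclideanSpace ℝ (Fin m)) ℂ α).toLinearMap)
    have hd : HasFDerivAt (fderiv ℝ Φ) (fderiv ℝ (fderiv ℝ Φ) (j x)) (j x) :=
      ((hΦ.fderiv_right (m := 1) (by norm_cast)).differentiableAt one_ne_zero).hasFDerivAt
    exact ⟨K.comp (fderiv ℝ (fderiv ℝ Φ) (j x)), K.hasFDerivAt.comp (j x) hd, fun w => rfl⟩
  -- The Lie derivative of the pulled-back covector field annihilates the complex orbit, so its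
  -- coefficients lie in the kernels of the two matrices; this is the hypothesis of
  -- `fderiv_poisson_pairing_eq_zero`.
  have vanish (x : X) {Φ : (ι → ℂ) → EuclideanSpace ℝ (Fin m)}
      (hΦ : ContDiffAt ℝ ∞ Φ (j x))
      (hΦ0 : ∀ᶠ x' in 𝓝 x, ∀ v ∈ realOrbitTangent e (j x'), fderiv ℝ Φ (j x') v = 0)
      (ξ : ι → ℝ) (α : EuclideanSpace ℝ (Fin m) →L[ℝ] ℂ) :
      poissonMatrix e (j x) *ᵥ (holCoeff (α.comp (fderiv ℝ (fderiv ℝ Φ) (j x)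
          (coadMatrix e (fun i => (ξ i : ℂ)) *ᵥ j x))) +
        (coadMatrix e fun i => (ξ i : ℂ))ᵀ *ᵥ holCoeff (α.comp (fderiv ℝ Φ (j x)))) = 0 ∧
      poissonMatrix e (star (j x)) *ᵥ (antiholCoeff (α.comp (fderiv ℝ (fderiv ℝ Φ) (j x)
          (coadMatrix e (fun i => (ξ i : ℂ)) *ᵥ j x))) +
        (coadMatrix e fun i => (ξ i : ℂ))ᵀ *ᵥ antiholCoeff (α.comp (fderiv ℝ Φ (j x)))) = 0 := by
    let L : (ι → ℂ) →L[ℝ] (ι → ℂ) := (LinearMap.toContinuousLinearMap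
      (coadMatrix e (fun i => (ξ i : ℂ))).mulVecLin : (ι → ℂ) →L[ℂ] (ι → ℂ)).restrictScalars ℝ
    obtain ⟨e1, e2⟩ := coeff_comp_coad e (α.comp (fderiv ℝ Φ (j x))) ξ L (fun _ => rfl)
    rw [← e1, ← e2, ← map_add, ← map_add]
    refine (covector_vanishes_iff e _ _).1 fun w hw => ?_
    have := second_derivative_local_extension hj hΦ hΦ0 ξ w hw
    exact (map_add α _ _).symm.trans ((congrArg α this).trans (map_zero α))
  constructor
  -- The bracket is a function on X alone, because of the chosen extensions of covectors. Near each
  -- point of the fibre it agrees with the pairing of the coefficients of α ∘ Φ' and β ∘ Φ', a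
  -- smooth ambient function.
  · refine eq_of_sameRealOrbitIn hj (fun x => lieBivector e (j x)
      (extendCovector (vecDeriv d j x) (α.comp (vecDeriv d (ψ ∘ p) x)))
      (extendCovector (vecDeriv d j x) (β.comp (vecDeriv d (ψ ∘ p) x)))) (fun x hx' => ?_) hfib
    obtain ⟨Φ, hΦ, hev⟩ := local_data x hx'
    obtain ⟨A, hA, hAw⟩ := coeff_deriv x hΦ holCoeff α
    obtain ⟨A', hA', hAw'⟩ := coeff_deriv x hΦ holCoeff β
    have hfd := fderiv_poisson_pairing_eq_zero e (s := ContinuousLinearMap.id ℝ _) hA hA'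
    refine ⟨_, hfd.1, ?_, ?_⟩
    · rintro _ ⟨ξ, rfl⟩
      refine hfd.2 _ rfl ?_ ?_
      · rw [hAw]
        exact (vanish x hΦ (hev.mono fun _ h => h.2) ξ α).1
      · rw [hAw']
        exact (vanish x hΦ (hev.mono fun _ h => h.2) ξ β).1
    · filter_upwards [hev] with x' h
      refine Eq.trans ?_ (lieBivector_apply e (j x') (α.comp (fderiv ℝ Φ (j x')))
        (β.comp (fderiv ℝ Φ (j x'))))
      refine lieBivector_congr (hj.range_vecDeriv x') ?_ ?_ <;>
      · rw [extendCovector_comp (hj.vecDeriv_injective x'), h.1]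
        rfl
  -- This map is the complex conjugation; it commutes with the real coadjoint fields.
  · let S : (ι → ℂ) →L[ℝ] (ι → ℂ) := phiL (0, 1)
    have hS (w : ι → ℂ) : S w = star w := by
      rw [phiL_apply, phi_eq]
      simp
    refine eq_of_sameRealOrbitIn hj (fun x => lieBivectorConj e (j x)
      (extendCovector (vecDeriv d j x) (α.comp (vecDeriv d (ψ ∘ p) x)))
      (extendCovector (vecDeriv d j x) (β.comp (vecDeriv d (ψ ∘ p) x)))) (fun x hx' => ?_) hfib
    obtain ⟨Φ, hΦ, hev⟩ := local_data x hx'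
    obtain ⟨A, hA, hAw⟩ := coeff_deriv x hΦ antiholCoeff α
    obtain ⟨A', hA', hAw'⟩ := coeff_deriv x hΦ antiholCoeff β
    have hfd := fderiv_poisson_pairing_eq_zero e (s := S) hA hA'
    refine ⟨_, hfd.1, ?_, ?_⟩
    · rintro _ ⟨ξ, rfl⟩
      refine hfd.2 _ (by rw [hS, hS, star_coadMatrix_mulVec]) ?_ ?_
      · rw [hAw, hS]
        exact (vanish x hΦ (hev.mono fun _ h => h.2) ξ α).2
      · rw [hAw', hS]
        exact (vanish x hΦ (hev.mono fun _ h => h.2) ξ β).2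
    · filter_upwards [hev] with x' h
      rw [hS]
      refine Eq.trans ?_ (lieBivectorConj_apply e (j x') (α.comp (fderiv ℝ Φ (j x')))
        (β.comp (fderiv ℝ Φ (j x'))))
      refine lieBivectorConj_congr (hj.range_vecDeriv x') ?_ ?_ <;>
      · rw [extendCovector_comp (hj.vecDeriv_injective x'), h.1]
        rfl

end Reduction

/-! ### Kernels of the reduced bivectors -/

section Kernels

open Filter Topology

variable {ι : Type*} [Fintype ι] [DecidableEq ι] {𝔤₀ : Type*} [LieRing 𝔤₀] [LieAlgebra ℝ 𝔤₀]
  {e : Module.Basis ι ℝ 𝔤₀}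
  {T : Type*} [NormedAddCommGroup T] [NormedSpace ℝ T] [FiniteDimensional ℝ T]
  {Q : Type*} [NormedAddCommGroup Q] [NormedSpace ℝ Q] [FiniteDimensional ℝ Q]
  {V : Set (ι → ℂ)} {W : ℂ × ℂ → Set (ι → ℂ)} {z : ι → ℂ}

/-- The covector with given coefficients, restricted along `J`. -/
noncomputable def restrictedCovector (J : T →L[ℝ] (ι → ℂ)) :
    ((ι → ℂ) × (ι → ℂ)) →ₗ[ℂ] (T →L[ℝ] ℂ) where
  toFun q := (ofCoeff q.1 q.2).comp J
  map_add' q q' := by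
    ext v
    simp only [ContinuousLinearMap.comp_apply, _root_.add_apply, ofCoeff_apply, Prod.fst_add,
      Prod.snd_add, add_dotProduct]
    ring
  map_smul' c q := by
    ext v
    simp only [ContinuousLinearMap.comp_apply, _root_.smul_apply, ofCoeff_apply, Prod.smul_fst,
      Prod.smul_snd, smul_dotProduct, RingHom.id_apply, smul_add]

theorem restrictedCovector_congr {J : T →L[ℝ] (ι → ℂ)}
    (hJ : Set.range J = complexOrbitTangent e z) {a b a' b' : ι → ℂ}
    (ha : poissonMatrix e z *ᵥ a = poissonMatrix e z *ᵥ a')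
    (hb : poissonMatrix e (star z) *ᵥ b = poissonMatrix e (star z) *ᵥ b') :
    restrictedCovector J (a, b) = restrictedCovector J (a', b') :=
  (comp_eq_iff_of_range hJ _ _).2 ⟨by rw [holCoeff_ofCoeff, holCoeff_ofCoeff, ha],
    by rw [antiholCoeff_ofCoeff, antiholCoeff_ofCoeff, hb]⟩

theorem IsAdmissible.mem_span_star_holGrad (hV : IsAdmissible e V) (hz : z ∈ V) {v : ι → ℂ}
    (hv : poissonMatrix e (star z) *ᵥ v = 0) :
    v ∈ Submodule.span ℂ ((fun g => star (holGrad g z)) '' holCasimirs e V) := by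
  have h : poissonMatrix e z *ᵥ star v = 0 := by
    have := poissonMatrix_star_mulVec e (star z) v
    rw [star_star, hv, star_zero] at this
    exact this
  have key : ∀ u ∈ Submodule.span ℂ ((fun g => holGrad g z) '' holCasimirs e V),
      star u ∈ Submodule.span ℂ ((fun g => star (holGrad g z)) '' holCasimirs e V) := by
    intro u hu
    induction hu using Submodule.span_induction with
    | mem u hu =>
      obtain ⟨g, hg, rfl⟩ := hu
      exact Submodule.subset_span ⟨g, hg, rfl⟩
    | zero => rw [star_zero]; exact Submodule.zero_mem _
    | add u v _ _ hu hv => rw [star_add]; exact Submodule.add_mem _ hu hv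
    | smul c u _ hu => rw [star_smul]; exact Submodule.smul_mem _ _ hu
  have := key _ (hV.mem_span_holGrad hz h)
  rwa [star_star] at this

/-- The kernel is spanned by conjugated gradients of Casimir functions g, and the differential of g̃
completes each of them. This provides the completion required in `finrank_ker_left`. -/
theorem IsAdmissible.exists_antihol (hV : IsAdmissible e V) (hz : z ∈ V) (v : ι → ℂ)
    (hv : poissonMatrix e (star z) *ᵥ v = 0) :
    ∃ w, poissonMatrix e z *ᵥ v + poissonMatrix e (star z) *ᵥ w = 0 := by
  have hle : Submodule.span ℂ ((fun g => star (holGrad g z)) '' holCasimirs e V) ≤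
      (LinearMap.range (poissonMatrix e (star z)).mulVecLin).comap
        (poissonMatrix e z).mulVecLin := by
    rw [Submodule.span_le]
    rintro _ ⟨g, hg, rfl⟩
    refine ⟨-tildeCoeff g z, ?_⟩
    rw [Matrix.mulVecLin_apply, Matrix.mulVec_neg, Matrix.mulVecLin_apply]
    exact (eq_neg_of_add_eq_zero_left (poissonMatrix_mulVec_tildeCoeff hV.1 hg hz)).symm
  obtain ⟨w, hw⟩ := hle (hV.mem_span_star_holGrad hz hv)
  simp only [Matrix.mulVecLin_apply] at hw
  exact ⟨-w, by rw [Matrix.mulVec_neg, hw, add_neg_cancel]⟩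

theorem IsAdmissible.exists_hol (hV : IsAdmissible e V) (hz : z ∈ V) (w : ι → ℂ)
    (hw : poissonMatrix e z *ᵥ w = 0) :
    ∃ v, poissonMatrix e z *ᵥ v + poissonMatrix e (star z) *ᵥ w = 0 := by
  obtain ⟨v, hv⟩ := hV.exists_antihol hz (star w) (by rw [poissonMatrix_star_mulVec, hw, star_zero])
  refine ⟨star v, ?_⟩
  have h := congrArg star hv
  rw [star_add, star_zero, ← poissonMatrix_star_mulVec, ← poissonMatrix_star_mulVec, star_star,
    star_star, add_comm] at h
  exact h

variable (e V W z) in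
/-- The span of the restrictions along `J` of the differentials of the generators of `F_1`. -/
noncomputable def generatorSpan (J : T →L[ℝ] (ι → ℂ)) : Submodule ℂ (T →L[ℝ] ℂ) :=
  Submodule.span ℂ ((fun G => (fderiv ℝ G z).comp J) '' F1Generators e id V W)

/-- The vector u is a combination of gradients at φ_l(z) of Casimir functions on `W l`, and the
covector depends linearly on u. -/
theorem restrictedCovector_mem_of_ne (hW : ∀ l ≠ 0, IsAdmissible e (W l) ∧ phi l z ∈ W l)
    (J : T →L[ℝ] (ι → ℂ)) {l : ℂ × ℂ} (h1 : l.1 ≠ 0) (h2 : l.2 ≠ 0) {u : ι → ℂ}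
    (hu : poissonMatrix e (phi l z) *ᵥ u = 0) :
    restrictedCovector J (l.1 • u, l.2 • u) ∈ generatorSpan e V W z J := by
  have hl : l ≠ 0 := fun h => h1 (by rw [h]; rfl)
  obtain ⟨hadm, hmem⟩ := hW l hl
  have hu' := hadm.mem_span_holGrad hmem hu
  have hle : Submodule.span ℂ ((fun g => holGrad g (phi l z)) '' holCasimirs e (W l)) ≤
      (generatorSpan e V W z J).comap (restrictedCovector J ∘ₗ
        (l.1 • LinearMap.id).prod (l.2 • LinearMap.id)) := by
    rw [Submodule.span_le]
    rintro _ ⟨g, hg, rfl⟩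
    refine Submodule.subset_span ⟨g ∘ phi l, Or.inr ⟨l, h1, h2, g, hg, rfl⟩, ?_⟩
    change (fderiv ℝ (g ∘ phi l) z).comp J = _
    rw [(hasFDerivAt_comp_phi hadm.1 hg.1 l hmem).fderiv]
    rfl
  exact hle hu'

theorem restrictedCovector_mem_of_antihol (hV : IsAdmissible e V) (hz : z ∈ V)
    {J : T →L[ℝ] (ι → ℂ)} (hJ : Set.range J = complexOrbitTangent e z) {v w : ι → ℂ}
    (hv : poissonMatrix e (star z) *ᵥ v = 0)
    (hvw : poissonMatrix e z *ᵥ v + poissonMatrix e (star z) *ᵥ w = 0) :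
    restrictedCovector J (v, w) ∈ generatorSpan e V W z J := by
  -- The relation determines w modulo the kernel of the conjugate matrix, which restriction to the
  -- orbit ignores, so one suitable completion is enough.
  have key : ∃ w', poissonMatrix e z *ᵥ v + poissonMatrix e (star z) *ᵥ w' = 0 ∧
      restrictedCovector J (v, w') ∈ generatorSpan e V W z J := by
    have hv' := hV.mem_span_star_holGrad hz hv
    clear hv hvw
    induction hv' using Submodule.span_induction with
    | mem v hv =>
      obtain ⟨g, hg, rfl⟩ := hv
      refine ⟨tildeCoeff g z, poissonMatrix_mulVec_tildeCoeff hV.1 hg hz, ?_⟩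
      refine Submodule.subset_span ⟨tildeFun g, Or.inl (Or.inr ⟨g, hg, rfl⟩), ?_⟩
      change (fderiv ℝ (tildeFun g) z).comp J = _
      rw [(hasFDerivAt_tildeFun hV.1 hg.1 hz).fderiv]
      rfl
    | zero =>
      exact ⟨0, by simp, by rw [← Prod.zero_eq_mk, map_zero]; exact Submodule.zero_mem _⟩
    | add v v' _ _ h h' =>
      obtain ⟨w, hw, hS⟩ := h
      obtain ⟨w', hw', hS'⟩ := h'
      refine ⟨w + w', ?_, ?_⟩
      · rw [Matrix.mulVec_add, Matrix.mulVec_add, add_add_add_comm, hw, hw', add_zero]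
      · rw [← Prod.mk_add_mk, map_add]
        exact Submodule.add_mem _ hS hS'
    | smul c v _ h =>
      obtain ⟨w, hw, hS⟩ := h
      refine ⟨c • w, ?_, ?_⟩
      · rw [Matrix.mulVec_smul, Matrix.mulVec_smul, ← smul_add, hw, smul_zero]
      · rw [← Prod.smul_mk, map_smul]
        exact Submodule.smul_mem _ _ hS
  obtain ⟨w', hw', hS⟩ := key
  rwa [restrictedCovector_congr hJ rfl (add_left_cancel (hvw.trans hw'.symm))]

/-- The candidates are the differentials of the conjugates of the functions g̃, which are not
generators. They are reached as derivatives of covectors in the span, by `mem_of_hasDerivAt`. -/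
theorem restrictedCovector_mem_of_hol (hV : IsAdmissible e V) (hz : z ∈ V)
    (hW : ∀ l ≠ 0, IsAdmissible e (W l) ∧ phi l z ∈ W l)
    {J : T →L[ℝ] (ι → ℂ)} (hJ : Set.range J = complexOrbitTangent e z) {v w : ι → ℂ}
    (hw : poissonMatrix e z *ᵥ w = 0)
    (hvw : poissonMatrix e z *ᵥ v + poissonMatrix e (star z) *ᵥ w = 0) :
    restrictedCovector J (v, w) ∈ generatorSpan e V W z J := by
  have base {g : (ι → ℂ) → ℂ} (hg : g ∈ holCasimirs e V) :
      restrictedCovector J (star (tildeCoeff g z), holGrad g z) ∈ generatorSpan e V W z J := by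
    refine mem_of_hasDerivAt ((generatorSpan e V W z J).comap (restrictedCovector J))
      (hasDerivAt_holGrad_phi hV.1 hg.1 hz) ?_
    have hcont : ContinuousAt (fun ε : ℝ => phi (1, (ε : ℂ)) z) 0 := by
      simp only [phi_eq]
      fun_prop
    have hV0 : ∀ᶠ ε : ℝ in 𝓝 0, phi (1, (ε : ℂ)) z ∈ V :=
      hcont.eventually (p := fun w => w ∈ V) (by
        have : phi (1, ((0 : ℝ) : ℂ)) z = z := by simp [phi_eq]
        change ∀ᶠ w in 𝓝 (phi (1, ((0 : ℝ) : ℂ)) z), w ∈ V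
        rw [this]
        exact hV.1.mem_nhds hz)
    filter_upwards [hV0] with ε hε
    rw [Submodule.mem_comap]
    -- At ε = 0 the covector is the differential of g, which vanishes on the orbit.
    by_cases h0 : ε = 0
    · have h1 : phi (1, (ε : ℂ)) z = z := by simp [h0, phi_eq]
      rw [h1, h0, restrictedCovector_congr (a' := 0) (b' := 0) hJ, ← Prod.zero_eq_mk, map_zero]
      · exact Submodule.zero_mem _
      · rw [poissonMatrix_mulVec_holGrad hg hz, Matrix.mulVec_zero]
      · simp
    -- Here g is a Casimir function on V only, but its gradient lies in the kernel of the Poisson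
    -- matrix at φ_(1, ε)(z), and this suffices.
    · have := restrictedCovector_mem_of_ne (V := V) hW J (l := (1, (ε : ℂ))) one_ne_zero
        (Complex.ofReal_ne_zero.2 h0) (poissonMatrix_mulVec_holGrad hg hε)
      rwa [one_smul] at this
  have key : ∃ v', poissonMatrix e z *ᵥ v' + poissonMatrix e (star z) *ᵥ w = 0 ∧
      restrictedCovector J (v', w) ∈ generatorSpan e V W z J := by
    have hw' := hV.mem_span_holGrad hz hw
    clear hw hvw
    induction hw' using Submodule.span_induction with
    | mem w hw =>
      obtain ⟨g, hg, rfl⟩ := hw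
      refine ⟨star (tildeCoeff g z), ?_, base hg⟩
      have h := congrArg star (poissonMatrix_mulVec_tildeCoeff hV.1 hg hz)
      rwa [star_add, star_zero, ← poissonMatrix_star_mulVec, ← poissonMatrix_star_mulVec,
        star_star, star_star, add_comm] at h
    | zero =>
      exact ⟨0, by simp, by rw [← Prod.zero_eq_mk, map_zero]; exact Submodule.zero_mem _⟩
    | add w w' _ _ h h' =>
      obtain ⟨v, hv, hS⟩ := h
      obtain ⟨v', hv', hS'⟩ := h'
      refine ⟨v + v', ?_, ?_⟩
      · rw [Matrix.mulVec_add, Matrix.mulVec_add, add_add_add_comm, hv, hv', add_zero]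
      · rw [← Prod.mk_add_mk, map_add]
        exact Submodule.add_mem _ hS hS'
    | smul c w _ h =>
      obtain ⟨v, hv, hS⟩ := h
      refine ⟨c • v, ?_, ?_⟩
      · rw [Matrix.mulVec_smul, Matrix.mulVec_smul, ← smul_add, hv, smul_zero]
      · rw [← Prod.smul_mk, map_smul]
        exact Submodule.smul_mem _ _ hS
  obtain ⟨v', hv', hS⟩ := key
  rwa [restrictedCovector_congr hJ (add_right_cancel (hvw.trans hv'.symm)) rfl]

/-- The reduction of the linear Poisson bivector at a point. -/
noncomputable def reducedForm (B : ((ι → ℂ) →L[ℝ] ℂ) →ₗ[ℂ] ((ι → ℂ) →L[ℝ] ℂ) →ₗ[ℂ] ℂ)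
    (J : T →L[ℝ] (ι → ℂ)) (P : T →L[ℝ] Q) : (Q →L[ℝ] ℂ) →ₗ[ℂ] (Q →L[ℝ] ℂ) →ₗ[ℂ] ℂ :=
  B.compl₁₂ (extendCovector J ∘ₗ pullCovector P) (extendCovector J ∘ₗ pullCovector P)

theorem restrictedCovector_coeff {J : T →L[ℝ] (ι → ℂ)} (hJ : Function.Injective J)
    (α : T →L[ℝ] ℂ) : restrictedCovector J
      (holCoeff (extendCovector J α), antiholCoeff (extendCovector J α)) = α := by
  have h : ofCoeff (holCoeff (extendCovector J α)) (antiholCoeff (extendCovector J α)) =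
      extendCovector J α := by
    ext w
    rw [ofCoeff_apply, ← covector_apply]
  change (ofCoeff _ _).comp J = α
  rw [h, extendCovector_comp hJ]

namespace IsReductionAt

variable {J : T →L[ℝ] (ι → ℂ)} {P : T →L[ℝ] Q}

theorem form_apply (l : ℂ × ℂ) (α β : Q →L[ℝ] ℂ) :
    (l.1 • reducedForm (lieBivector e z) J P + l.2 • reducedForm (lieBivectorConj e z) J P) α β =
      l.1 * (holCoeff (extendCovector J (pullCovector P α)) ⬝ᵥ poissonMatrix e z *ᵥ
          holCoeff (extendCovector J (pullCovector P β))) +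
        l.2 * (antiholCoeff (extendCovector J (pullCovector P α)) ⬝ᵥ poissonMatrix e (star z) *ᵥ
          antiholCoeff (extendCovector J (pullCovector P β))) := by
  rw [← lieBivector_apply, ← lieBivectorConj_apply]
  rfl

/-- The kernels of the reduced bivectors are spanned by differentials of generators of `F_1`. -/
theorem pullCovector_mem_generatorSpan (h : IsReductionAt e z J P) (hV : IsAdmissible e V)
    (hz : z ∈ V) (hW : ∀ l ≠ 0, IsAdmissible e (W l) ∧ phi l z ∈ W l) {l : ℂ × ℂ} (hl : l ≠ 0)
    {α : Q →L[ℝ] ℂ} (hα : (l.1 • reducedForm (lieBivector e z) J P +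
      l.2 • reducedForm (lieBivectorConj e z) J P) α = 0) :
    pullCovector P α ∈ generatorSpan e V W z J := by
  have hα' (β : Q →L[ℝ] ℂ) := (form_apply l α β).symm.trans (LinearMap.congr_fun hα β)
  have hrel := h.isPencilReduction.rel α
  rw [← restrictedCovector_coeff h.inj (pullCovector P α)]
  set a := holCoeff (extendCovector J (pullCovector P α)) with ha
  set b := antiholCoeff (extendCovector J (pullCovector P α)) with hb
  change poissonMatrix e z *ᵥ a + poissonMatrix e (star z) *ᵥ b = 0 at hrel
  by_cases h1 : l.1 = 0
  · have h2 : l.2 ≠ 0 := fun h2 => hl (Prod.ext h1 h2)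
    obtain ⟨t, ht, hbt⟩ := (h.isPencilReduction.symm.form_eq_zero_iff (l₁ := l.2) (l₂ := l.1) h2
      α).1 (fun β => (add_comm _ _).trans (hα' β))
    change poissonMatrix e (star z) *ᵥ b = _ at hbt
    rw [h1, zero_smul, zero_add, smul_eq_zero, or_iff_right h2] at ht
    rw [restrictedCovector_congr h.range rfl hbt]
    exact restrictedCovector_mem_of_hol hV hz hW h.range ht (by rw [← hbt, hrel])
  · obtain ⟨t, ht, hat⟩ := (h.isPencilReduction.form_eq_zero_iff (l₂ := l.2) h1 α).1 hα'
    change poissonMatrix e z *ᵥ a = _ at hat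
    by_cases h2 : l.2 = 0
    · rw [h2, zero_smul, zero_add, smul_eq_zero, or_iff_right h1] at ht
      rw [restrictedCovector_congr h.range hat rfl]
      exact restrictedCovector_mem_of_antihol hV hz h.range ht (by rw [← hat, hrel])
    -- The scaling makes l.2 times this vector equal to t, so that the holomorphic part agrees with
    -- a; agreement of the other part follows from the two relations.
    · have hu : poissonMatrix e (phi (l.2, l.1) z) *ᵥ (l.2⁻¹ • t) = 0 := by
        rw [poissonMatrix_phi, Matrix.mulVec_smul, Matrix.add_mulVec, Matrix.smul_mulVec,
          Matrix.smul_mulVec, ht, smul_zero]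
      have hmem := restrictedCovector_mem_of_ne (V := V) hW J (l := (l.2, l.1)) h2 h1 hu
      rwa [restrictedCovector_congr h.range (a' := l.2 • l.2⁻¹ • t) (b' := l.1 • l.2⁻¹ • t)]
      · rw [smul_inv_smul₀ h2, hat]
      · rw [Matrix.mulVec_smul, Matrix.mulVec_smul, smul_comm, eq_neg_of_add_eq_zero_right ht,
          smul_neg, inv_smul_smul₀ h2, ← hat, eq_neg_of_add_eq_zero_right hrel]

/-- A covector that comes from a Casimir function `g ∘ φ_l`, where `l = (l₂, l₁)`, or from
a function `g̃`, lies in the kernel of the reduced bivector with parameters `(l₁, l₂)`. -/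
theorem form_eq_zero (h : IsReductionAt e z J P) {l : ℂ × ℂ} (hl : l.1 ≠ 0) {α : Q →L[ℝ] ℂ}
    {a b : ι → ℂ} (hα : pullCovector P α = restrictedCovector J (a, b))
    (ha : l.2 • poissonMatrix e z *ᵥ a + l.1 • poissonMatrix e (star z) *ᵥ a = 0) :
    (l.1 • reducedForm (lieBivector e z) J P + l.2 • reducedForm (lieBivectorConj e z) J P) α
      = 0 := by
  refine LinearMap.ext fun β => (form_apply l α β).trans ?_
  refine (h.isPencilReduction.form_eq_zero_iff hl α).2 ⟨a, ha, ?_⟩ β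
  have h1 : (extendCovector J (pullCovector P α)).comp J = (ofCoeff a b).comp J := by
    rw [extendCovector_comp h.inj, hα]
    rfl
  have h2 := ((comp_eq_iff_of_range h.range _ _).1 h1).1
  rw [holCoeff_ofCoeff] at h2
  exact h2

/-- Off the incompleteness set no nonzero combination of the two matrices drops rank, so their
kernels all have dimension `lieRank e` and the count for pencils applies. -/
theorem finrank_range_reducedForm_eq (h : IsReductionAt e z J P) (hV : IsAdmissible e V)
    (hz : z ∈ V) (hz' : z ∉ incompletenessSet e) {l l' : ℂ × ℂ} (hl : l ≠ 0) (hl' : l' ≠ 0) :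
    Module.finrank ℂ (LinearMap.range (l.1 • reducedForm (lieBivector e z) J P +
        l.2 • reducedForm (lieBivectorConj e z) J P)) =
      Module.finrank ℂ (LinearMap.range (l'.1 • reducedForm (lieBivector e z) J P +
        l'.2 • reducedForm (lieBivectorConj e z) J P)) := by
  refine h.isPencilReduction.finrank_range_eq _ _ (fun α β => lieBivector_apply e z _ _)
    (fun α β => lieBivectorConj_apply e z _ _) (hV.exists_antihol hz) (hV.exists_hol hz)
    (r := lieRank e) (fun l hl => ?_) hl hl'
  rw [← poissonMatrix_phi]
  exact finrank_ker_poissonMatrix fun hs => hz' ⟨l, hl, hs⟩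

end IsReductionAt

end Kernels

/-! ### Pencils of bivector fields of constant rank -/

section Pencil

variable {m : ℕ} {N : Type*} [TopologicalSpace N] [ChartedSpace (EuclideanSpace ℝ (Fin m)) N]
  {c₁ c₂ : BivectorField (𝓡 m) N}

/-- All nonzero members of the pencil spanned by `c₁` and `c₂` have the same pointwise ranks. -/
def IsEquirankPencil (c₁ c₂ : BivectorField (𝓡 m) N) : Prop :=
  ∀ l l' : ℂ × ℂ, l ≠ 0 → l' ≠ 0 → ∀ y,
    Module.finrank ℂ (LinearMap.range (l.1 • c₁ y + l.2 • c₂ y)) =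
      Module.finrank ℂ (LinearMap.range (l'.1 • c₁ y + l'.2 • c₂ y))

theorem bivectorRank_zero : bivectorRank (0 : BivectorField (𝓡 m) N) = 0 := by
  have h (y : N) : Module.finrank ℂ (LinearMap.range ((0 : BivectorField (𝓡 m) N) y)) = 0 := by
    rw [Pi.zero_apply, LinearMap.range_zero, finrank_bot]
  simp only [bivectorRank, h]
  exact le_antisymm (ciSup_le' fun _ => le_rfl) (Nat.zero_le _)

theorem finrank_range_le_bivectorRank (b : BivectorField (𝓡 m) N) (y : N) :
    Module.finrank ℂ (LinearMap.range (b y)) ≤ bivectorRank b := by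
  refine le_ciSup (f := fun y => Module.finrank ℂ (LinearMap.range (b y)))
    ⟨Module.finrank ℂ (EuclideanSpace ℝ (Fin m) →L[ℝ] ℂ), ?_⟩ y
  rintro _ ⟨y, rfl⟩
  have : Module.Finite ℂ (EuclideanSpace ℝ (Fin m) →L[ℝ] ℂ) :=
    Module.Finite.of_restrictScalars_finite ℝ ℂ _
  let B : (EuclideanSpace ℝ (Fin m) →L[ℝ] ℂ) →ₗ[ℂ] (EuclideanSpace ℝ (Fin m) →L[ℝ] ℂ) →ₗ[ℂ] ℂ :=
    b y
  exact LinearMap.finrank_range_le B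

theorem eq_zero_of_bivectorRank_eq_zero {b : BivectorField (𝓡 m) N} (hb : bivectorRank b = 0) :
    b = 0 := by
  funext y
  have h := finrank_range_le_bivectorRank b y
  rw [hb, Nat.le_zero] at h
  have : Module.Finite ℂ (EuclideanSpace ℝ (Fin m) →L[ℝ] ℂ) :=
    Module.Finite.of_restrictScalars_finite ℝ ℂ _
  let B : (EuclideanSpace ℝ (Fin m) →L[ℝ] ℂ) →ₗ[ℂ] (EuclideanSpace ℝ (Fin m) →L[ℝ] ℂ) →ₗ[ℂ] ℂ :=
    b y
  have hB : Module.finrank ℂ (LinearMap.range B) = 0 := h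
  have hB0 : B = 0 := LinearMap.range_eq_bot.1 (Submodule.finrank_eq_zero.1 hB)
  exact hB0

namespace IsEquirankPencil

theorem mem_maximalRankPart (h : IsEquirankPencil c₁ c₂) {l : ℂ × ℂ} (hl : l ≠ 0) :
    l.1 • c₁ + l.2 • c₂ ∈ maximalRankPart (Submodule.span ℂ {c₁, c₂}) := by
  refine ⟨Submodule.mem_span_pair.2 ⟨l.1, l.2, rfl⟩, fun b' hb' => ?_⟩
  obtain ⟨a₁, a₂, rfl⟩ := Submodule.mem_span_pair.1 hb'
  by_cases ha : ((a₁, a₂) : ℂ × ℂ) = 0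
  · obtain ⟨rfl, rfl⟩ := Prod.mk_eq_zero.1 ha
    rw [zero_smul, zero_smul, add_zero, bivectorRank_zero]
    exact Nat.zero_le _
  · exact (iSup_congr (h _ _ ha hl)).le

/-- Zero parameters can give maximal rank only if the whole pencil vanishes. Then every smooth
function is a Casimir function of every member, and the parameters (1, 0) serve as well. -/
theorem exists_mem_casimirs (h : IsEquirankPencil c₁ c₂) {b : BivectorField (𝓡 m) N}
    (hb : b ∈ maximalRankPart (Submodule.span ℂ {c₁, c₂})) {f : N → ℂ} (hf : f ∈ casimirs b) :
    ∃ l : ℂ × ℂ, l ≠ 0 ∧ f ∈ casimirs (l.1 • c₁ + l.2 • c₂) := by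
  obtain ⟨a₁, a₂, rfl⟩ := Submodule.mem_span_pair.1 hb.1
  by_cases ha : ((a₁, a₂) : ℂ × ℂ) = 0
  · obtain ⟨rfl, rfl⟩ := Prod.mk_eq_zero.1 ha
    have h1 := hb.2 _ (h.mem_maximalRankPart (l := (1, 0)) (by simp)).1
    have h0 : (0 : ℂ) • c₁ + (0 : ℂ) • c₂ = 0 := by rw [zero_smul, zero_smul, add_zero]
    rw [h0, bivectorRank_zero, Nat.le_zero] at h1
    refine ⟨(1, 0), by simp, hf.1, fun y => ?_⟩
    rw [eq_zero_of_bivectorRank_eq_zero h1]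
    rfl
  · exact ⟨_, ha, hf⟩

theorem casimirs_subset (h : IsEquirankPencil c₁ c₂) {l : ℂ × ℂ} (hl : l ≠ 0) {f : N → ℂ}
    (hf : f ∈ casimirs (l.1 • c₁ + l.2 • c₂)) :
    f ∈ firstIntegrals (Submodule.span ℂ {c₁, c₂}) :=
  Submodule.subset_span (Set.mem_biUnion (h.mem_maximalRankPart hl) hf)

end IsEquirankPencil

end Pencil

/-! ### Descent of functions -/

section Descent

open Filter Topology

variable {ι : Type*} [Fintype ι] [DecidableEq ι] {𝔤₀ : Type*} [LieRing 𝔤₀] [LieAlgebra ℝ 𝔤₀]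
  {e : Module.Basis ι ℝ 𝔤₀}
  {d m : ℕ} {X : Type*} [TopologicalSpace X] [ChartedSpace (EuclideanSpace ℝ (Fin d)) X]
  [IsManifold (𝓡 d) ∞ X]
  {N : Type*} [TopologicalSpace N] [ChartedSpace (EuclideanSpace ℝ (Fin m)) N]
  [IsManifold (𝓡 m) ∞ N]
  {z₀ : ι → ℂ} {j : X → ι → ℂ} {p : X → N}

/-- Composing with a local retraction extends f to the ambient space, where constancy along real
orbits applies. -/
theorem eq_of_vecDeriv_vanishes (hj : IsOpenInOrbit (d := d) e z₀ j)
    (hp : IsRealOrbitQuotient (d := d) (m := m) e j p) {f : X → ℂ}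
    (hf : ContMDiff (𝓡 d) 𝓘(ℝ, ℂ) ∞ f)
    (hf0 : ∀ x w, mapDeriv d m p x w = 0 → vecDeriv d f x w = 0) {x₀ x₁ : X}
    (hx : p x₀ = p x₁) : f x₁ = f x₀ := by
  refine eq_of_sameRealOrbitIn hj f (fun x _ => ?_) ((hp.fibre x₀ x₁).1 hx)
  obtain ⟨π, hπ, hπj⟩ := exists_local_retraction hj.smooth x (hj.immersion x)
  have hF : DifferentiableAt ℝ (f ∘ π) (j x) := by
    have h1 : ContMDiffAt 𝓘(ℝ, ι → ℂ) 𝓘(ℝ, ℂ) ∞ (f ∘ π) (j x) := (hf _).comp _ hπ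
    exact (contMDiffAt_iff_contDiffAt.1 h1).differentiableAt (by simp)
  have heq : f =ᶠ[𝓝 x] (f ∘ π) ∘ j := hπj.mono fun x' h => by
    rw [Function.comp_apply, Function.comp_apply, h]
  refine ⟨f ∘ π, hF, fun v hv => ?_, heq⟩
  obtain ⟨w, rfl⟩ : v ∈ Set.range (vecDeriv d j x) :=
    (hj.range_vecDeriv x).symm ▸ realOrbitTangent_subset _ hv
  have h0 := hf0 x w (((hp.isReductionAt hj x).ker w).2 hv)
  rwa [vecDeriv_congr heq, vecDeriv_comp (hj.mdifferentiableAt x) hF] at h0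

theorem exists_descent (hj : IsOpenInOrbit (d := d) e z₀ j)
    (hp : IsRealOrbitQuotient (d := d) (m := m) e j p) {f : X → ℂ}
    (hf : ContMDiff (𝓡 d) 𝓘(ℝ, ℂ) ∞ f)
    (hf0 : ∀ x w, mapDeriv d m p x w = 0 → vecDeriv d f x w = 0) :
    ∃ h : N → ℂ, ContMDiff (𝓡 m) 𝓘(ℝ, ℂ) ∞ h ∧ h ∘ p = f := by
  have hdesc (x : X) : f (Function.surjInv hp.surjective (p x)) = f x :=
    eq_of_vecDeriv_vanishes hj hp hf hf0 (Function.surjInv_eq hp.surjective (p x)).symm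
  refine ⟨f ∘ Function.surjInv hp.surjective, fun y => ?_, funext hdesc⟩
  obtain ⟨x, rfl⟩ := hp.surjective y
  -- The global choice of preimages need not be continuous; constancy on fibres lets a smooth local
  -- section replace it.
  obtain ⟨σ, hσ, hpσ⟩ := exists_local_section hp.smooth x (hp.submersion x)
  have h1 : ContMDiffAt (𝓡 m) 𝓘(ℝ, ℂ) ∞ (f ∘ σ) (p x) := (hf _).comp _ hσ
  refine h1.congr_of_eventuallyEq (hpσ.mono fun y hy => ?_)
  have h2 := hdesc (σ y)
  rw [hy] at h2
  exact h2

end Descent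

/-! ### The reduced pencil -/

section Main

open Filter Topology

variable {ι : Type*} [Fintype ι] [DecidableEq ι] {𝔤₀ : Type*} [LieRing 𝔤₀] [LieAlgebra ℝ 𝔤₀]
  {e : Module.Basis ι ℝ 𝔤₀}
  {d m : ℕ} {X : Type*} [TopologicalSpace X] [ChartedSpace (EuclideanSpace ℝ (Fin d)) X]
  [IsManifold (𝓡 d) ∞ X]
  {N : Type*} [TopologicalSpace N] [ChartedSpace (EuclideanSpace ℝ (Fin m)) N]
  [IsManifold (𝓡 m) ∞ N]
  {z₀ : ι → ℂ} {j : X → ι → ℂ} {p : X → N} {V : Set (ι → ℂ)} {W : ℂ × ℂ → Set (ι → ℂ)}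

variable (e d m) in
/-- `c₁` and `c₂` are given at the point `p x` by the reductions of the linear Poisson bivector and
of its conjugate at `j x`. -/
structure IsReducedPencil (j : X → ι → ℂ) (p : X → N) (c₁ c₂ : BivectorField (𝓡 m) N) : Prop where
  left : ∀ x, c₁ (p x) = reducedForm (lieBivector e (j x)) (vecDeriv d j x) (mapDeriv d m p x)
  right : ∀ x, c₂ (p x) = reducedForm (lieBivectorConj e (j x)) (vecDeriv d j x) (mapDeriv d m p x)

/-- The reductions are defined at a chosen point of each fibre; `lieBivector_pull_eq` makes the
choice immaterial. -/
theorem exists_isReducedPencil (hj : IsOpenInOrbit (d := d) e z₀ j)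
    (hp : IsRealOrbitQuotient (d := d) (m := m) e j p) :
    ∃ c₁ c₂ : BivectorField (𝓡 m) N, IsReducedPencil e d m j p c₁ c₂ := by
  let σ := Function.surjInv hp.surjective
  have hσ (x : X) : p x = p (σ (p x)) := (Function.surjInv_eq hp.surjective (p x)).symm
  refine ⟨fun y => reducedForm (lieBivector e (j (σ y))) (vecDeriv d j (σ y))
    (mapDeriv d m p (σ y)), fun y => reducedForm (lieBivectorConj e (j (σ y)))
    (vecDeriv d j (σ y)) (mapDeriv d m p (σ y)), ⟨fun x => ?_, fun x => ?_⟩⟩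
  · exact LinearMap.ext₂ fun α β => (lieBivector_pull_eq hj hp (hσ x) α β).1
  · exact LinearMap.ext₂ fun α β => (lieBivector_pull_eq hj hp (hσ x) α β).2

namespace IsReducedPencil

variable {c₁ c₂ : BivectorField (𝓡 m) N}

theorem isReduction (h : IsReducedPencil e d m j p c₁ c₂) (hj : IsOpenInOrbit (d := d) e z₀ j) :
    IsReduction (d := d) e j p c₁ c₂ := by
  refine ⟨fun x => (lieBivector e (j x)).compl₁₂ (extendCovector (vecDeriv d j x))
      (extendCovector (vecDeriv d j x)),
    fun x => (lieBivectorConj e (j x)).compl₁₂ (extendCovector (vecDeriv d j x))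
      (extendCovector (vecDeriv d j x)), fun x α β => ?_, fun x α β => ?_, fun x α β => ?_,
      fun x α β => ?_⟩
  · exact lieBivector_congr (hj.range_vecDeriv x)
      (extendCovector_comp (hj.vecDeriv_injective x) _).symm
      (extendCovector_comp (hj.vecDeriv_injective x) _).symm
  · exact lieBivectorConj_congr (hj.range_vecDeriv x)
      (extendCovector_comp (hj.vecDeriv_injective x) _).symm
      (extendCovector_comp (hj.vecDeriv_injective x) _).symm
  · rw [h.left]
    rfl
  · rw [h.right]
    rfl

theorem isEquirankPencil (h : IsReducedPencil e d m j p c₁ c₂)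
    (hj : IsOpenInOrbit (d := d) e z₀ j) (hp : IsRealOrbitQuotient (d := d) (m := m) e j p)
    (hV : IsAdmissible e V) (hjV : Set.range j ⊆ V)
    (hdisj : Disjoint (Set.range j) (incompletenessSet e)) : IsEquirankPencil c₁ c₂ := by
  intro l l' hl hl' y
  obtain ⟨x, rfl⟩ := hp.surjective y
  rw [h.left, h.right]
  exact (hp.isReductionAt hj x).finrank_range_reducedForm_eq hV (hjV ⟨x, rfl⟩)
    (Set.disjoint_left.1 hdisj ⟨x, rfl⟩) hl hl'

end IsReducedPencil

theorem contDiffAt_generator (hV : IsAdmissible e V) (hjV : Set.range j ⊆ V)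
    (hW : ∀ l ≠ 0, IsAdmissible e (W l) ∧ phi l '' Set.range j ⊆ W l) {G : (ι → ℂ) → ℂ}
    (hG : G ∈ F1Generators e id V W) (x : X) : ContDiffAt ℝ ∞ G (j x) :=
  F1Generators_contDiffAt hV.1 (fun l hl => (hW l hl).1.1) (hjV ⟨x, rfl⟩)
    (fun l hl => (hW l hl).2 ⟨_, ⟨x, rfl⟩, rfl⟩) hG

theorem generatorSpan_eq_span_vecDeriv (hj : IsOpenInOrbit (d := d) e z₀ j)
    (hV : IsAdmissible e V) (hjV : Set.range j ⊆ V)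
    (hW : ∀ l ≠ 0, IsAdmissible e (W l) ∧ phi l '' Set.range j ⊆ W l) (x : X) :
    generatorSpan e V W (j x) (vecDeriv d j x) =
      Submodule.span ℂ ((fun s => vecDeriv d s x) '' F1Generators e j V W) := by
  rw [F1Generators_eq_image, Set.image_image, generatorSpan]
  congr 1
  refine Set.image_congr fun G hG => ?_
  exact (vecDeriv_comp (hj.mdifferentiableAt x)
    ((contDiffAt_generator hV hjV hW hG x).differentiableAt (by simp))).symm

end Main

/-! ### First integrals -/

section FirstIntegrals

open Filter Topology

variable {ι : Type*} [Fintype ι] [DecidableEq ι] {𝔤₀ : Type*} [LieRing 𝔤₀] [LieAlgebra ℝ 𝔤₀]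
  {e : Module.Basis ι ℝ 𝔤₀}
  {d m : ℕ} {X : Type*} [TopologicalSpace X] [ChartedSpace (EuclideanSpace ℝ (Fin d)) X]
  [IsManifold (𝓡 d) ∞ X]
  {N : Type*} [TopologicalSpace N] [ChartedSpace (EuclideanSpace ℝ (Fin m)) N]
  [IsManifold (𝓡 m) ∞ N]
  {z₀ : ι → ℂ} {j : X → ι → ℂ} {p : X → N} {V : Set (ι → ℂ)} {W : ℂ × ℂ → Set (ι → ℂ)}
  {c₁ c₂ : BivectorField (𝓡 m) N}

/-- The differential of a Casimir function lies in the kernel of a reduced form with nonzero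
parameters, hence in the span. Differentiability is carried along the induction because the
derivative of a sum needs it. -/
theorem IsReducedPencil.pullCovector_firstIntegral_mem (h : IsReducedPencil e d m j p c₁ c₂)
    (hj : IsOpenInOrbit (d := d) e z₀ j) (hp : IsRealOrbitQuotient (d := d) (m := m) e j p)
    (hV : IsAdmissible e V) (hjV : Set.range j ⊆ V)
    (hW : ∀ l ≠ 0, IsAdmissible e (W l) ∧ phi l '' Set.range j ⊆ W l)
    (heq : IsEquirankPencil c₁ c₂) {s : N → ℂ}
    (hs : s ∈ firstIntegrals (Submodule.span ℂ {c₁, c₂})) (x : X) :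
    MDifferentiableAt (𝓡 m) 𝓘(ℝ, ℂ) s (p x) ∧ pullCovector (mapDeriv d m p x) (vecDeriv m s (p x)) ∈
      generatorSpan e V W (j x) (vecDeriv d j x) := by
  induction hs using Submodule.span_induction with
  | mem s hs =>
    obtain ⟨b, hb, hs⟩ := Set.mem_iUnion₂.1 hs
    obtain ⟨l, hl, hs⟩ := heq.exists_mem_casimirs hb hs
    refine ⟨(hs.1 _).mdifferentiableAt (by simp), ?_⟩
    refine (hp.isReductionAt hj x).pullCovector_mem_generatorSpan hV (hjV ⟨x, rfl⟩)
      (fun l hl => ⟨(hW l hl).1, (hW l hl).2 ⟨_, ⟨x, rfl⟩, rfl⟩⟩) hl ?_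
    rw [← h.left, ← h.right]
    exact hs.2 (p x)
  | zero =>
    refine ⟨mdifferentiableAt_const, ?_⟩
    rw [vecDeriv_const (f := (0 : N → ℂ)) (c := 0) (Eventually.of_forall fun _ => rfl), map_zero]
    exact Submodule.zero_mem _
  | add s t _ _ hs ht =>
    refine ⟨hs.1.add ht.1, ?_⟩
    have : vecDeriv m (s + t) (p x) = vecDeriv m s (p x) + vecDeriv m t (p x) :=
      mfderiv_add hs.1 ht.1
    rw [this, map_add]
    exact Submodule.add_mem _ hs.2 ht.2
  | smul c s _ hs =>
    have hc : vecDeriv m (c • s) (p x) = c • vecDeriv m s (p x) := by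
      have hd : HasFDerivAt (fun w : ℂ => c • w) (c • ContinuousLinearMap.id ℝ ℂ) (s (p x)) :=
        (hasFDerivAt_id (s (p x))).fun_const_smul c
      have h1 : c • s = (fun w : ℂ => c • w) ∘ s := rfl
      rw [h1, vecDeriv_comp hs.1 hd.differentiableAt, hd.fderiv]
      rfl
    refine ⟨?_, ?_⟩
    · have hd : DifferentiableAt ℝ (fun w : ℂ => c • w) (s (p x)) := by fun_prop
      exact hd.mdifferentiableAt.comp (p x) hs.1
    · rw [hc, map_smul]
      exact Submodule.smul_mem _ _ hs.2

theorem generatorSpan_vanishes (hj : IsOpenInOrbit (d := d) e z₀ j)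
    (hp : IsRealOrbitQuotient (d := d) (m := m) e j p)
    (hV : IsAdmissible e V) (hjV : Set.range j ⊆ V)
    (hW : ∀ l ≠ 0, IsAdmissible e (W l) ∧ phi l '' Set.range j ⊆ W l) (x : X)
    {w : EuclideanSpace ℝ (Fin d)} (hw : mapDeriv d m p x w = 0)
    {α : EuclideanSpace ℝ (Fin d) →L[ℝ] ℂ}
    (hα : α ∈ generatorSpan e V W (j x) (vecDeriv d j x)) : α w = 0 := by
  induction hα using Submodule.span_induction with
  | mem α hα =>
    obtain ⟨G, hG, rfl⟩ := hα
    exact F1Generators_fderiv_eq_zero hV.1 (fun l hl => (hW l hl).1.1) (hjV ⟨x, rfl⟩)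
      (fun l hl => (hW l hl).2 ⟨_, ⟨x, rfl⟩, rfl⟩) hG _ (((hp.isReductionAt hj x).ker w).1 hw)
  | zero => rfl
  | add α β _ _ hα hβ => rw [_root_.add_apply, hα, hβ, add_zero]
  | smul c α _ hα => rw [_root_.smul_apply, hα, smul_zero]

/-- A generator of `F_1` whose holomorphic coefficients satisfy the equation of the kernel of
a member of the pencil descends to a first integral. -/
theorem IsReducedPencil.exists_firstIntegral (h : IsReducedPencil e d m j p c₁ c₂)
    (hj : IsOpenInOrbit (d := d) e z₀ j) (hp : IsRealOrbitQuotient (d := d) (m := m) e j p)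
    (hV : IsAdmissible e V) (hjV : Set.range j ⊆ V)
    (hW : ∀ l ≠ 0, IsAdmissible e (W l) ∧ phi l '' Set.range j ⊆ W l)
    (heq : IsEquirankPencil c₁ c₂) {G : (ι → ℂ) → ℂ} (hG : G ∈ F1Generators e id V W)
    {l : ℂ × ℂ} (hl : l.1 ≠ 0) (a b : X → ι → ℂ)
    (hab : ∀ x, fderiv ℝ G (j x) = ofCoeff (a x) (b x))
    (ha : ∀ x, l.2 • poissonMatrix e (j x) *ᵥ a x + l.1 • poissonMatrix e (star (j x)) *ᵥ a x = 0) :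
    ∃ s ∈ firstIntegrals (Submodule.span ℂ {c₁, c₂}), ∀ x,
      pullCovector (mapDeriv d m p x) (vecDeriv m s (p x)) =
        (fderiv ℝ G (j x)).comp (vecDeriv d j x) := by
  have hGd (x : X) := contDiffAt_generator hV hjV hW hG x
  have hder (x : X) : vecDeriv d (G ∘ j) x = (fderiv ℝ G (j x)).comp (vecDeriv d j x) :=
    vecDeriv_comp (hj.mdifferentiableAt x) ((hGd x).differentiableAt (by simp))
  -- The generator is stationary along real orbits, hence is a smooth function on the quotient; the
  -- kernel equation then makes it a Casimir function there.
  obtain ⟨s, hs, hsG⟩ := exists_descent hj hp (f := G ∘ j)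
    (fun x => (hGd x).contMDiffAt.comp x (hj.smooth x)) (fun x w hw => by
      rw [hder]
      exact generatorSpan_vanishes hj hp hV hjV hW x hw (Submodule.subset_span ⟨G, hG, rfl⟩))
  have hpull (x : X) : pullCovector (mapDeriv d m p x) (vecDeriv m s (p x)) =
      (fderiv ℝ G (j x)).comp (vecDeriv d j x) := by
    rw [← hder, ← hsG, vecDeriv_comp_map (hp.mdifferentiableAt x)
      ((hs (p x)).mdifferentiableAt (by simp)), pullCovector_apply]
  refine ⟨s, heq.casimirs_subset (l := l) (fun h0 => hl (by rw [h0]; rfl)) ⟨hs, fun y => ?_⟩, hpull⟩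
  obtain ⟨x, rfl⟩ := hp.surjective y
  have h0 := (hp.isReductionAt hj x).form_eq_zero hl ((hpull x).trans (by rw [hab x]; rfl)) (ha x)
  rw [← h.left, ← h.right] at h0
  exact h0

/-- A Casimir g has zero differential on the orbit and is matched by the first integral 0. The
function g̃ belongs to the parameters (1, 0), and g ∘ φ_l to the interchanged parameters (l₂, l₁).
-/
theorem IsReducedPencil.exists_firstIntegral_of_generator (h : IsReducedPencil e d m j p c₁ c₂)
    (hj : IsOpenInOrbit (d := d) e z₀ j) (hp : IsRealOrbitQuotient (d := d) (m := m) e j p)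
    (hV : IsAdmissible e V) (hjV : Set.range j ⊆ V)
    (hW : ∀ l ≠ 0, IsAdmissible e (W l) ∧ phi l '' Set.range j ⊆ W l)
    (heq : IsEquirankPencil c₁ c₂) {G : (ι → ℂ) → ℂ} (hG : G ∈ F1Generators e id V W) :
    ∃ s ∈ firstIntegrals (Submodule.span ℂ {c₁, c₂}), ∀ x,
      pullCovector (mapDeriv d m p x) (vecDeriv m s (p x)) =
        (fderiv ℝ G (j x)).comp (vecDeriv d j x) := by
  have hmem (x : X) : j x ∈ V := hjV ⟨x, rfl⟩
  obtain ((⟨g, hg, rfl⟩ | ⟨g, hg, rfl⟩) | ⟨l, h1, h2, g, hg, rfl⟩) := id hG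
  · refine ⟨0, Submodule.zero_mem _, fun x => ?_⟩
    rw [vecDeriv_const (f := (0 : N → ℂ)) (c := 0) (Eventually.of_forall fun _ => rfl), map_zero]
    have h10 : phi (1, 0) (j x) = j x := by simp [phi_eq]
    have hfd := hasFDerivAt_comp_phi hV.1 hg.1 (1, 0) (z := j x) (by rw [h10]; exact hmem x)
    have hid : g ∘ phi (1, 0) = g ∘ id := by
      funext w; simp [phi_eq]
    rw [hid, h10] at hfd
    rw [hfd.fderiv]
    symm
    have h0 := restrictedCovector_congr (hj.range_vecDeriv x) (e := e) (a' := 0) (b' := 0)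
      (a := (1 : ℂ) • holGrad g (j x)) (b := (0 : ℂ) • holGrad g (j x))
      (by rw [one_smul, poissonMatrix_mulVec_holGrad hg (hmem x), Matrix.mulVec_zero])
      (by rw [zero_smul])
    rw [← Prod.zero_eq_mk, map_zero] at h0
    exact h0
  · refine h.exists_firstIntegral hj hp hV hjV hW heq hG (l := (1, 0)) one_ne_zero
      (fun x => star (holGrad g (j x))) (fun x => tildeCoeff g (j x))
      (fun x => (hasFDerivAt_tildeFun hV.1 hg.1 (hmem x)).fderiv) (fun x => ?_)
    rw [poissonMatrix_star_mulVec, poissonMatrix_mulVec_holGrad hg (hmem x), star_zero, smul_zero,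
      zero_smul, zero_add]
  · obtain ⟨hadm, hsub⟩ := hW l fun h0 => h1 (by rw [h0]; rfl)
    have hmem' (x : X) : phi l (j x) ∈ W l := hsub ⟨_, ⟨x, rfl⟩, rfl⟩
    refine h.exists_firstIntegral hj hp hV hjV hW heq hG (l := (l.2, l.1)) h2
      (fun x => l.1 • holGrad g (phi l (j x))) (fun x => l.2 • holGrad g (phi l (j x)))
      (fun x => (hasFDerivAt_comp_phi hadm.1 hg.1 l (hmem' x)).fderiv) (fun x => ?_)
    rw [← Matrix.smul_mulVec, ← Matrix.smul_mulVec, ← Matrix.add_mulVec, ← poissonMatrix_phi,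
      Matrix.mulVec_smul, poissonMatrix_mulVec_holGrad hg (hmem' x), smul_zero]

/-- Functions functionally generated by the first integrals correspond to functions functionally
generated by the generators of `F_1`. -/
theorem IsReducedPencil.image_functionallyGenerated (h : IsReducedPencil e d m j p c₁ c₂)
    (hj : IsOpenInOrbit (d := d) e z₀ j) (hp : IsRealOrbitQuotient (d := d) (m := m) e j p)
    (hV : IsAdmissible e V) (hjV : Set.range j ⊆ V)
    (hW : ∀ l ≠ 0, IsAdmissible e (W l) ∧ phi l '' Set.range j ⊆ W l)
    (heq : IsEquirankPencil c₁ c₂) :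
    (fun f => f ∘ p) '' functionallyGenerated (𝓡 m) Set.univ
        (firstIntegrals (Submodule.span ℂ {c₁, c₂}) : Set (N → ℂ)) =
      functionallyGenerated (𝓡 d) Set.univ (F1Generators e j V W) := by
  ext f
  constructor
  · rintro ⟨f, ⟨hf, hspan⟩, rfl⟩
    rw [contMDiffOn_univ] at hf
    refine ⟨(hf.comp hp.smooth).contMDiffOn, fun x _ => ?_⟩
    have h1 : vecDeriv m f (p x) ∈ Submodule.span ℂ ((fun s => vecDeriv m s (p x)) ''
      (firstIntegrals (Submodule.span ℂ {c₁, c₂}) : Set (N → ℂ))) := hspan (p x) trivial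
    have hle : Submodule.span ℂ ((fun s => vecDeriv m s (p x)) ''
        (firstIntegrals (Submodule.span ℂ {c₁, c₂}) : Set (N → ℂ))) ≤
        (generatorSpan e V W (j x) (vecDeriv d j x)).comap (pullCovector (mapDeriv d m p x)) := by
      rw [Submodule.span_le]
      rintro _ ⟨s, hs, rfl⟩
      exact (h.pullCovector_firstIntegral_mem hj hp hV hjV hW heq hs x).2
    have h2 := hle h1
    rw [generatorSpan_eq_span_vecDeriv hj hV hjV hW, Submodule.mem_comap, pullCovector_apply,
      ← vecDeriv_comp_map (hp.mdifferentiableAt x) ((hf (p x)).mdifferentiableAt (by simp))] at h2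
    exact h2
  · rintro ⟨hf, hspan⟩
    rw [contMDiffOn_univ] at hf
    have hspan' (x : X) : vecDeriv d f x ∈ generatorSpan e V W (j x) (vecDeriv d j x) := by
      rw [generatorSpan_eq_span_vecDeriv hj hV hjV hW]
      exact hspan x trivial
    obtain ⟨F, hF, rfl⟩ := exists_descent hj hp hf fun x w hw =>
      generatorSpan_vanishes hj hp hV hjV hW x hw (hspan' x)
    refine ⟨F, ⟨hF.contMDiffOn, fun y _ => ?_⟩, rfl⟩
    obtain ⟨x, rfl⟩ := hp.surjective y
    -- Each generating differential on X is the pull-back of the differential of a first integral.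
    -- Injectivity of the pull-back then brings the membership for f down to the quotient.
    have hle : generatorSpan e V W (j x) (vecDeriv d j x) ≤
        (Submodule.span ℂ ((fun s => vecDeriv m s (p x)) ''
          (firstIntegrals (Submodule.span ℂ {c₁, c₂}) : Set (N → ℂ)))).map
            (pullCovector (mapDeriv d m p x)) := by
      rw [generatorSpan, Submodule.span_le]
      rintro _ ⟨G, hG, rfl⟩
      obtain ⟨s, hs, hsG⟩ := h.exists_firstIntegral_of_generator hj hp hV hjV hW heq hG
      exact ⟨_, Submodule.subset_span ⟨s, hs, rfl⟩, hsG x⟩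
    obtain ⟨α, hα, hαF⟩ := hle (hspan' x)
    rw [vecDeriv_comp_map (hp.mdifferentiableAt x) ((hF (p x)).mdifferentiableAt (by simp)),
      ← pullCovector_apply] at hαF
    rw [(hp.isReductionAt hj x).pullCovector_injective hαF] at hα
    exact hα

end FirstIntegrals

/-! ### The proposition -/

theorem mainTheorem3 {ι : Type*} [Fintype ι] [DecidableEq ι]
    {𝔤₀ : Type*} [LieRing 𝔤₀] [LieAlgebra ℝ 𝔤₀] (e : Module.Basis ι ℝ 𝔤₀)
    (hnonabelian : ¬ IsLieAbelian 𝔤₀)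
    (hcodim : 3 ≤ (MvPolynomial.vanishingIdeal ℂ (singSet e)).height) :
    -- part (i)
    (∀ (U : Set (ι → ℂ)) (W : ℂ × ℂ → Set (ι → ℂ)), IsOpen U → IsStronglyAdmissible e U →
      (∀ l : ℂ × ℂ, l ≠ 0 → IsAdmissible e (W l) ∧ phi l '' U ⊆ W l) →
      ∀ f ∈ functionallyGenerated 𝓘(ℝ, ι → ℂ) U (F1Generators e id U W),
        IsRealInvariantOn e U f ∧
          ((∀ A ∈ realCoadjointGroup e, ∀ z ∈ U, A *ᵥ z ∈ U) →
            ∀ A ∈ realCoadjointGroup e, ∀ z ∈ U, f (A *ᵥ z) = f z)) ∧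
    -- part (ii)
    (∀ (d m : ℕ) (X : Type*) (N : Type*) [TopologicalSpace X] [ChartedSpace (EuclideanSpace ℝ (Fin d)) X]
      [IsManifold (𝓡 d) ∞ X] [TopologicalSpace N] [T2Space N] [SecondCountableTopology N]
      [ChartedSpace (EuclideanSpace ℝ (Fin m)) N] [IsManifold (𝓡 m) ∞ N]
      (z₀ : ι → ℂ) (j : X → ι → ℂ) (p : X → N) (V : Set (ι → ℂ)) (W : ℂ × ℂ → Set (ι → ℂ)),
      IsOpenInOrbit (d := d) e z₀ j → IsRealOrbitQuotient (d := d) (m := m) e j p → IsStronglyAdmissible e (Set.range j) →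
      IsAdmissible e V → Set.range j ⊆ V →
      (∀ l : ℂ × ℂ, l ≠ 0 → IsAdmissible e (W l) ∧ phi l '' Set.range j ⊆ W l) →
      ∃ c₁ c₂ : BivectorField (𝓡 m) N, IsReduction (d := d) e j p c₁ c₂ ∧
        (fun f => f ∘ p) '' functionallyGenerated (𝓡 m) Set.univ
            (firstIntegrals (Submodule.span ℂ {c₁, c₂}) : Set (N → ℂ)) =
          functionallyGenerated (𝓡 d) Set.univ (F1Generators e j V W)) := by
  refine ⟨fun U W hU _ hW f hf => ?_, fun d m X N _ _ _ _ _ _ _ _ z₀ j p V W hj hp hadm hV hjV hW => ?_⟩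
  · have hinv : IsRealInvariantOn e U f := invariant_of_mem_functionallyGenerated hU
      (fun l hl => ⟨(hW l hl).1.1, (hW l hl).2⟩) hf
    exact ⟨hinv, fun hA A hA' z hz => hinv.apply_mulVec hA hA' hz⟩
  · obtain ⟨c₁, c₂, h⟩ := exists_isReducedPencil hj hp
    exact ⟨c₁, c₂, h.isReduction hj, h.image_functionallyGenerated hj hp hV hjV hW
      (h.isEquirankPencil hj hp hV hjV hadm.1)⟩
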